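/- Let $P$ be a probability measure on environments $\omega=(\omega_x)_{x\in\mathbb Z}\in[0,1]^{\mathbb Z}$ under which the $\omega_x$ are i.i.d. and which is not concentrated on $\omega_0=1$ (that is, $P(\omega_0=1)<1$). Write $E$ for expectation under $P$. For an environment $\omega$ let $P_\omega$ be the law of the Markov chain $(X_k)_{k\ge 0}$ on $\mathbb Z$ with $X_0=0$ which jumps from $y$ to $y+1$ with probability $\omega_y$ and to $y-1$ with probability $1-\omega_y$; let $E_\omega$ and $\mathrm{Var}_\omega$ be the expectation and the variance under $P_\omega$. Put $T_n=\inf\{k\ge 0: X_k=n\}$ and $\rho_x=\frac{1-\omega_x}{\omega_x}\in[0,\infty]$, and assume that $$\kappa:=\sup\{p>0: E[\rho_0^p]<1\}\in(2,\infty].$$ Then, for $P$-almost every $\omega$, for every $n\ge 0$ the time $T_n$ is $P_\omega$-a.s. finite with $E_\omega[T_n^2]<\infty$, and $\sigma^2:=E[\mathrm{Var}_\omega(T_1)]\in(0,\infty)$. Moreover, with $$F_{n,\omega}(x)=P_\omega\left(\frac{T_n-E_\omega[T_n]}{\sigma\sqrt n}\le x\right),$$ $\Phi$ the standard normal distribution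 function and $\|\cdot\|_\infty$ the supremum norm on $\mathbb R$: - if $\kappa>4$, then for every $\varepsilon>0$, $\ \lim_{n\to\infty} n^{\frac12-\varepsilon}\,\|F_{n,\omega}-\Phi\|_\infty=0$ for $P$-almost every $\omega$; - if $\kappa\in(2,4]$, then for every $\varepsilon>0$, $\ \lim_{n\to\infty} n^{1-\frac2\kappa-\varepsilon}\,\|F_{n,\omega}-\Phi\|_\infty=0$ for $P$-almost every $\omega$. -/

import Mathlib

open MeasureTheory ProbabilityTheory Filter Topology
open scoped ENNReal

noncomputable section

namespace RWRE

/-- Environments: families of numbers in the closed unit interval indexed by the integers,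
with the product sigma-algebra. -/
abbrev Env : Type := ℤ → unitInterval

/-- One step of the walk in the environment `ω`: from `y` jump to `y + 1` with probability `ω y`
and to `y - 1` with probability `1 - ω y`. -/
def stepMeasure (ω : Env) (y : ℤ) : Measure ℤ :=
  ENNReal.ofReal (ω y : ℝ) • Measure.dirac (y + 1)
    + ENNReal.ofReal (1 - (ω y : ℝ)) • Measure.dirac (y - 1)

instance (ω : Env) (y : ℤ) : IsProbabilityMeasure (stepMeasure ω y) := by
  constructor
  have h0 : 0 ≤ (ω y : ℝ) := (ω y).2.1
  have h1 : 0 ≤ 1 - (ω y : ℝ) := sub_nonneg.2 (ω y).2.2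
  simp only [stepMeasure, Measure.add_apply, Measure.smul_apply, measure_univ, smul_eq_mul,
    mul_one]
  rw [← ENNReal.ofReal_add h0 h1]
  simp

/-- The transition kernel that, given the path up to time `n`, makes one step from the position
at time `n`. -/
def pathKernel (ω : Env) (n : ℕ) : Kernel ((i : Finset.Iic n) → (fun _ : ℕ => ℤ) i) ℤ where
  toFun h := stepMeasure ω (h ⟨n, Finset.mem_Iic.2 le_rfl⟩)
  measurable' := (measurable_of_countable (stepMeasure ω)).comp (measurable_pi_apply _)

instance (ω : Env) (n : ℕ) : IsMarkovKernel (pathKernel ω n) :=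
  ⟨fun h => inferInstanceAs (IsProbabilityMeasure
    (stepMeasure ω (h ⟨n, Finset.mem_Iic.2 le_rfl⟩)))⟩

/-- The quenched law of the walk started at `x` in the environment `ω`: the law on path space of
the Markov chain with initial position `x` and one-step transitions `stepMeasure ω`
(Ionescu-Tulcea). -/
def quenchedLaw (ω : Env) (x : ℤ) : Measure (ℕ → ℤ) :=
  Kernel.trajMeasure (X := fun _ : ℕ => ℤ) (Measure.dirac x) (pathKernel ω)

/-- The hitting time `T n = inf {k ≥ 0 : X k = n}`, equal to `⊤` if `n` is never visited. -/
def hitTime (n : ℤ) (X : ℕ → ℤ) : ℕ∞ :=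
  hittingAfter (fun (k : ℕ) (Y : ℕ → ℤ) => Y k) {n} 0 X

/-- The hitting time as a real number; the value where `T n = ⊤` is a dummy value. -/
def hitTimeReal (n : ℤ) (X : ℕ → ℤ) : ℝ := ((hitTime n X).toNat : ℝ)

/-- The quenched mean of `T n` for the walk started at `0`. -/
def quenchedMean (ω : Env) (n : ℤ) : ℝ := ∫ X, hitTimeReal n X ∂(quenchedLaw ω 0)

/-- The quenched variance of `T n` for the walk started at `0`. -/
def quenchedVar (ω : Env) (n : ℤ) : ℝ := variance (hitTimeReal n) (quenchedLaw ω 0)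

/-- `σ² = E[Var_ω(T 1)]`. -/
def sigmaSq (P : Measure Env) : ℝ := ∫ ω, quenchedVar ω 1 ∂P

/-- `F_{n,ω}(x)`: the quenched distribution function of `(T n - E_ω[T n]) / (σ √n)`. -/
def quenchedCDF (P : Measure Env) (ω : Env) (n : ℕ) (x : ℝ) : ℝ :=
  (quenchedLaw ω 0).real
    {X | (hitTimeReal n X - quenchedMean ω n) / (√(sigmaSq P) * √(n : ℝ)) ≤ x}

/-- The supremum distance between `F_{n,ω}` and the standard normal distribution function. -/
def supDist (P : Measure Env) (ω : Env) (n : ℕ) : ℝ :=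
  ⨆ x : ℝ, |quenchedCDF P ω n x - cdf (gaussianReal 0 1) x|

/-- `ρ x = (1 - ω x) / ω x`, with the value `∞` if `ω x = 0`. -/
def rho (ω : Env) (x : ℤ) : ℝ≥0∞ := ENNReal.ofReal (1 - (ω x : ℝ)) / ENNReal.ofReal (ω x : ℝ)

/-- `κ = sup {p > 0 : E[(ρ 0) ^ p] < 1}`, an element of `[0, ∞]`. -/
def kappa (P : Measure Env) : ℝ≥0∞ :=
  sSup {q : ℝ≥0∞ | ∃ p : ℝ, 0 < p ∧ ∫⁻ ω, rho ω 0 ^ p ∂P < 1 ∧ q = ENNReal.ofReal p}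

/-- The coordinates `ω x`, `x ∈ ℤ`, are independent and identically distributed under `P`. -/
def IsIID (P : Measure Env) : Prop :=
  iIndepFun (fun (x : ℤ) (ω : Env) => ω x) P ∧
    ∀ x : ℤ, IdentDistrib (fun ω : Env => ω x) (fun ω : Env => ω 0) P P

end RWRE

end

open MeasureTheory ProbabilityTheory Filter Topology
open scoped ENNReal

noncomputable section

namespace RWRE

/-! A nearest-neighbour walk must visit every site between `0` and `n`, so in a fixed environment
`T_n` is the sum of the crossing times from `k` to `k + 1`, `0 ≤ k < n`, and these are independent
by the strong Markov property. The distance to the normal law is then a Berry–Esseen problem for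
independent, non-identically distributed summands. Two errors matter: the normalised sum of quenched
third moments, and the discrepancy between the quenched variance of `T_n` and `nσ²`, since the
normalisation is deterministic.

First-step analysis expresses the moments of the crossing time at `x` through those at `x - 1`, with
`ρ_x` as random multiplier. The quantities at `x - 1` depend only on sites up to `x - 1`, hence are
independent of `ρ_x`, and they are stationary. So `E[ρ^q] < 1` makes each recursion contract in
`L^q`: the `j`-th quenched moment, `j = 1, 2, 3`, lies in `L^{p/j}` whenever `E[ρ^p] < 1` with `p ≥
2` (`lintegral_moment_rpow_lt_top` and its three applications).

For the variances, subtracting the stationary means from the recursions leaves contractions driven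
by martingale differences with `p/2 ∈ (1, 2]` moments. A von Bahr–Esseen bound, martingale
convergence and Kronecker's lemma (`ae_sumGrowth_martingale`) give fluctuations below `n^b` for
every `b > 2/p` (`ae_sumGrowth_passVar`). After division by `n` this produces the rate
`n^{-(1-2/p)}`, which is `n^{-1/2}` at `p = 4`. The third moments grow at most like `n^{3/min(p,3)}`
up to small powers (`ae_sum_moment_three_le`); divided by `n^{3/2}` they never exceed the variance
error for `2 < p ≤ 4`.

The Berry–Esseen bound (`exists_berryEsseen_bound`) is obtained by smoothing with a normal law. Its
Fourier transform is not compactly supported, which costs a factor `a²` and a tail `a^{-N}`; with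
`a` a tiny power of `n` and `N` large, both are absorbed by `ε`. -/

/-! ### Quenched path law and first-passage probabilities. -/

/-- The probability of a jump to the right, as an extended nonnegative real. -/
def right (ω : Env) (y : ℤ) : ℝ≥0∞ := ENNReal.ofReal (ω y : ℝ)

/-- The probability of a jump to the left, as an extended nonnegative real. -/
def left (ω : Env) (y : ℤ) : ℝ≥0∞ := ENNReal.ofReal (1 - (ω y : ℝ))

lemma right_add_left (ω : Env) (y : ℤ) : right ω y + left ω y = 1 := by
  rw [right, left, ← ENNReal.ofReal_add (ω y).2.1 (sub_nonneg.2 (ω y).2.2)]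
  simp

lemma lintegral_stepMeasure (ω : Env) (y : ℤ) (g : ℤ → ℝ≥0∞) :
    ∫⁻ z, g z ∂(stepMeasure ω y) = right ω y * g (y + 1) + left ω y * g (y - 1) := by
  simp [stepMeasure, lintegral_add_measure, lintegral_smul_measure, right, left]

instance (ω : Env) (x : ℤ) : IsProbabilityMeasure (quenchedLaw ω x) := by
  unfold quenchedLaw; infer_instance

lemma quenchedLaw_map_zero (ω : Env) (x : ℤ) :
    (quenchedLaw ω x).map (fun X => X 0) = Measure.dirac x := by
  have h1 : (quenchedLaw ω x).map (Preorder.frestrictLe (π := fun _ : ℕ => ℤ) 0)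
      = (Measure.dirac x).map (MeasurableEquiv.piUnique
        (fun i : Finset.Iic 0 => (fun _ : ℕ => ℤ) i)).symm := by
    rw [quenchedLaw, Kernel.trajMeasure, Measure.map_comp _ _ (by fun_prop),
      Kernel.traj_map_frestrictLe, Kernel.partialTraj_self, Measure.id_comp]
  have h2 : (fun X : ℕ → ℤ => X 0) = (fun h : ((i : Finset.Iic 0) → (fun _ : ℕ => ℤ) i) =>
      h ⟨0, by simp⟩) ∘ (Preorder.frestrictLe (π := fun _ : ℕ => ℤ) 0) := rfl
  rw [h2, ← Measure.map_map (by fun_prop) (by fun_prop), h1,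
    Measure.map_map (by fun_prop) (MeasurableEquiv.measurable _)]
  exact Measure.map_dirac' (by fun_prop) x

/-- The Markov property at time `j`: the only place, apart from the initial law, where the
Ionescu-Tulcea construction is unfolded. -/
lemma lintegral_quenchedLaw_succ (ω : Env) (x : ℤ) (j : ℕ)
    (G : ((i : Finset.Iic j) → (fun _ : ℕ => ℤ) i) → ℝ≥0∞) (hG : Measurable G) (g : ℤ → ℝ≥0∞) :
    ∫⁻ X, G (Preorder.frestrictLe (π := fun _ : ℕ => ℤ) j X) * g (X (j + 1)) ∂(quenchedLaw ω x)
      = ∫⁻ X, G (Preorder.frestrictLe (π := fun _ : ℕ => ℤ) j X) *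
        (right ω (X j) * g (X j + 1) + left ω (X j) * g (X j - 1)) ∂(quenchedLaw ω x) := by
  have h := Kernel.map_frestrictLe_trajMeasure_compProd_eq_map_trajMeasure
    (X := fun _ : ℕ => ℤ) (κ := pathKernel ω) (μ₀ := Measure.dirac x) (a := j)
  have hg : Measurable g := measurable_of_countable g
  have hm : Measurable (fun p : ((i : Finset.Iic j) → (fun _ : ℕ => ℤ) i) × ℤ => G p.1 * g p.2) := by
    fun_prop
  have e1 : ∫⁻ X, G (Preorder.frestrictLe (π := fun _ : ℕ => ℤ) j X) * g (X (j + 1)) ∂(quenchedLaw ω x)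
      = ∫⁻ p, G p.1 * g p.2 ∂((quenchedLaw ω x).map
        (fun X => (Preorder.frestrictLe (π := fun _ : ℕ => ℤ) j X, X (j + 1)))) := by
    rw [lintegral_map hm (by fun_prop)]
  rw [e1, quenchedLaw, ← h, Measure.lintegral_compProd hm]
  have hm2 : Measurable fun h : ((i : Finset.Iic j) → (fun _ : ℕ => ℤ) i) =>
      ∫⁻ b, G h * g b ∂(pathKernel ω j h) := by
    exact Measurable.lintegral_kernel_prod_right' (κ := pathKernel ω j) hm
  rw [lintegral_map hm2 (by fun_prop)]
  refine lintegral_congr fun X => ?_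
  rw [lintegral_const_mul _ hg]
  congr 1
  exact lintegral_stepMeasure ω (X j) g

/-- The probability that the walk started at `x` visits `n` for the first time at time `k`,
defined through its first step. -/
def passProb (ω : Env) (n : ℤ) : ℕ → ℤ → ℝ≥0∞
  | 0, x => if x = n then 1 else 0
  | k + 1, x => if x = n then 0
      else right ω x * passProb ω n k (x + 1) + left ω x * passProb ω n k (x - 1)

/-- Each use of the Markov property trades one step of the trajectory for one unrolling of the
recursion for `passProb`, so `k` must vary in the induction. On `X j = n` the value `passProb ω n (k
+ 1) n` is zero, so also forbidding `n` at time `j` costs nothing. The case `k = 0` identifies the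
law of the hitting time. -/
lemma lintegral_passProb (ω : Env) (n x : ℤ) (j k : ℕ) :
    ∫⁻ X, (if ∀ i < j, X i ≠ n then 1 else 0) * passProb ω n k (X j) ∂(quenchedLaw ω x)
      = passProb ω n (j + k) x := by
  classical
  induction j generalizing k with
  | zero =>
    simp only [not_lt_zero, IsEmpty.forall_iff, implies_true, if_true, one_mul, zero_add]
    rw [← lintegral_map (μ := quenchedLaw ω x) (f := passProb ω n k) (g := fun X => X 0)
      (measurable_of_countable _) (by fun_prop), quenchedLaw_map_zero, lintegral_dirac]
  | succ j ih =>
    have h := lintegral_quenchedLaw_succ ω x j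
      (fun h => if ∀ i : Finset.Iic j, h i ≠ n then 1 else 0)
      (by
        refine Measurable.ite ?_ measurable_const measurable_const
        simp only [Set.ofPred_forall]
        refine MeasurableSet.iInter fun i => ?_
        exact (measurableSet_singleton n).compl.preimage (measurable_pi_apply i))
      (passProb ω n k)
    have e : ∀ X : ℕ → ℤ, (∀ i : Finset.Iic j,
        Preorder.frestrictLe (π := fun _ : ℕ => ℤ) j X i ≠ n) ↔ ∀ i < j + 1, X i ≠ n := by
      intro X
      simp only [Preorder.frestrictLe_apply, Subtype.forall, Finset.mem_Iic, Nat.lt_succ_iff]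
    simp only [e] at h
    rw [h, show j + 1 + k = j + (k + 1) by ring, ← ih (k + 1)]
    refine lintegral_congr fun X => ?_
    by_cases hX : X j = n
    · have : ¬ ∀ i < j + 1, X i ≠ n := fun h => h j (by omega) hX
      simp only [if_neg this, zero_mul, passProb, if_pos hX, mul_zero]
    · have : (∀ i < j + 1, X i ≠ n) ↔ ∀ i < j, X i ≠ n := by
        refine ⟨fun h i hi => h i (by omega), fun h i hi => ?_⟩
        rcases Nat.lt_succ_iff_lt_or_eq.1 hi with h' | rfl
        · exact h i h'
        · exact hX
      simp only [this, passProb, if_neg hX]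

lemma hitTime_eq_coe_iff (n : ℤ) (X : ℕ → ℤ) (k : ℕ) :
    hitTime n X = k ↔ (∀ i < k, X i ≠ n) ∧ X k = n := by
  classical
  have hdef : hitTime n X = if ∃ j, X j = n then ((sInf {i : ℕ | X i = n} : ℕ) : ℕ∞) else ⊤ := by
    simp only [hitTime, hittingAfter, zero_le, true_and, Set.mem_singleton_iff]
    rfl
  rw [hdef]
  split_ifs with h
  · rw [Nat.cast_inj]
    constructor
    · rintro rfl
      exact ⟨fun i hi hn => Nat.notMem_of_lt_sInf hi hn, Nat.sInf_mem (s := {i | X i = n}) h⟩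
    · rintro ⟨h1, h2⟩
      refine le_antisymm (Nat.sInf_le h2) ?_
      by_contra hlt
      exact h1 _ (not_le.1 hlt) (Nat.sInf_mem (s := {i | X i = n}) h)
  · simp only [ENat.top_ne_natCast, false_iff, not_and]
    exact fun _ h2 => h ⟨k, h2⟩

lemma measurableSet_hitTime_eq (n : ℤ) (k : ℕ) : MeasurableSet {X | hitTime n X = k} := by
  simp only [hitTime_eq_coe_iff, Set.ofPred_and, Set.ofPred_forall]
  refine MeasurableSet.inter (MeasurableSet.iInter fun i => MeasurableSet.iInter fun _ => ?_) ?_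
  · exact (measurableSet_singleton n).compl.preimage (measurable_pi_apply i)
  · exact (measurableSet_singleton n).preimage (measurable_pi_apply k)

lemma quenchedLaw_hitTime_eq (ω : Env) (n x : ℤ) (k : ℕ) :
    quenchedLaw ω x {X | hitTime n X = k} = passProb ω n k x := by
  classical
  rw [← lintegral_indicator_one (measurableSet_hitTime_eq n k)]
  have h := lintegral_passProb ω n x k 0
  rw [add_zero] at h
  rw [← h]
  refine lintegral_congr fun X => ?_
  simp only [Set.indicator, Set.mem_ofPred_eq, hitTime_eq_coe_iff, passProb, Pi.one_apply]
  by_cases h1 : ∀ i < k, X i ≠ n <;> by_cases h2 : X k = n <;> simp [h1, h2]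

lemma measurable_hitTimeReal (n : ℤ) : Measurable (hitTimeReal n) := by
  have h : Measurable fun X => (hitTime n X).toNat := by
    refine measurable_to_countable' fun k => ?_
    rcases Nat.eq_zero_or_pos k with rfl | hk
    -- `toNat` sends both `0` and `⊤` to `0`, so the fibre over `0` also contains the paths that
    -- never hit `n`.
    · have : (fun X => (hitTime n X).toNat) ⁻¹' {0}
          = {X | hitTime n X = (0 : ℕ)} ∪ (⋃ k : ℕ, {X | hitTime n X = k})ᶜ := by
        ext X
        simp only [Set.mem_preimage, Set.mem_singleton_iff, Set.mem_union, Set.mem_compl_iff,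
          Set.mem_iUnion, Set.mem_ofPred_eq]
        generalize hitTime n X = t
        cases t using ENat.recTopCoe <;> simp
      rw [this]
      exact (measurableSet_hitTime_eq n 0).union
        (MeasurableSet.iUnion fun k => measurableSet_hitTime_eq n k).compl
    · have : (fun X => (hitTime n X).toNat) ⁻¹' {k} = {X | hitTime n X = k} := by
        ext X
        simp only [Set.mem_preimage, Set.mem_singleton_iff, Set.mem_ofPred_eq]
        generalize hitTime n X = t
        cases t using ENat.recTopCoe <;> simp
        omega
      rw [this]
      exact measurableSet_hitTime_eq n k
  exact (measurable_of_countable (fun k : ℕ => (k : ℝ))).comp h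

/-- The (possibly defective) law on `ℕ` of the first passage time from `x` to `n`. -/
def passLaw (ω : Env) (n x : ℤ) : Measure ℕ := Measure.sum fun k => passProb ω n k x • Measure.dirac k

lemma lintegral_passLaw (ω : Env) (n x : ℤ) (f : ℕ → ℝ≥0∞) :
    ∫⁻ k, f k ∂(passLaw ω n x) = ∑' k, passProb ω n k x * f k := by
  simp [passLaw, lintegral_sum_measure]

lemma passLaw_singleton (ω : Env) (n x : ℤ) (k : ℕ) : passLaw ω n x {k} = passProb ω n k x := by
  rw [← lintegral_indicator_one (measurableSet_singleton k), lintegral_passLaw,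
    tsum_eq_single k]
  · simp
  · intro j hj; simp [hj]

lemma passLaw_univ (ω : Env) (n x : ℤ) :
    passLaw ω n x Set.univ = quenchedLaw ω x {X | hitTime n X < ⊤} := by
  have : {X | hitTime n X < ⊤} = ⋃ k : ℕ, {X | hitTime n X = k} := by
    ext X
    simp only [Set.mem_ofPred_eq, Set.mem_iUnion]
    rw [lt_top_iff_ne_top, ENat.ne_top_iff_exists]
    simp only [eq_comm]
  rw [this, measure_iUnion _ fun k => measurableSet_hitTime_eq n k]
  · rw [← lintegral_one, lintegral_passLaw]
    simp [quenchedLaw_hitTime_eq]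
  · intro j k hjk
    refine Set.disjoint_left.2 fun X hj hk => hjk ?_
    simp only [Set.mem_ofPred_eq] at hj hk
    exact_mod_cast hj.symm.trans hk

lemma passLaw_univ_le_one (ω : Env) (n x : ℤ) : passLaw ω n x Set.univ ≤ 1 := by
  rw [passLaw_univ]; exact prob_le_one

instance (ω : Env) (n x : ℤ) : IsFiniteMeasure (passLaw ω n x) :=
  ⟨(passLaw_univ_le_one ω n x).trans_lt ENNReal.one_lt_top⟩

lemma ae_hitTime_lt_top {ω : Env} {n x : ℤ} (h : passLaw ω n x Set.univ = 1) :
    ∀ᵐ X ∂(quenchedLaw ω x), hitTime n X < ⊤ := by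
  rw [passLaw_univ] at h
  have hm : MeasurableSet {X : ℕ → ℤ | hitTime n X < ⊤} := by
    have : {X | hitTime n X < ⊤} = ⋃ k : ℕ, {X | hitTime n X = k} := by
      ext X
      simp only [Set.mem_ofPred_eq, Set.mem_iUnion]
      rw [lt_top_iff_ne_top, ENat.ne_top_iff_exists]
      simp only [eq_comm]
    rw [this]
    exact MeasurableSet.iUnion fun k => measurableSet_hitTime_eq n k
  rw [ae_iff]
  exact (prob_compl_eq_zero_iff hm).2 h

/-- If the walk reaches `n` almost surely, then `passLaw` is the law of `hitTimeReal`. -/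
lemma map_hitTimeReal {ω : Env} {n x : ℤ} (h : passLaw ω n x Set.univ = 1) :
    (quenchedLaw ω x).map (hitTimeReal n) = (passLaw ω n x).map (fun k : ℕ => (k : ℝ)) := by
  have hN : Measurable fun X => (hitTime n X).toNat := by
    have h1 : (fun X => (hitTime n X).toNat) = (fun r : ℝ => ⌊r⌋₊) ∘ hitTimeReal n := by
      ext X; simp [hitTimeReal]
    rw [h1]
    exact Nat.measurable_floor.comp (measurable_hitTimeReal n)
  have h2 : (quenchedLaw ω x).map (fun X => (hitTime n X).toNat) = passLaw ω n x := by
    refine Measure.ext_of_singleton fun k => ?_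
    rw [Measure.map_apply hN (measurableSet_singleton k), passLaw_singleton,
      ← quenchedLaw_hitTime_eq]
    refine measure_congr ?_
    filter_upwards [ae_hitTime_lt_top h] with X hX
    refine propext ?_
    change (hitTime n X).toNat = k ↔ hitTime n X = k
    lift hitTime n X to ℕ using hX.ne with m
    simp
  rw [← h2, Measure.map_map (measurable_of_countable _) hN]
  rfl

/-! ### Decomposition at intermediate sites and first-step analysis of crossing times. -/

/-- From `x ≤ n` the walk cannot reach `n + 1` without visiting `n`; this is the decomposition at
the first visit to `n`. No stopping-time argument is needed: both sides obey the same one-step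
recursion for `x < n`, and at `x = n` only the term with first coordinate `0` survives. -/
lemma passProb_succ_eq_sum (ω : Env) (n : ℤ) (k : ℕ) : ∀ x ≤ n,
    passProb ω (n + 1) k x = ∑ p ∈ Finset.HasAntidiagonal.antidiagonal k,
      passProb ω n p.1 x * passProb ω (n + 1) p.2 n := by
  induction k with
  | zero =>
    intro x hx
    have h1 : x ≠ n + 1 := by omega
    simp [passProb, h1]
  | succ k ih =>
    intro x hx
    rw [Finset.Nat.sum_antidiagonal_succ]
    rcases hx.eq_or_lt with rfl | hlt
    · simp [passProb]
    · have h1 : x ≠ n + 1 := by omega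
      have h2 : x ≠ n := by omega
      simp only [passProb, if_neg h1, if_neg h2, zero_mul, zero_add]
      rw [ih (x + 1) (by omega), ih (x - 1) (by omega), Finset.mul_sum, Finset.mul_sum,
        ← Finset.sum_add_distrib]
      refine Finset.sum_congr rfl fun p _ => ?_
      ring

lemma lintegral_passLaw_succ (ω : Env) {n x : ℤ} (hx : x ≤ n) (f : ℕ → ℝ≥0∞) :
    ∫⁻ k, f k ∂(passLaw ω (n + 1) x)
      = ∫⁻ i, ∫⁻ j, f (i + j) ∂(passLaw ω (n + 1) n) ∂(passLaw ω n x) := by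
  simp only [lintegral_passLaw, ← ENNReal.tsum_mul_left]
  rw [← ENNReal.tsum_prod (f := fun i j => passProb ω n i x * (passProb ω (n + 1) j n * f (i + j))),
    ← (Finset.HasAntidiagonal.sigmaAntidiagonalEquivProd (A := ℕ)).tsum_eq, ENNReal.tsum_sigma']
  refine tsum_congr fun k => ?_
  rw [passProb_succ_eq_sum ω n k x hx, Finset.sum_mul]
  rw [tsum_fintype, ← Finset.sum_coe_sort]
  refine Finset.sum_congr rfl fun p _ => ?_
  have hp : p.1.1 + p.1.2 = k := Finset.HasAntidiagonal.mem_antidiagonal.1 p.2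
  simp only [Finset.HasAntidiagonal.sigmaAntidiagonalEquivProd_apply, hp]
  ring

lemma passLaw_succ (ω : Env) {n x : ℤ} (hx : x ≤ n) :
    passLaw ω (n + 1) x = passLaw ω n x ∗ passLaw ω (n + 1) n := by
  refine Measure.ext_of_lintegral _ fun f _ => ?_
  rw [lintegral_passLaw_succ ω hx, Measure.lintegral_conv (measurable_of_countable _)]

lemma passLaw_self (ω : Env) (n : ℤ) : passLaw ω n n = Measure.dirac 0 := by
  refine Measure.ext_of_lintegral _ fun f _ => ?_
  rw [lintegral_passLaw, lintegral_dirac, tsum_eq_single 0]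
  · simp [passProb]
  · intro k hk
    obtain ⟨j, rfl⟩ := Nat.exists_eq_succ_of_ne_zero hk
    simp [passProb]

/-- The law of the passage time from `x` to `x + 1`. -/
def crossLaw (ω : Env) (x : ℤ) : Measure ℕ := passLaw ω (x + 1) x

instance (ω : Env) (x : ℤ) : IsFiniteMeasure (crossLaw ω x) :=
  inferInstanceAs (IsFiniteMeasure (passLaw ω (x + 1) x))

lemma crossLaw_univ_le_one (ω : Env) (x : ℤ) : crossLaw ω x Set.univ ≤ 1 :=
  passLaw_univ_le_one ω _ _

/-- The walk at `x` either steps right and is done at time `1`, or steps left and then has to cross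
from `x - 1` to `x` and, afresh, from `x` to `x + 1`. All moment recursions come from this identity.
-/
lemma lintegral_crossLaw (ω : Env) (x : ℤ) (f : ℕ → ℝ≥0∞) :
    ∫⁻ k, f k ∂(crossLaw ω x) = right ω x * f 1
      + left ω x * ∫⁻ i, ∫⁻ j, f (i + j + 1) ∂(crossLaw ω x) ∂(crossLaw ω (x - 1)) := by
  have h1 : ∫⁻ i, ∫⁻ j, f (i + j + 1) ∂(crossLaw ω x) ∂(crossLaw ω (x - 1))
      = ∫⁻ k, f (k + 1) ∂(passLaw ω (x + 1) (x - 1)) := by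
    rw [lintegral_passLaw_succ ω (by omega : x - 1 ≤ x), crossLaw, crossLaw, sub_add_cancel]
  have h2 : f 1 = ∫⁻ k, f (k + 1) ∂(passLaw ω (x + 1) (x + 1)) := by
    rw [passLaw_self, lintegral_dirac]
  rw [h1, h2, crossLaw, lintegral_passLaw, lintegral_passLaw, lintegral_passLaw,
    tsum_eq_zero_add' ENNReal.summable, ← ENNReal.tsum_mul_left, ← ENNReal.tsum_mul_left,
    ← ENNReal.tsum_add]
  have hx : x ≠ x + 1 := by omega
  simp only [passProb, if_neg hx, zero_mul, zero_add]
  refine tsum_congr fun k => ?_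
  ring

lemma crossLaw_univ (ω : Env) (x : ℤ) : crossLaw ω x Set.univ
    = right ω x + left ω x * (crossLaw ω (x - 1) Set.univ * crossLaw ω x Set.univ) := by
  have h := lintegral_crossLaw ω x (fun _ => 1)
  simp only [lintegral_const, one_mul, mul_one] at h
  rw [mul_comm (crossLaw ω (x - 1) Set.univ)]
  exact h

/-! ### Recursions for the quenched moments of crossing times. -/

/-- The `j`-th moment of the passage time from `x` to `x + 1`. -/
def moment (j : ℕ) (ω : Env) (x : ℤ) : ℝ≥0∞ := ∫⁻ k, (k : ℝ≥0∞) ^ j ∂(crossLaw ω x)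

/-- The `j`-th moment of the passage time from `x` to `x + 1` truncated at level `K`. -/
def truncMoment (j K : ℕ) (ω : Env) (x : ℤ) : ℝ≥0∞ :=
  ∫⁻ k, ((min k K : ℕ) : ℝ≥0∞) ^ j ∂(crossLaw ω x)

lemma truncMoment_le_moment (j K : ℕ) (ω : Env) (x : ℤ) :
    truncMoment j K ω x ≤ moment j ω x :=
  lintegral_mono fun k => by gcongr; exact min_le_left _ _

lemma truncMoment_mono (j : ℕ) (ω : Env) (x : ℤ) : Monotone fun K => truncMoment j K ω x :=
  fun _ _ h => lintegral_mono fun k => by dsimp only; gcongr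

lemma truncMoment_lt_top (j K : ℕ) (ω : Env) (x : ℤ) : truncMoment j K ω x < ⊤ := by
  refine (lintegral_mono (g := fun _ => (K : ℝ≥0∞) ^ j) fun k => ?_).trans_lt ?_
  · exact pow_le_pow_left' (Nat.cast_le.2 (min_le_right _ _)) _
  · rw [lintegral_const]
    exact ENNReal.mul_lt_top (ENNReal.pow_lt_top (ENNReal.natCast_lt_top K)) (measure_lt_top _ _)

lemma iSup_truncMoment (j : ℕ) (ω : Env) (x : ℤ) :
    ⨆ K, truncMoment j K ω x = moment j ω x := by
  simp only [truncMoment, moment]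
  rw [← lintegral_iSup (fun K => measurable_of_countable _)]
  · refine lintegral_congr fun k => le_antisymm (iSup_le fun K => ?_) ?_
    · gcongr; exact min_le_left _ _
    · exact le_iSup_of_le k (by simp)
  · intro K L h k
    simp only
    gcongr

lemma lintegral_nat_add (μ : Measure ℕ) (a b : ℕ → ℝ≥0∞) :
    ∫⁻ i, (a i + b i) ∂μ = ∫⁻ i, a i ∂μ + ∫⁻ i, b i ∂μ :=
  lintegral_add_left (measurable_of_countable _) _

lemma lintegral_nat_const_mul (μ : Measure ℕ) (c : ℝ≥0∞) (a : ℕ → ℝ≥0∞) :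
    ∫⁻ i, c * a i ∂μ = c * ∫⁻ i, a i ∂μ :=
  lintegral_const_mul _ (measurable_of_countable _)

lemma lintegral_nat_mul_const (μ : Measure ℕ) (c : ℝ≥0∞) (a : ℕ → ℝ≥0∞) :
    ∫⁻ i, a i * c ∂μ = (∫⁻ i, a i ∂μ) * c :=
  lintegral_mul_const _ (measurable_of_countable _)

section Bilinear

variable {μ ν : Measure ℕ} (a b : ℕ → ℝ≥0∞)

lemma lintegral_add_pow_one (hμ : μ Set.univ = 1) (hν : ν Set.univ = 1) :
    ∫⁻ i, ∫⁻ j, (a i + b j) ∂ν ∂μ = ∫⁻ i, a i ∂μ + ∫⁻ j, b j ∂ν := by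
  simp only [lintegral_nat_add, lintegral_const, hμ, hν, mul_one]

lemma lintegral_add_pow_two (hμ : μ Set.univ = 1) (hν : ν Set.univ = 1) :
    ∫⁻ i, ∫⁻ j, (a i + b j) ^ 2 ∂ν ∂μ = ∫⁻ i, a i ^ 2 ∂μ + ∫⁻ j, b j ^ 2 ∂ν
      + 2 * (∫⁻ i, a i ∂μ) * ∫⁻ j, b j ∂ν := by
  have h : ∀ i j, (a i + b j) ^ 2 = a i ^ 2 + b j ^ 2 + (2 * a i) * b j := fun i j => by ring
  simp only [h, lintegral_nat_add, lintegral_nat_const_mul, lintegral_nat_mul_const,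
    lintegral_const, hμ, hν, mul_one]

lemma lintegral_add_pow_three (hμ : μ Set.univ = 1) (hν : ν Set.univ = 1) :
    ∫⁻ i, ∫⁻ j, (a i + b j) ^ 3 ∂ν ∂μ = ∫⁻ i, a i ^ 3 ∂μ + ∫⁻ j, b j ^ 3 ∂ν
      + 3 * (∫⁻ i, a i ^ 2 ∂μ) * (∫⁻ j, b j ∂ν) + 3 * (∫⁻ i, a i ∂μ) * (∫⁻ j, b j ^ 2 ∂ν) := by
  have h : ∀ i j, (a i + b j) ^ 3 = a i ^ 3 + b j ^ 3 + (3 * a i ^ 2) * b j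
      + (3 * a i) * b j ^ 2 := fun i j => by ring
  simp only [h, lintegral_nat_add, lintegral_nat_const_mul, lintegral_nat_mul_const,
    lintegral_const, hμ, hν, mul_one]

end Bilinear

lemma rho_eq_div (ω : Env) (x : ℤ) : rho ω x = left ω x / right ω x := rfl

lemma right_lt_top (ω : Env) (x : ℤ) : right ω x < ⊤ := ENNReal.ofReal_lt_top

lemma left_lt_top (ω : Env) (x : ℤ) : left ω x < ⊤ := ENNReal.ofReal_lt_top

/-- First-step analysis puts the unknown `y` on both sides. Cancelling `left ω x * y` and dividing
by `right ω x` needs `y < ⊤`, which is why truncated moments are used until finiteness is known. -/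
lemma le_one_add_rho_mul {ω : Env} {x : ℤ} (h0 : right ω x ≠ 0) {y z : ℝ≥0∞} (hy : y < ⊤)
    (h : y ≤ right ω x + left ω x * (z + y)) : y ≤ 1 + rho ω x * z := by
  have hr := (right_lt_top ω x).ne
  have e : y = right ω x * y + left ω x * y := by rw [← add_mul, right_add_left, one_mul]
  have hly : left ω x * y ≠ ⊤ := (ENNReal.mul_lt_top (left_lt_top ω x) hy).ne
  have h1 : right ω x * y ≤ right ω x + left ω x * z := by
    refine (ENNReal.add_le_add_iff_right hly).1 ?_
    rw [← e]
    refine h.trans_eq ?_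
    ring
  have h2 : right ω x * (1 + rho ω x * z) = right ω x + left ω x * z := by
    rw [rho_eq_div, mul_add, mul_one, ← mul_assoc, ENNReal.mul_div_cancel h0 hr]
  rw [← h2] at h1
  exact (ENNReal.mul_le_mul_iff_right h0 hr).1 h1

lemma eq_one_add_rho_mul {ω : Env} {x : ℤ} (h0 : right ω x ≠ 0) {y z : ℝ≥0∞} (hy : y < ⊤)
    (h : y = right ω x + left ω x * (z + y)) : y = 1 + rho ω x * z := by
  refine le_antisymm (le_one_add_rho_mul h0 hy h.le) ?_
  have hr := (right_lt_top ω x).ne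
  have e : y = right ω x * y + left ω x * y := by rw [← add_mul, right_add_left, one_mul]
  have hly : left ω x * y ≠ ⊤ := (ENNReal.mul_lt_top (left_lt_top ω x) hy).ne
  have h1 : right ω x + left ω x * z ≤ right ω x * y := by
    refine (ENNReal.add_le_add_iff_right hly).1 ?_
    rw [← e]
    nth_rewrite 2 [h]
    refine le_of_eq ?_
    ring
  have h2 : right ω x * (1 + rho ω x * z) = right ω x + left ω x * z := by
    rw [rho_eq_div, mul_add, mul_one, ← mul_assoc, ENNReal.mul_div_cancel h0 hr]
  rw [← h2] at h1
  exact (ENNReal.mul_le_mul_iff_right h0 hr).1 h1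

/-- The initial step uses up one unit of the truncation level, so the crossing from `x - 1` is
truncated at `K` while the one from `x` stays at `K + 1`. This drop allows induction on `K`. -/
lemma truncMoment_succ_le_aux (j K : ℕ) (ω : Env) (x : ℤ) :
    truncMoment j (K + 1) ω x ≤ right ω x + left ω x * ∫⁻ i, ∫⁻ k,
      ((1 + ((min i K : ℕ) : ℝ≥0∞)) + ((min k (K + 1) : ℕ) : ℝ≥0∞)) ^ j
        ∂(crossLaw ω x) ∂(crossLaw ω (x - 1)) := by
  rw [truncMoment, lintegral_crossLaw]
  gcongr with i k
  · simp
  · have : min (i + k + 1) (K + 1) ≤ 1 + min i K + min k (K + 1) := by omega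
    exact_mod_cast this

lemma moment_eq_aux (j : ℕ) (ω : Env) (x : ℤ) :
    moment j ω x = right ω x + left ω x * ∫⁻ i, ∫⁻ k,
      ((1 + (i : ℝ≥0∞)) + (k : ℝ≥0∞)) ^ j ∂(crossLaw ω x) ∂(crossLaw ω (x - 1)) := by
  rw [moment, lintegral_crossLaw]
  have : ∀ i k : ℕ, ((i + k + 1 : ℕ) : ℝ≥0∞) = (1 + (i : ℝ≥0∞)) + (k : ℝ≥0∞) := by
    intro i k; push_cast; ring
  simp only [this]
  simp

section Recursion

variable {ω : Env} {x : ℤ} (h' : crossLaw ω (x - 1) Set.univ = 1)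
  (h : crossLaw ω x Set.univ = 1) (h0 : right ω x ≠ 0)

lemma lintegral_one_add_pow {μ : Measure ℕ} (hμ : μ Set.univ = 1) (a : ℕ → ℝ≥0∞) :
    ∫⁻ i, (1 + a i) ∂μ = 1 + ∫⁻ i, a i ∂μ ∧
    ∫⁻ i, (1 + a i) ^ 2 ∂μ = 1 + 2 * ∫⁻ i, a i ∂μ + ∫⁻ i, a i ^ 2 ∂μ ∧
    ∫⁻ i, (1 + a i) ^ 3 ∂μ = 1 + 3 * ∫⁻ i, a i ∂μ + 3 * ∫⁻ i, a i ^ 2 ∂μ + ∫⁻ i, a i ^ 3 ∂μ := by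
  have e2 : ∀ i, (1 + a i) ^ 2 = 1 + 2 * a i + a i ^ 2 := fun i => by ring
  have e3 : ∀ i, (1 + a i) ^ 3 = 1 + 3 * a i + 3 * a i ^ 2 + a i ^ 3 := fun i => by ring
  simp only [e2, e3, lintegral_nat_add, lintegral_nat_const_mul, lintegral_const, hμ, mul_one,
    and_self]

include h' h h0

lemma truncMoment_one_succ_le (K : ℕ) :
    truncMoment 1 (K + 1) ω x ≤ 1 + rho ω x * (1 + truncMoment 1 K ω (x - 1)) := by
  have a := truncMoment_succ_le_aux 1 K ω x
  simp only [pow_one] at a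
  rw [lintegral_add_pow_one _ _ h' h, (lintegral_one_add_pow h' _).1] at a
  refine le_one_add_rho_mul h0 (truncMoment_lt_top _ _ _ _) ?_
  simpa only [truncMoment, pow_one] using a

/-- Only the top-order moment at `x - 1` has to stay truncated; lower-order moments are replaced by
full ones, whose integrability is established beforehand. -/
lemma truncMoment_two_succ_le (K : ℕ) :
    truncMoment 2 (K + 1) ω x ≤ 1 + rho ω x * (1 + 2 * moment 1 ω (x - 1)
      + truncMoment 2 K ω (x - 1) + 2 * (1 + moment 1 ω (x - 1)) * moment 1 ω x) := by
  have a := truncMoment_succ_le_aux 2 K ω x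
  rw [lintegral_add_pow_two _ _ h' h, (lintegral_one_add_pow h' _).1,
    (lintegral_one_add_pow h' _).2.1] at a
  have b1 := truncMoment_le_moment 1 K ω (x - 1)
  have b2 := truncMoment_le_moment 1 (K + 1) ω x
  refine le_one_add_rho_mul h0 (truncMoment_lt_top _ _ _ _) (a.trans ?_)
  simp only [truncMoment, pow_one] at b1 b2 ⊢
  rw [add_right_comm]
  gcongr

lemma truncMoment_three_succ_le (K : ℕ) :
    truncMoment 3 (K + 1) ω x ≤ 1 + rho ω x * (1 + 3 * moment 1 ω (x - 1)
      + 3 * moment 2 ω (x - 1) + truncMoment 3 K ω (x - 1)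
      + 3 * (1 + 2 * moment 1 ω (x - 1) + moment 2 ω (x - 1)) * moment 1 ω x
      + 3 * (1 + moment 1 ω (x - 1)) * moment 2 ω x) := by
  have a := truncMoment_succ_le_aux 3 K ω x
  rw [lintegral_add_pow_three _ _ h' h, (lintegral_one_add_pow h' _).1,
    (lintegral_one_add_pow h' _).2.1, (lintegral_one_add_pow h' _).2.2] at a
  have b1 := truncMoment_le_moment 1 K ω (x - 1)
  have b2 := truncMoment_le_moment 1 (K + 1) ω x
  have b3 := truncMoment_le_moment 2 K ω (x - 1)
  have b4 := truncMoment_le_moment 2 (K + 1) ω x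
  refine le_one_add_rho_mul h0 (truncMoment_lt_top _ _ _ _) (a.trans ?_)
  simp only [truncMoment, pow_one] at b1 b2 b3 b4 ⊢
  have e : ∀ P J Q R : ℝ≥0∞, P + J + Q + R = P + Q + R + J := fun _ _ _ _ => by ring
  rw [e]
  gcongr

lemma moment_one_eq (ht : moment 1 ω x < ⊤) :
    moment 1 ω x = 1 + rho ω x * (1 + moment 1 ω (x - 1)) := by
  have a := moment_eq_aux 1 ω x
  simp only [pow_one] at a
  rw [lintegral_add_pow_one _ _ h' h, (lintegral_one_add_pow h' _).1] at a
  refine eq_one_add_rho_mul h0 ht ?_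
  simpa only [moment, pow_one] using a

lemma moment_two_eq (ht : moment 2 ω x < ⊤) :
    moment 2 ω x = 1 + rho ω x * (1 + 2 * moment 1 ω (x - 1)
      + moment 2 ω (x - 1) + 2 * (1 + moment 1 ω (x - 1)) * moment 1 ω x) := by
  have a := moment_eq_aux 2 ω x
  rw [lintegral_add_pow_two _ _ h' h, (lintegral_one_add_pow h' _).1,
    (lintegral_one_add_pow h' _).2.1, add_right_comm] at a
  refine eq_one_add_rho_mul h0 ht ?_
  simpa only [moment, pow_one] using a

end Recursion

/-! ### Stationarity of the environment and dependence on the past. -/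

/-- The environment seen from `a`. -/
def shift (a : ℤ) (ω : Env) : Env := fun y => ω (y + a)

lemma passProb_shift (ω : Env) (n a : ℤ) (k : ℕ) (x : ℤ) :
    passProb (shift a ω) n k x = passProb ω (n + a) k (x + a) := by
  induction k generalizing x with
  | zero => simp [passProb]
  | succ k ih =>
    simp only [passProb, ih, add_left_inj, right, left, shift]
    rw [add_right_comm x 1 a, sub_add_eq_add_sub]

lemma crossLaw_shift (ω : Env) (a x : ℤ) : crossLaw (shift a ω) x = crossLaw ω (x + a) := by
  simp only [crossLaw, passLaw, passProb_shift]
  rw [add_right_comm]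

/-- The sigma-algebra generated by the sites to the left of `x`, including `x`. -/
@[reducible] def past (x : ℤ) : MeasurableSpace Env :=
  ⨆ y ∈ Set.Iic x, MeasurableSpace.comap (fun ω : Env => ω y) inferInstance

lemma past_mono : Monotone past := fun _ _ h =>
  biSup_mono fun _ hy => le_trans hy h

lemma past_le (x : ℤ) : past x ≤ (inferInstance : MeasurableSpace Env) :=
  iSup₂_le fun y _ => (measurable_pi_apply y).comap_le

lemma measurable_past_apply {x y : ℤ} (h : y ≤ x) : Measurable[past x] fun ω : Env => ω y := by
  refine Measurable.mono (comap_measurable _) ?_ le_rfl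
  exact le_iSup₂_of_le y h le_rfl

/-- Before its first visit to `n + 1` the walk only consults sites up to `n`. -/
lemma measurable_past_passProb (n : ℤ) (k : ℕ) : ∀ x ≤ n + 1,
    Measurable[past n] fun ω => passProb ω (n + 1) k x := by
  induction k with
  | zero => intro x _; simp only [passProb]; exact measurable_const
  | succ k ih =>
    intro x hx
    simp only [passProb]
    split_ifs with h
    · exact measurable_const
    · have hx' : x ≤ n := by omega
      have h1 : Measurable[past n] fun ω : Env => (ω x : ℝ) :=
        measurable_subtype_coe.comp (measurable_past_apply hx')
      have h2 : Measurable[past n] fun ω : Env => right ω x :=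
        ENNReal.measurable_ofReal.comp h1
      have h3 : Measurable[past n] fun ω : Env => left ω x :=
        ENNReal.measurable_ofReal.comp (measurable_const.sub h1)
      exact (h2.mul (ih _ (by omega))).add (h3.mul (ih _ (by omega)))

lemma measurable_past_lintegral_crossLaw (x : ℤ) (f : ℕ → ℝ≥0∞) :
    Measurable[past x] fun ω => ∫⁻ k, f k ∂(crossLaw ω x) := by
  simp only [crossLaw, lintegral_passLaw]
  refine @Measurable.tsum Env ℝ≥0∞ ℕ (past x) _ _ _ _ _ _ _ _ _ _ _ _ fun k => ?_
  exact (measurable_past_passProb x k x (by omega)).mul measurable_const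

lemma measurable_shift (a : ℤ) : Measurable (shift a) :=
  measurable_pi_lambda _ fun y => measurable_pi_apply (y + a)

section Stationary

variable {P : Measure Env}

lemma indep_past (hiid : IsIID P) (x : ℤ) :
    Indep (MeasurableSpace.comap (fun ω : Env => ω x) inferInstance) (past (x - 1)) P := by
  have h := indep_iSup_of_disjoint (fun y : ℤ => (measurable_pi_apply y :
    Measurable fun ω : Env => ω y).comap_le) hiid.1.iIndep (S := {x}) (T := Set.Iic (x - 1))
    (by simp)
  simpa only [Set.mem_singleton_iff, iSup_iSup_eq_left] using h

variable [IsProbabilityMeasure P]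

lemma measurePreserving_shift (hiid : IsIID P) (a : ℤ) : MeasurePreserving (shift a) P P := by
  refine ⟨measurable_shift a, ?_⟩
  have h0 := (iIndepFun_iff_map_fun_eq_infinitePi_map
    (fun x : ℤ => (measurable_pi_apply x : Measurable fun ω : Env => ω x))).1 hiid.1
  have h1 := (iIndepFun_iff_map_fun_eq_infinitePi_map
    (fun x : ℤ => (measurable_pi_apply (x + a) : Measurable fun ω : Env => ω (x + a)))).1
    (hiid.1.precomp (g := fun x : ℤ => x + a) (add_left_injective a))
  have h2 : ∀ x : ℤ, P.map (fun ω : Env => ω (x + a)) = P.map (fun ω : Env => ω x) := fun x =>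
    (hiid.2 (x + a)).map_eq.trans (hiid.2 x).map_eq.symm
  simp only [h2] at h1
  change P.map (fun ω x => ω (x + a)) = P
  rw [h1, ← h0]
  exact Measure.map_id

lemma lintegral_shift (hiid : IsIID P) (a : ℤ) {F : Env → ℝ≥0∞} (hF : Measurable F) :
    ∫⁻ ω, F (shift a ω) ∂P = ∫⁻ ω, F ω ∂P :=
  (measurePreserving_shift hiid a).lintegral_comp hF

lemma ae_shift (hiid : IsIID P) (a : ℤ) {p : Env → Prop} (h : ∀ᵐ ω ∂P, p ω) :
    ∀ᵐ ω ∂P, p (shift a ω) :=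
  (measurePreserving_shift hiid a).quasiMeasurePreserving.ae h

lemma lintegral_mul_past (hiid : IsIID P) (x : ℤ) {g : unitInterval → ℝ≥0∞} (hg : Measurable g)
    {G : Env → ℝ≥0∞} (hG : Measurable[past (x - 1)] G) :
    ∫⁻ ω, g (ω x) * G ω ∂P = (∫⁻ ω, g (ω 0) ∂P) * ∫⁻ ω, G ω ∂P := by
  rw [lintegral_mul_eq_lintegral_mul_lintegral_of_independent_measurableSpace
    (f := fun ω : Env => g (ω x)) (measurable_pi_apply x : Measurable fun ω : Env => ω x).comap_le (past_le _)
    (indep_past hiid x) (hg.comp (comap_measurable _)) hG]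
  congr 1
  have h := lintegral_shift hiid x (hg.comp (measurable_pi_apply (0 : ℤ)))
  simpa [shift] using h

/-- The odds of a jump to the left. -/
def odds (u : unitInterval) : ℝ≥0∞ := ENNReal.ofReal (1 - (u : ℝ)) / ENNReal.ofReal (u : ℝ)

lemma measurable_odds : Measurable odds :=
  (ENNReal.measurable_ofReal.comp (measurable_const.sub measurable_subtype_coe)).div
    (ENNReal.measurable_ofReal.comp measurable_subtype_coe)

lemma rho_eq_odds (ω : Env) (x : ℤ) : rho ω x = odds (ω x) := rfl

lemma measurable_rho (x : ℤ) : Measurable fun ω : Env => rho ω x :=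
  measurable_odds.comp (measurable_pi_apply x)

lemma measurable_past_truncMoment (j K : ℕ) (x : ℤ) :
    Measurable[past x] fun ω => truncMoment j K ω x := measurable_past_lintegral_crossLaw x _

lemma measurable_past_moment (j : ℕ) (x : ℤ) :
    Measurable[past x] fun ω => moment j ω x := measurable_past_lintegral_crossLaw x _

lemma measurable_moment (j : ℕ) (x : ℤ) : Measurable fun ω => moment j ω x :=
  (measurable_past_moment j x).mono (past_le x) le_rfl

lemma measurable_truncMoment (j K : ℕ) (x : ℤ) : Measurable fun ω => truncMoment j K ω x :=
  (measurable_past_truncMoment j K x).mono (past_le x) le_rfl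

lemma moment_shift (j : ℕ) (ω : Env) (a x : ℤ) :
    moment j (shift a ω) x = moment j ω (x + a) := by
  simp only [moment, crossLaw_shift]

lemma truncMoment_shift (j K : ℕ) (ω : Env) (a x : ℤ) :
    truncMoment j K (shift a ω) x = truncMoment j K ω (x + a) := by
  simp only [truncMoment, crossLaw_shift]

/-- The factor in front of `a ^ q` can be taken arbitrarily close to `1`, so that multiplying a
contraction constant below `1` by it keeps it below `1`. The two cases are `b ≤ δ a` and `a ≤ δ⁻¹
b`. -/
lemma add_rpow_le_mul (δ : ℝ≥0∞) (hδ : δ ≠ 0) (hδ' : δ ≠ ⊤) {q : ℝ} (hq : 0 < q)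
    (a b : ℝ≥0∞) : (a + b) ^ q ≤ (1 + δ) ^ q * a ^ q + (1 + δ⁻¹) ^ q * b ^ q := by
  rcases le_total b (δ * a) with h | h
  · refine le_trans ?_ le_self_add
    rw [← ENNReal.mul_rpow_of_nonneg _ _ hq.le]
    gcongr
    rw [add_mul, one_mul]; gcongr
  · refine le_trans ?_ le_add_self
    rw [← ENNReal.mul_rpow_of_nonneg _ _ hq.le]
    gcongr
    rw [add_mul, one_mul, add_comm]; gcongr
    calc a = δ⁻¹ * (δ * a) := by rw [← mul_assoc, ENNReal.inv_mul_cancel hδ hδ', one_mul]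
      _ ≤ δ⁻¹ * b := by gcongr

lemma lintegral_rho_rpow_le {p q : ℝ} (hq : 0 < q) (hqp : q ≤ p)
    (h : ∫⁻ ω, rho ω 0 ^ p ∂P < 1) : ∫⁻ ω, rho ω 0 ^ q ∂P < 1 := by
  have h1 := eLpNorm'_le_eLpNorm'_of_exponent_le hq hqp P
    (measurable_rho 0).aestronglyMeasurable
  simp only [eLpNorm', enorm_eq_self] at h1
  have hp : 0 < p := hq.trans_le hqp
  have h2 : (∫⁻ ω, rho ω 0 ^ p ∂P) ^ (1 / p) < 1 :=
    ENNReal.rpow_lt_one h (by positivity)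
  have h3 := h1.trans_lt h2
  by_contra h4
  exact absurd (ENNReal.one_le_rpow (not_lt.1 h4) (by positivity : 0 < 1 / q)) (not_le.2 h3)

lemma exists_one_add_rpow_mul_lt_one {θ : ℝ≥0∞} (hθ : θ < 1) {q : ℝ} :
    ∃ δ : ℝ≥0∞, δ ≠ 0 ∧ δ ≠ ⊤ ∧ (1 + δ) ^ q * θ < 1 := by
  have hc : Tendsto (fun n : ℕ => (1 + ((n : ℝ≥0∞))⁻¹) ^ q * θ) atTop (𝓝 ((1 + 0) ^ q * θ)) := by
    refine ENNReal.Tendsto.mul_const ?_ (Or.inr (hθ.trans ENNReal.one_lt_top).ne)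
    exact (ENNReal.continuous_rpow_const.tendsto _).comp
      (tendsto_const_nhds.add ENNReal.tendsto_inv_nat_nhds_zero)
  have h1 : ((1 : ℝ≥0∞) + 0) ^ q * θ < 1 := by simpa using hθ
  obtain ⟨n, hn, hn0⟩ := ((hc.eventually_lt_const h1).and (eventually_gt_atTop 0)).exists
  exact ⟨(n : ℝ≥0∞)⁻¹, by simp, by simpa using hn0.ne', hn⟩

/-- A perpetuity argument. The truncated moment at `-1` is independent of `ρ_0` and distributed like
the one at `0`, so the `q`-th moments `a_K` satisfy `a_{K+1} ≤ θ a_K + C` with `θ < 1`. Since `a_0 =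
0`, they stay below the fixed point `C / (1 - θ)`, and monotone convergence removes the truncation.
No independence between `H` and `ρ_0` is needed. -/
lemma lintegral_moment_rpow_lt_top (hiid : IsIID P) {j : ℕ} (hj : j ≠ 0) {q : ℝ} (hq : 0 < q)
    (hρ : ∫⁻ ω, rho ω 0 ^ q ∂P < 1) {H : Env → ℝ≥0∞} (hHm : Measurable H)
    (hH : ∫⁻ ω, H ω ^ q ∂P < ⊤)
    (hrec : ∀ K, ∀ᵐ ω ∂P, truncMoment j (K + 1) ω 0 ≤ H ω + rho ω 0 * truncMoment j K ω (-1)) :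
    ∫⁻ ω, moment j ω 0 ^ q ∂P < ⊤ := by
  obtain ⟨δ, hδ, hδ', hlt⟩ := exists_one_add_rpow_mul_lt_one (q := q) hρ
  set θ := (1 + δ) ^ q * ∫⁻ ω, rho ω 0 ^ q ∂P with hθ
  set C := (1 + δ⁻¹) ^ q * ∫⁻ ω, H ω ^ q ∂P with hC
  have hCt : C < ⊤ := by
    refine ENNReal.mul_lt_top (ENNReal.rpow_lt_top_of_nonneg hq.le ?_) hH
    simp [hδ]
  have hsub : 1 - θ ≠ 0 := (tsub_pos_of_lt hlt).ne'
  have hb : ∀ K, ∫⁻ ω, truncMoment j K ω 0 ^ q ∂P ≤ C * (1 - θ)⁻¹ := by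
    intro K
    induction K with
    | zero => simp [truncMoment, hj, hq]
    | succ K ih =>
      have hg : Measurable fun u => odds u ^ q := measurable_odds.pow_const q
      have hG : Measurable[past (0 - 1)] fun ω => truncMoment j K ω (-1) ^ q :=
        (measurable_past_truncMoment j K (-1)).pow_const q
      have h1 : ∫⁻ ω, rho ω 0 ^ q * truncMoment j K ω (-1) ^ q ∂P
          = (∫⁻ ω, rho ω 0 ^ q ∂P) * ∫⁻ ω, truncMoment j K ω 0 ^ q ∂P := by
        have := lintegral_mul_past hiid 0 hg hG
        simp only [← rho_eq_odds] at this
        rw [this]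
        congr 1
        rw [← lintegral_shift hiid (-1) ((measurable_truncMoment j K 0).pow_const q)]
        simp only [truncMoment_shift, zero_add]
      calc ∫⁻ ω, truncMoment j (K + 1) ω 0 ^ q ∂P
          ≤ ∫⁻ ω, ((1 + δ) ^ q * (rho ω 0 ^ q * truncMoment j K ω (-1) ^ q)
            + (1 + δ⁻¹) ^ q * H ω ^ q) ∂P := by
            refine lintegral_mono_ae ?_
            filter_upwards [hrec K] with ω hω
            rw [← ENNReal.mul_rpow_of_nonneg (rho ω 0) _ hq.le]
            refine le_trans ?_ (add_rpow_le_mul δ hδ hδ' hq _ _)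
            gcongr
            rw [add_comm (rho ω 0 * _)]
            exact hω
        _ = θ * (∫⁻ ω, truncMoment j K ω 0 ^ q ∂P) + C := by
            rw [lintegral_add_right _ ((hHm.pow_const q).const_mul _),
              lintegral_const_mul _ (hHm.pow_const q), lintegral_const_mul
              (f := fun ω => rho ω 0 ^ q * truncMoment j K ω (-1) ^ q) _
              (((measurable_rho 0).pow_const q).mul ((measurable_truncMoment j K (-1)).pow_const q)),
              h1, ← mul_assoc]
        _ ≤ θ * (C * (1 - θ)⁻¹) + C := by gcongr
        _ = C * (1 - θ)⁻¹ * (θ + (1 - θ)) := by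
            rw [mul_add, mul_assoc C _ (1 - θ), ENNReal.inv_mul_cancel hsub (by simp)]
            ring
        _ = C * (1 - θ)⁻¹ := by rw [add_tsub_cancel_of_le hlt.le, mul_one]
  have h2 : ∫⁻ ω, moment j ω 0 ^ q ∂P = ⨆ K, ∫⁻ ω, truncMoment j K ω 0 ^ q ∂P := by
    rw [← lintegral_iSup (fun K => (measurable_truncMoment j K 0).pow_const q)]
    · refine lintegral_congr fun ω => ?_
      rw [← iSup_truncMoment]
      exact (ENNReal.orderIsoRpow q hq).map_iSup _
    · intro K L h ω
      exact ENNReal.rpow_le_rpow (truncMoment_mono j ω 0 h) hq.le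
  rw [h2]
  refine (iSup_le hb).trans_lt (ENNReal.mul_lt_top hCt ?_)
  exact ENNReal.inv_lt_top.2 (tsub_pos_of_lt hlt)

end Stationary

/-! ### Integrability of the first three quenched moments. -/

section Moments

variable {P : Measure Env}

lemma add_rpow_le_two {q : ℝ} (hq : 0 < q) (a b : ℝ≥0∞) :
    (a + b) ^ q ≤ 2 ^ q * (a ^ q + b ^ q) := by
  have h := add_rpow_le_mul 1 one_ne_zero ENNReal.one_ne_top hq a b
  rw [inv_one, one_add_one_eq_two] at h
  rwa [mul_add]

lemma lintegral_add_rpow_lt_top {f g : Env → ℝ≥0∞} (hf : Measurable f)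
    {q : ℝ} (hq : 0 < q) (h1 : ∫⁻ ω, f ω ^ q ∂P < ⊤) (h2 : ∫⁻ ω, g ω ^ q ∂P < ⊤) :
    ∫⁻ ω, (f ω + g ω) ^ q ∂P < ⊤ := by
  refine (lintegral_mono fun ω => add_rpow_le_two hq (f ω) (g ω)).trans_lt ?_
  rw [lintegral_const_mul' _ _ (ENNReal.rpow_ne_top_of_nonneg hq.le (by simp)),
    lintegral_add_left (hf.pow_const q)]
  exact ENNReal.mul_lt_top (ENNReal.rpow_lt_top_of_nonneg hq.le (by simp))
    (ENNReal.add_lt_top.2 ⟨h1, h2⟩)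

variable [IsProbabilityMeasure P]

lemma ae_right_ne_zero (hiid : IsIID P) (h1 : ∫⁻ ω, rho ω 0 ∂P < 1) :
    ∀ᵐ ω ∂P, ∀ x, right ω x ≠ 0 := by
  have h0 : ∀ᵐ ω ∂P, right ω 0 ≠ 0 := by
    filter_upwards [ae_lt_top (measurable_rho 0) (h1.trans ENNReal.one_lt_top).ne] with ω hω h
    have := right_add_left ω 0
    rw [h, zero_add] at this
    rw [rho_eq_div, this, h] at hω
    simp at hω
  refine ae_all_iff.2 fun x => ?_
  filter_upwards [ae_shift hiid x h0] with ω hω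
  simpa [right, shift] using hω

/-- The defect `1 - p_x`, with `p_x` the crossing probability, satisfies `1 - p_x ≤ ρ_x (1 -
p_{x-1})`. By independence and stationarity its mean is at most `E[ρ]` times itself, and `E[ρ] < 1`
forces it to vanish. -/
lemma ae_crossLaw_univ (hiid : IsIID P) (h1 : ∫⁻ ω, rho ω 0 ∂P < 1) :
    ∀ᵐ ω ∂P, ∀ x, crossLaw ω x Set.univ = 1 := by
  have hmp : ∀ x, Measurable[past x] fun ω => 1 - crossLaw ω x Set.univ := fun x => by
    have := measurable_past_lintegral_crossLaw x (fun _ => 1)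
    simp only [lintegral_one] at this
    exact measurable_const.sub this
  have hm : ∀ x, Measurable fun ω => 1 - crossLaw ω x Set.univ := fun x =>
    (hmp x).mono (past_le x) le_rfl
  have hle : ∀ᵐ ω ∂P, 1 - crossLaw ω 0 Set.univ ≤ rho ω 0 * (1 - crossLaw ω (-1) Set.univ) := by
    filter_upwards [ae_right_ne_zero hiid h1] with ω hω
    have e := crossLaw_univ ω 0
    have p1 := crossLaw_univ_le_one ω 0
    have p2 := crossLaw_univ_le_one ω (-1)
    rw [zero_sub] at e
    have hr := (right_lt_top ω 0).ne
    have hl := (left_lt_top ω 0).ne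
    have hs := right_add_left ω 0
    refine (ENNReal.mul_le_mul_iff_right (hω 0) hr).1 ?_
    rw [rho_eq_div, ← mul_assoc, ENNReal.mul_div_cancel (hω 0) hr]
    generalize crossLaw ω 0 Set.univ = p at *
    generalize crossLaw ω (-1) Set.univ = p' at *
    generalize right ω 0 = r at *
    generalize left ω 0 = l at *
    lift p to NNReal using (p1.trans_lt ENNReal.one_lt_top).ne
    lift p' to NNReal using (p2.trans_lt ENNReal.one_lt_top).ne
    lift r to NNReal using hr
    lift l to NNReal using hl
    norm_cast at *
    rw [← NNReal.coe_le_coe]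
    push_cast [NNReal.coe_sub p1, NNReal.coe_sub p2]
    have e' : (p : ℝ) = r + l * (p' * p) := by exact_mod_cast e
    have hs' : (r : ℝ) + l = 1 := by exact_mod_cast hs
    have q1 : (p : ℝ) ≤ 1 := by exact_mod_cast p1
    have q2 : (p' : ℝ) ≤ 1 := by exact_mod_cast p2
    have e3 : (r : ℝ) * (1 - p) = l * p * (1 - p') := by
      have : (r : ℝ) = 1 - l := by linarith
      rw [this] at e' ⊢
      linear_combination -e'
    rw [e3]
    exact mul_le_mul_of_nonneg_right (mul_le_of_le_one_right l.coe_nonneg q1) (by linarith)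
  have hz : ∫⁻ ω, (1 - crossLaw ω 0 Set.univ) ∂P = 0 := by
    have a1 : ∫⁻ ω, (1 - crossLaw ω 0 Set.univ) ∂P
        ≤ (∫⁻ ω, rho ω 0 ∂P) * ∫⁻ ω, (1 - crossLaw ω 0 Set.univ) ∂P := by
      refine (lintegral_mono_ae hle).trans_eq ?_
      have a2 := lintegral_mul_past hiid 0 measurable_odds (G := fun ω => 1 - crossLaw ω (-1) Set.univ)
        (hmp (-1))
      simp only [← rho_eq_odds] at a2
      rw [a2]
      congr 1
      have a3 := lintegral_shift hiid (-1) (hm 0)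
      simp only [crossLaw_shift, zero_add] at a3
      exact a3
    have a4 : ∫⁻ ω, (1 - crossLaw ω 0 Set.univ) ∂P ≤ 1 :=
      (lintegral_mono (g := fun _ => 1) fun ω => tsub_le_self).trans_eq (by simp)
    by_contra hne
    have a5 := ENNReal.mul_lt_mul_left hne (a4.trans_lt ENNReal.one_lt_top).ne h1
    rw [one_mul] at a5
    exact absurd a1 (not_le.2 a5)
  have h0 : ∀ᵐ ω ∂P, crossLaw ω 0 Set.univ = 1 := by
    filter_upwards [(lintegral_eq_zero_iff (hm 0)).1 hz] with ω hω
    exact le_antisymm (crossLaw_univ_le_one ω 0) (tsub_eq_zero_iff_le.1 hω)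
  refine ae_all_iff.2 fun x => ?_
  filter_upwards [ae_shift hiid x h0] with ω hω
  rwa [crossLaw_shift, zero_add] at hω

lemma lintegral_one_add_rho_rpow_lt_top {q : ℝ} (hq : 0 < q) (h : ∫⁻ ω, rho ω 0 ^ q ∂P < 1) :
    ∫⁻ ω, (1 + rho ω 0) ^ q ∂P < ⊤ :=
  lintegral_add_rpow_lt_top measurable_const hq (by simp) (h.trans ENNReal.one_lt_top)

lemma ae_good_aux (hiid : IsIID P) (h1 : ∫⁻ ω, rho ω 0 ∂P < 1) :
    ∀ᵐ ω ∂P, crossLaw ω (0 - 1) Set.univ = 1 ∧ crossLaw ω 0 Set.univ = 1 ∧ right ω 0 ≠ 0 := by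
  filter_upwards [ae_crossLaw_univ hiid h1, ae_right_ne_zero hiid h1] with ω a b
  exact ⟨a _, a _, b _⟩

lemma lintegral_rho_lt_one {p : ℝ} (hp : 1 ≤ p) (h : ∫⁻ ω, rho ω 0 ^ p ∂P < 1) :
    ∫⁻ ω, rho ω 0 ∂P < 1 := by
  simpa using lintegral_rho_rpow_le one_pos hp h

lemma lintegral_moment_one_rpow (hiid : IsIID P) {p : ℝ} (hp : 1 ≤ p)
    (h : ∫⁻ ω, rho ω 0 ^ p ∂P < 1) : ∫⁻ ω, moment 1 ω 0 ^ p ∂P < ⊤ := by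
  have hp0 : 0 < p := one_pos.trans_le hp
  refine lintegral_moment_rpow_lt_top hiid one_ne_zero hp0 h
    (H := fun ω => 1 + rho ω 0) (measurable_const.add (measurable_rho 0))
    (lintegral_one_add_rho_rpow_lt_top hp0 h) fun K => ?_
  filter_upwards [ae_good_aux hiid (lintegral_rho_lt_one hp h)] with ω ⟨a, b, c⟩
  refine (truncMoment_one_succ_le a b c K).trans_eq ?_
  rw [zero_sub]
  ring

lemma ae_moment_one_lt_top (hiid : IsIID P) (h1 : ∫⁻ ω, rho ω 0 ∂P < 1) :
    ∀ᵐ ω ∂P, moment 1 ω 0 < ⊤ := by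
  have := lintegral_moment_one_rpow hiid le_rfl (p := 1) (by simpa using h1)
  simp only [ENNReal.rpow_one] at this
  exact ae_lt_top (measurable_moment 1 0) this.ne

/-- Controls the forcing terms: the exponent `q / n` turns the `n`-th powers into `q`-th powers, and
`F` is independent of `ρ_0`. -/
lemma lintegral_rho_mul_moment (hiid : IsIID P) {q : ℝ}
    {F : Env → ℝ≥0∞} (hF : Measurable[past (-1)] F) (c : ℝ≥0∞) (hc : c ≠ ⊤) {n : ℕ} (hn : 0 < n)
    (hq : 0 < q) (hρ : ∫⁻ ω, rho ω 0 ^ q ∂P < 1)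
    (hFq : ∫⁻ ω, F ω ^ q ∂P < ⊤) :
    ∫⁻ ω, (c * (1 + rho ω 0) ^ n * F ω ^ n) ^ (q / n) ∂P < ⊤ := by
  have hn' : (n : ℝ) ≠ 0 := by positivity
  have hqn : 0 ≤ q / n := by positivity
  have e : ∀ ω, (c * (1 + rho ω 0) ^ n * F ω ^ n) ^ (q / n)
      = c ^ (q / n) * ((1 + rho ω 0) ^ q * F ω ^ q) := fun ω => by
    rw [ENNReal.mul_rpow_of_nonneg _ _ hqn, ENNReal.mul_rpow_of_nonneg _ _ hqn,
      ← ENNReal.rpow_natCast, ← ENNReal.rpow_natCast, ← ENNReal.rpow_mul, ← ENNReal.rpow_mul,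
      mul_div_cancel₀ _ hn', mul_assoc]
  simp only [e]
  have hg : Measurable fun u => (1 + odds u) ^ q := (measurable_const.add measurable_odds).pow_const q
  have h2 := lintegral_mul_past hiid 0 hg (G := fun ω => F ω ^ q) (hF.pow_const q)
  simp only [← rho_eq_odds] at h2
  rw [lintegral_const_mul' _ _ (ENNReal.rpow_ne_top_of_nonneg hqn hc), h2]
  exact ENNReal.mul_lt_top (ENNReal.rpow_lt_top_of_nonneg hqn hc)
    (ENNReal.mul_lt_top (lintegral_one_add_rho_rpow_lt_top hq hρ) hFq)

lemma lintegral_moment_rpow_neg_one (hiid : IsIID P) (j : ℕ) (q : ℝ) :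
    ∫⁻ ω, moment j ω (-1) ^ q ∂P = ∫⁻ ω, moment j ω 0 ^ q ∂P := by
  rw [← lintegral_shift hiid (-1) ((measurable_moment j 0).pow_const q)]
  simp only [moment_shift, zero_add]

/-- Once the mean at `0` is rewritten through the mean at `-1`, the forcing in the second-moment
recursion is a polynomial of degree two in `ρ_0` and in that mean; both are in `L^p`, so it is in
`L^{p/2}`. -/
lemma lintegral_moment_two_rpow (hiid : IsIID P) {p : ℝ} (hp : 1 ≤ p)
    (h : ∫⁻ ω, rho ω 0 ^ p ∂P < 1) : ∫⁻ ω, moment 2 ω 0 ^ (p / 2) ∂P < ⊤ := by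
  have hp0 : 0 < p := one_pos.trans_le hp
  have hF : Measurable[past (-1)] fun ω => 1 + moment 1 ω (-1) :=
    measurable_const.add (measurable_past_moment 1 (-1))
  have hFq : ∫⁻ ω, (1 + moment 1 ω (-1)) ^ p ∂P < ⊤ := by
    refine lintegral_add_rpow_lt_top measurable_const hp0 (by simp) ?_
    rw [lintegral_moment_rpow_neg_one hiid]
    exact lintegral_moment_one_rpow hiid hp h
  have hH := lintegral_rho_mul_moment hiid hF 5 (by simp) (n := 2) (by norm_num) hp0 h hFq
  refine lintegral_moment_rpow_lt_top hiid two_ne_zero (by positivity)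
    (lintegral_rho_rpow_le (by positivity) (by linarith) h)
    (H := fun ω => 5 * (1 + rho ω 0) ^ 2 * (1 + moment 1 ω (-1)) ^ 2)
    (((measurable_const.add (measurable_rho 0)).pow_const 2).const_mul _ |>.mul
      ((measurable_const.add (measurable_moment 1 (-1))).pow_const 2)) (by exact_mod_cast hH)
    fun K => ?_
  have h1 := lintegral_rho_lt_one hp h
  filter_upwards [ae_good_aux hiid h1, ae_moment_one_lt_top hiid h1] with ω ⟨a, b, c⟩ d
  refine (truncMoment_two_succ_le a b c K).trans ?_
  rw [moment_one_eq a b c d, zero_sub]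
  generalize moment 1 ω (-1) = m
  generalize truncMoment 2 K ω (-1) = t
  generalize rho ω 0 = r
  have e : 5 * (1 + r) ^ 2 * (1 + m) ^ 2 + r * t = (1 + r * (1 + 2 * m + t
    + 2 * (1 + m) * (1 + r * (1 + m)))) + (4 + 7 * r + 3 * r ^ 2 + 10 * m + 16 * m * r
      + 6 * m * r ^ 2 + 5 * m ^ 2 + 10 * m ^ 2 * r + 3 * m ^ 2 * r ^ 2) := by ring
  rw [e]
  exact le_self_add

/-- Here `s` stands for the square root of the second moment at `-1`. With it the forcing of the
third-moment recursion is dominated by a product of two cubes, one in `1 + r` and one in `1 + m +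
s`, each base having a `p`-th moment. -/
lemma cubic_moment_bound (m s r t : ℝ≥0∞) :
    1 + r * (1 + 3 * m + 3 * s ^ 2 + t + 3 * (1 + 2 * m + s ^ 2) * (1 + r * (1 + m))
      + 3 * (1 + m) * (1 + r * (1 + 2 * m + s ^ 2 + 2 * (1 + m) * (1 + r * (1 + m)))))
      ≤ 20 * (1 + r) ^ 3 * ((1 + m) + s) ^ 3 + r * t := by
  have hm : 1 + m ≤ (1 + m) + s := le_self_add
  have hU : 1 ≤ (1 + m) + s := le_self_add.trans hm
  have hq : 1 + 2 * m + s ^ 2 ≤ ((1 + m) + s) ^ 2 := by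
    rw [show ((1 + m) + s) ^ 2 = (1 + 2 * m + s ^ 2) + (m ^ 2 + 2 * s + 2 * m * s) by ring]
    exact le_self_add
  have hR : 1 ≤ 1 + r := le_self_add
  have hr : r ≤ 1 + r := le_add_self
  have h1 : 1 + r * (1 + m) ≤ (1 + r) * ((1 + m) + s) := by
    rw [add_mul, one_mul]; gcongr
  set U := (1 + m) + s
  set R := 1 + r
  have hU3 : U ^ 2 ≤ U ^ 3 := pow_le_pow_right₀ hU (by norm_num)
  have hRp : 1 ≤ R ^ 2 := one_le_pow₀ hR
  have hR12 : R ≤ R ^ 2 := by simpa using pow_le_pow_right₀ hR (show 1 ≤ 2 by norm_num)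
  have h2 : 1 + r * (1 + 2 * m + s ^ 2 + 2 * (1 + m) * (1 + r * (1 + m))) ≤ 4 * R ^ 2 * U ^ 2 := by
    calc 1 + r * (1 + 2 * m + s ^ 2 + 2 * (1 + m) * (1 + r * (1 + m)))
        ≤ R ^ 2 * U ^ 2 + R * (R * U ^ 2 + 2 * U * (R * U)) := by
          gcongr
          · exact one_le_mul hRp (one_le_pow₀ hU)
          · exact hq.trans (le_mul_of_one_le_left zero_le hR)
      _ = 4 * R ^ 2 * U ^ 2 := by ring
  calc 1 + r * (1 + 3 * m + 3 * s ^ 2 + t + 3 * (1 + 2 * m + s ^ 2) * (1 + r * (1 + m))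
      + 3 * (1 + m) * (1 + r * (1 + 2 * m + s ^ 2 + 2 * (1 + m) * (1 + r * (1 + m)))))
      = 1 + r * (1 + 3 * m + 3 * s ^ 2 + 3 * (1 + 2 * m + s ^ 2) * (1 + r * (1 + m))
      + 3 * (1 + m) * (1 + r * (1 + 2 * m + s ^ 2 + 2 * (1 + m) * (1 + r * (1 + m)))))
      + r * t := by ring
    _ ≤ R ^ 3 * U ^ 3 + R * (3 * (R ^ 2 * U ^ 3) + 3 * U ^ 2 * (R ^ 2 * U)
        + 3 * U * (4 * R ^ 2 * U ^ 2)) + r * t := by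
        gcongr
        · exact one_le_mul (one_le_pow₀ hR) (one_le_pow₀ hU)
        · calc 1 + 3 * m + 3 * s ^ 2 ≤ 3 * (1 + 2 * m + s ^ 2) := by
                rw [show 3 * (1 + 2 * m + s ^ 2) = (1 + 3 * m + 3 * s ^ 2) + (2 + 3 * m) by ring]
                exact le_self_add
            _ ≤ 3 * (R ^ 2 * U ^ 3) := by
                gcongr
                exact (hq.trans hU3).trans (le_mul_of_one_le_left zero_le hRp)
        · exact h1.trans (by gcongr)
    _ = 19 * R ^ 3 * U ^ 3 + r * t := by ring
    _ ≤ 20 * R ^ 3 * U ^ 3 + r * t := by gcongr; norm_num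

lemma lintegral_moment_three_rpow (hiid : IsIID P) {p : ℝ} (hp : 2 ≤ p)
    (h : ∫⁻ ω, rho ω 0 ^ p ∂P < 1) : ∫⁻ ω, moment 3 ω 0 ^ (p / 3) ∂P < ⊤ := by
  have hp1 : 1 ≤ p := by linarith
  have hp0 : 0 < p := by linarith
  have hF : Measurable[past (-1)] fun ω => (1 + moment 1 ω (-1)) + moment 2 ω (-1) ^ (1 / 2 : ℝ) :=
    (measurable_const.add (measurable_past_moment 1 (-1))).add
      ((measurable_past_moment 2 (-1)).pow_const _)
  have hFq : ∫⁻ ω, ((1 + moment 1 ω (-1)) + moment 2 ω (-1) ^ (1 / 2 : ℝ)) ^ p ∂P < ⊤ := by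
    refine lintegral_add_rpow_lt_top (measurable_const.add (measurable_moment 1 (-1))) hp0
      (lintegral_add_rpow_lt_top measurable_const hp0 (by simp) ?_) ?_
    · rw [lintegral_moment_rpow_neg_one hiid]
      exact lintegral_moment_one_rpow hiid hp1 h
    · simp only [← ENNReal.rpow_mul, one_div_mul_eq_div]
      rw [lintegral_moment_rpow_neg_one hiid]
      exact lintegral_moment_two_rpow hiid hp1 h
  have hH := lintegral_rho_mul_moment hiid hF 20 (by simp) (n := 3) (by norm_num) hp0 h hFq
  refine lintegral_moment_rpow_lt_top hiid three_ne_zero (by positivity)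
    (lintegral_rho_rpow_le (by positivity) (by linarith) h)
    (H := fun ω => 20 * (1 + rho ω 0) ^ 3 * ((1 + moment 1 ω (-1))
      + moment 2 ω (-1) ^ (1 / 2 : ℝ)) ^ 3)
    (((measurable_const.add (measurable_rho 0)).pow_const 3).const_mul _ |>.mul
      ((hF.mono (past_le _) le_rfl).pow_const 3)) (by exact_mod_cast hH)
    fun K => ?_
  have h1 := lintegral_rho_lt_one hp1 h
  have h2 := lintegral_moment_two_rpow hiid one_le_two (lintegral_rho_rpow_le two_pos hp h)
  simp only [div_self (two_ne_zero' ℝ), ENNReal.rpow_one] at h2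
  filter_upwards [ae_good_aux hiid h1, ae_moment_one_lt_top hiid h1,
    ae_lt_top (measurable_moment 2 0) h2.ne] with ω ⟨a, b, c⟩ d d2
  refine (truncMoment_three_succ_le a b c K).trans ?_
  have e1 := moment_one_eq a b c d
  have e2 := moment_two_eq a b c d2
  rw [zero_sub] at *
  have hs : moment 2 ω (-1) = (moment 2 ω (-1) ^ (1 / 2 : ℝ)) ^ 2 := by
    rw [← ENNReal.rpow_natCast, ← ENNReal.rpow_mul]; simp
  rw [e2, e1]
  generalize moment 1 ω (-1) = m at *
  generalize truncMoment 3 K ω (-1) = t at *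
  generalize rho ω 0 = r at *
  generalize moment 2 ω (-1) ^ (1 / 2 : ℝ) = s at *
  rw [hs]
  exact cubic_moment_bound m s r t

end Moments

/-! ### Scalar inequalities behind the von Bahr–Esseen bound. -/

section ScalarInequalities

/-- For small `x`, split off one factor `1 + x` and use Bernoulli with exponent `s - 1 ≤ 1`; the
remainder is at most `x² ≤ |x|^s`. For `|x| ≥ 1/2`, `13 = 9 + 4`: `9` from `3^s ≤ 9`, and `4` from
`-s x ≤ 2|x| ≤ 4|x|^s`. -/
lemma one_add_abs_rpow_le {s : ℝ} (hs1 : 1 < s) (hs2 : s ≤ 2) (x : ℝ) :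
    |1 + x| ^ s ≤ 1 + s * x + 13 * |x| ^ s := by
  have hs0 : 0 < s := by linarith
  rcases le_total |x| (1 / 2) with h | h
  · have hx := abs_le.1 h
    have h1 : 0 < 1 + x := by linarith [hx.1]
    rw [abs_of_pos h1]
    have h2 : (1 + x) ^ s = (1 + x) * (1 + x) ^ (s - 1) := by
      rw [← Real.rpow_one_add' h1.le (by linarith)]; congr 1; ring
    have h3 := rpow_one_add_le_one_add_mul_self (s := x) (by linarith [hx.1]) (p := s - 1)
      (by linarith) (by linarith)
    have h4 : x ^ 2 ≤ |x| ^ s := by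
      rcases eq_or_ne x 0 with rfl | hx0
      · simp [hs0.ne']
      · have := Real.rpow_le_rpow_of_exponent_ge (abs_pos.2 hx0) (by linarith) hs2
        rwa [Real.rpow_two, sq_abs] at this
    rw [h2]
    have h5 : (s - 1) * x ^ 2 ≤ x ^ 2 := mul_le_of_le_one_left (sq_nonneg x) (by linarith)
    calc (1 + x) * (1 + x) ^ (s - 1) ≤ (1 + x) * (1 + (s - 1) * x) := by gcongr
      _ = 1 + s * x + (s - 1) * x ^ 2 := by ring
      _ ≤ 1 + s * x + 13 * |x| ^ s := by nlinarith [sq_nonneg x]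
  · have h1 : |1 + x| ≤ 3 * |x| := by
      calc |1 + x| ≤ |1| + |x| := abs_add_le _ _
        _ ≤ 3 * |x| := by rw [abs_one]; linarith
    have h2 : |1 + x| ^ s ≤ 9 * |x| ^ s := by
      calc |1 + x| ^ s ≤ (3 * |x|) ^ s := by gcongr
        _ = 3 ^ s * |x| ^ s := Real.mul_rpow (by norm_num) (abs_nonneg x)
        _ ≤ 9 * |x| ^ s := by
          gcongr
          calc (3 : ℝ) ^ s ≤ 3 ^ (2 : ℝ) := Real.rpow_le_rpow_of_exponent_le (by norm_num) hs2
            _ = 9 := by norm_num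
    have hpos : 0 < |x| := by linarith
    have h3 : |x| ≤ 2 * |x| ^ s := by
      have e : |x| ^ s = |x| * |x| ^ (s - 1) := by
        rw [← Real.rpow_one_add' hpos.le (by linarith)]; congr 1; ring
      have h4 : 1 / 2 ≤ |x| ^ (s - 1) := by
        calc (1 / 2 : ℝ) = (1 / 2) ^ (1 : ℝ) := by simp
          _ ≤ (1 / 2) ^ (s - 1) :=
            Real.rpow_le_rpow_of_exponent_ge (by norm_num) (by norm_num) (by linarith)
          _ ≤ |x| ^ (s - 1) := Real.rpow_le_rpow (by norm_num) h (by linarith)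
      rw [e]; nlinarith
    have h5 : -(s * x) ≤ 2 * |x| := by
      calc -(s * x) ≤ |s * x| := neg_le_abs _
        _ = s * |x| := by rw [abs_mul, abs_of_pos hs0]
        _ ≤ 2 * |x| := by gcongr
    linarith

/-- The term linear in `b` carries the derivative of `|·|^s` at `a`; it averages to zero when `b` is
a martingale increment over `a`. -/
lemma abs_add_rpow_le {s : ℝ} (hs1 : 1 < s) (hs2 : s ≤ 2) (a b : ℝ) :
    |a + b| ^ s ≤ |a| ^ s + s * (SignType.sign a * |a| ^ (s - 1)) * b + 13 * |b| ^ s := by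
  have hs0 : 0 < s := by linarith
  rcases eq_or_ne a 0 with rfl | ha
  · have : 0 ≤ |b| ^ s := by positivity
    simp [hs0.ne']
    linarith
  · have hpos : 0 < |a| := abs_pos.2 ha
    have h := one_add_abs_rpow_le hs1 hs2 (b / a)
    have e : a + b = a * (1 + b / a) := by field_simp
    have e2 : |a| ^ s = |a| ^ (s - 1) * |a| := by
      rw [← Real.rpow_add_one hpos.ne']; congr 1; ring
    have hsign : (SignType.sign a : ℝ) * a = |a| := sign_mul_self a
    have hss : (SignType.sign a : ℝ) = |a| / a := by
      rw [← hsign]; field_simp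
    rw [e, abs_mul, Real.mul_rpow hpos.le (abs_nonneg _)]
    calc |a| ^ s * |1 + b / a| ^ s ≤ |a| ^ s * (1 + s * (b / a) + 13 * |b / a| ^ s) := by gcongr
      _ = |a| ^ s + s * (SignType.sign a * |a| ^ (s - 1)) * b + 13 * |b| ^ s := by
        rw [abs_div, Real.div_rpow (abs_nonneg b) hpos.le, hss]
        have : |a| ^ s ≠ 0 := by positivity
        field_simp
        rw [e2]
        ring

lemma rpow_sub_one_mul_le {s x y : ℝ} (hs : 1 < s) (hx : 0 ≤ x) (hy : 0 ≤ y) :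
    x ^ (s - 1) * y ≤ x ^ s + y ^ s := by
  rcases le_total x y with h | h
  · calc x ^ (s - 1) * y ≤ y ^ (s - 1) * y := by gcongr
      _ = y ^ s := by
        rw [← Real.rpow_add_one' hy (by linarith)]; congr 1; ring
      _ ≤ x ^ s + y ^ s := le_add_of_nonneg_left (by positivity)
  · calc x ^ (s - 1) * y ≤ x ^ (s - 1) * x := by gcongr
      _ = x ^ s := by
        rw [← Real.rpow_add_one' hx (by linarith)]; congr 1; ring
      _ ≤ x ^ s + y ^ s := le_add_of_nonneg_right (by positivity)

lemma abs_le_one_add_abs_rpow {s : ℝ} (hs : 1 ≤ s) (x : ℝ) : |x| ≤ 1 + |x| ^ s := by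
  rcases le_total |x| 1 with h | h
  · linarith [show 0 ≤ |x| ^ s by positivity]
  · calc |x| = |x| ^ (1 : ℝ) := by simp
      _ ≤ |x| ^ s := Real.rpow_le_rpow_of_exponent_le h hs
      _ ≤ 1 + |x| ^ s := by linarith

end ScalarInequalities

/-! ### Deterministic growth of partial sums. -/

section Growth

/-- The partial sums of `x` grow at most like `n ^ b`. -/
def SumGrowth (b : ℝ) (x : ℕ → ℝ) : Prop :=
  ∃ C, ∀ n : ℕ, |∑ k ∈ Finset.range n, x k| ≤ C * ((n : ℝ) + 1) ^ b

lemma SumGrowth.add {b : ℝ} {x y : ℕ → ℝ} (hx : SumGrowth b x) (hy : SumGrowth b y) :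
    SumGrowth b fun k => x k + y k := by
  obtain ⟨C, hC⟩ := hx
  obtain ⟨D, hD⟩ := hy
  refine ⟨C + D, fun n => ?_⟩
  rw [Finset.sum_add_distrib, add_mul]
  exact (abs_add_le _ _).trans (add_le_add (hC n) (hD n))

lemma SumGrowth.const_mul {b : ℝ} {x : ℕ → ℝ} (hx : SumGrowth b x) (c : ℝ) :
    SumGrowth b fun k => c * x k := by
  obtain ⟨C, hC⟩ := hx
  refine ⟨|c| * C, fun n => ?_⟩
  rw [← Finset.mul_sum, abs_mul, mul_assoc]
  exact mul_le_mul_of_nonneg_left (hC n) (abs_nonneg c)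

/-- Partial sums inherit the affine recursion, and `(|x 0| + C) / (1 - lam)` is the fixed point of
`D ↦ |x 0| + lam D + C`. -/
lemma SumGrowth.of_recursion {b lam : ℝ} (hb : 0 ≤ b) (h0 : 0 ≤ lam) (h1 : lam < 1)
    {x y : ℕ → ℝ} (hrec : ∀ k, x (k + 1) = lam * x k + y k) (hy : SumGrowth b y) :
    SumGrowth b x := by
  obtain ⟨C, hC⟩ := hy
  have hC0 : 0 ≤ C := by simpa using hC 0
  have hl : 0 < 1 - lam := by linarith
  refine ⟨(|x 0| + C) / (1 - lam), fun n => ?_⟩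
  induction n with
  | zero => simp; positivity
  | succ n ih =>
    have e : ∑ k ∈ Finset.range (n + 1), x k
        = x 0 + lam * (∑ k ∈ Finset.range n, x k) + ∑ k ∈ Finset.range n, y k := by
      rw [Finset.sum_range_succ', Finset.mul_sum, add_assoc, ← Finset.sum_add_distrib, add_comm]
      simp only [hrec]
    have hpow : ((n : ℝ) + 1) ^ b ≤ ((n + 1 : ℕ) + 1 : ℝ) ^ b := by
      push_cast; gcongr; linarith
    have hone : 1 ≤ ((n + 1 : ℕ) + 1 : ℝ) ^ b :=
      Real.one_le_rpow (by push_cast; linarith [n.cast_nonneg (α := ℝ)]) hb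
    set D := (|x 0| + C) / (1 - lam) with hD
    have hD0 : 0 ≤ D := by positivity
    have hDe : |x 0| + lam * D + C = D := by
      rw [hD]; field_simp; ring
    rw [e]
    calc |x 0 + lam * (∑ k ∈ Finset.range n, x k) + ∑ k ∈ Finset.range n, y k|
        ≤ |x 0| + lam * |∑ k ∈ Finset.range n, x k| + |∑ k ∈ Finset.range n, y k| := by
          refine (abs_add_le _ _).trans ?_
          gcongr
          refine (abs_add_le _ _).trans ?_
          rw [abs_mul, abs_of_nonneg h0]
      _ ≤ |x 0| * 1 + lam * (D * ((n : ℝ) + 1) ^ b) + C * ((n : ℝ) + 1) ^ b := by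
          rw [mul_one]
          gcongr
          exact hC n
      _ ≤ |x 0| * ((n + 1 : ℕ) + 1 : ℝ) ^ b + lam * (D * ((n + 1 : ℕ) + 1 : ℝ) ^ b)
          + C * ((n + 1 : ℕ) + 1 : ℝ) ^ b := by gcongr
      _ = (|x 0| + lam * D + C) * ((n + 1 : ℕ) + 1 : ℝ) ^ b := by ring
      _ = D * ((n + 1 : ℕ) + 1 : ℝ) ^ b := by rw [hDe]

/-- Kronecker's lemma for bounded weighted sums. -/
lemma SumGrowth.of_weighted {b : ℝ} (hb : 0 < b) {d : ℕ → ℝ} {C : ℝ}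
    (h : ∀ n : ℕ, |∑ k ∈ Finset.range n, d k * ((k : ℝ) + 1) ^ (-b)| ≤ C) : SumGrowth b d := by
  have hC : 0 ≤ C := by simpa using h 0
  set M : ℕ → ℝ := fun n => ∑ k ∈ Finset.range n, d k * ((k : ℝ) + 1) ^ (-b) with hM
  -- Abel summation: the difference equals `-∑ ((k+1)^b - k^b) M k` over `k < n`, and the positive
  -- weights telescope to `n^b`.
  have key : ∀ n : ℕ, |∑ k ∈ Finset.range n, d k - (n : ℝ) ^ b * M n| ≤ C * (n : ℝ) ^ b := by
    intro n
    induction n with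
    | zero => simp [hb.ne']
    | succ n ih =>
      have hd : d n = ((n : ℝ) + 1) ^ b * (M (n + 1) - M n) := by
        have : ((n : ℝ) + 1) ^ b ≠ 0 := by positivity
        simp only [hM, Finset.sum_range_succ, add_sub_cancel_left]
        rw [Real.rpow_neg (by positivity)]
        field_simp
      have hmono : (n : ℝ) ^ b ≤ ((n : ℝ) + 1) ^ b := by gcongr; linarith
      have e : ∑ k ∈ Finset.range (n + 1), d k - ((n + 1 : ℕ) : ℝ) ^ b * M (n + 1)
          = (∑ k ∈ Finset.range n, d k - (n : ℝ) ^ b * M n)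
            - (((n : ℝ) + 1) ^ b - (n : ℝ) ^ b) * M n := by
        rw [Finset.sum_range_succ, hd]; push_cast; ring
      rw [e]
      calc _ ≤ C * (n : ℝ) ^ b + (((n : ℝ) + 1) ^ b - (n : ℝ) ^ b) * C := by
            refine (abs_sub _ _).trans (add_le_add ih ?_)
            rw [abs_mul, abs_of_nonneg (by linarith)]
            exact mul_le_mul_of_nonneg_left (h n) (by linarith)
        _ = C * ((n + 1 : ℕ) : ℝ) ^ b := by push_cast; ring
  refine ⟨2 * C, fun n => ?_⟩
  have hmono : (n : ℝ) ^ b ≤ ((n : ℝ) + 1) ^ b := by gcongr; linarith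
  calc |∑ k ∈ Finset.range n, d k|
      = |(∑ k ∈ Finset.range n, d k - (n : ℝ) ^ b * M n) + (n : ℝ) ^ b * M n| := by
        rw [sub_add_cancel]
    _ ≤ C * (n : ℝ) ^ b + (n : ℝ) ^ b * C := by
        refine (abs_add_le _ _).trans (add_le_add (key n) ?_)
        rw [abs_mul, abs_of_nonneg (by positivity)]
        exact mul_le_mul_of_nonneg_left (h n) (by positivity)
    _ = 2 * C * (n : ℝ) ^ b := by ring
    _ ≤ 2 * C * ((n : ℝ) + 1) ^ b := by gcongr

end Growth

/-! ### Almost sure growth of martingale transforms. -/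

section MartingaleTransform

variable {Ω : Type*} {m0 : MeasurableSpace Ω} {P : Measure Ω} [IsProbabilityMeasure P]
  {F : Filtration ℕ m0} {ξ A : ℕ → Ω → ℝ} {s : ℝ}

lemma integrable_of_abs_rpow {f : Ω → ℝ} (hs : 1 ≤ s) (hf : AEStronglyMeasurable f P)
    (h : Integrable (fun ω => |f ω| ^ s) P) : Integrable f P := by
  refine Integrable.mono' ((integrable_const (1 : ℝ)).add h) hf (ae_of_all _ fun ω => ?_)
  exact abs_le_one_add_abs_rpow hs (f ω)

/-- Almost sure growth of the sums of a martingale transform `ξ k * A k` of centred variables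
`ξ k`, independent of the past, by previsible `A k`, under moments of order `s ∈ (1, 2]`. -/
theorem ae_sumGrowth_martingale (hs1 : 1 < s) (hs2 : s ≤ 2) {b : ℝ} (hb : 1 / s < b)
    (hξm : ∀ n, Measurable[F (n + 1)] (ξ n)) (hAm : ∀ n, Measurable[F n] (A n))
    (hind : ∀ n, Indep (MeasurableSpace.comap (ξ n) inferInstance) (F n) P)
    (hξ0 : ∀ n, ∫ ω, ξ n ω ∂P = 0)
    (hξs : ∀ n, Integrable (fun ω => |ξ n ω| ^ s) P)
    (hAs : ∀ n, Integrable (fun ω => |A n ω| ^ s) P) {K : ℝ}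
    (hK : ∀ n, (∫ ω, |ξ n ω| ^ s ∂P) * ∫ ω, |A n ω| ^ s ∂P ≤ K) :
    ∀ᵐ ω ∂P, SumGrowth b fun k => ξ k ω * A k ω := by
  have hs0 : 0 < s := by linarith
  have hb0 : 0 < b := lt_trans (by positivity) hb
  have hξm0 : ∀ n, Measurable (ξ n) := fun n => (hξm n).mono (F.le _) le_rfl
  have hAm0 : ∀ n, Measurable (A n) := fun n => (hAm n).mono (F.le _) le_rfl
  have hindF : ∀ n (B : Ω → ℝ), Measurable[F n] B → IndepFun (ξ n) B P := fun n B hB =>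
    (IndepFun_iff_Indep _ _ _).2 (indep_of_indep_of_le_right (hind n) hB.comap_le)
  have hξi : ∀ n, Integrable (ξ n) P := fun n =>
    integrable_of_abs_rpow hs1.le (hξm0 n).aestronglyMeasurable (hξs n)
  set w : ℕ → ℝ := fun k => ((k : ℝ) + 1) ^ (-b) with hw
  have hw0 : ∀ k, 0 ≤ w k := fun k => by positivity
  set M : ℕ → Ω → ℝ := fun n ω => ∑ k ∈ Finset.range n, ξ k ω * A k ω * w k with hM
  have hMm : ∀ n, Measurable[F n] (M n) := fun n => by
    refine Finset.measurable_sum (m := F n) _ fun k hk => ?_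
    have hk' := Finset.mem_range.1 hk
    exact (((hξm k).mono (F.mono (by omega)) le_rfl).mul
      ((hAm k).mono (F.mono (by omega)) le_rfl)).mul measurable_const
  have hMm0 : ∀ n, Measurable (M n) := fun n => (hMm n).mono (F.le _) le_rfl
  have hMs : ∀ n ω, M (n + 1) ω = M n ω + ξ n ω * A n ω * w n := fun n ω => by
    simp only [hM, Finset.sum_range_succ]
  have hDs : ∀ n, Integrable (fun ω => |ξ n ω * A n ω * w n| ^ s) P ∧
      ∫ ω, |ξ n ω * A n ω * w n| ^ s ∂P ≤ w n ^ s * K := by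
    intro n
    have hi : IndepFun (fun ω => |ξ n ω| ^ s) (fun ω => |A n ω| ^ s) P :=
      (hindF n (A n) (hAm n)).comp (φ := fun x => |x| ^ s) (ψ := fun x => |x| ^ s)
        (measurable_id.abs.pow_const s) (measurable_id.abs.pow_const s)
    have e : ∀ ω, |ξ n ω * A n ω * w n| ^ s = w n ^ s * (|ξ n ω| ^ s * |A n ω| ^ s) := by
      intro ω
      rw [abs_mul, abs_mul, abs_of_nonneg (hw0 n), Real.mul_rpow (by positivity) (hw0 n),
        Real.mul_rpow (abs_nonneg _) (abs_nonneg _), mul_comm]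
    simp only [e]
    refine ⟨(hi.integrable_mul (hξs n) (hAs n)).const_mul _, ?_⟩
    rw [integral_const_mul, hi.integral_fun_mul_eq_mul_integral (hξs n).1 (hAs n).1]
    have := hK n
    gcongr
  -- Von Bahr–Esseen by induction: expand `|M n + increment|^s` with `abs_add_rpow_le`; only the
  -- `s`-th moments of the increments accumulate.
  have hMint : ∀ n, Integrable (fun ω => |M n ω| ^ s) P ∧
      ∫ ω, |M n ω| ^ s ∂P ≤ 13 * K * ∑ k ∈ Finset.range n, w k ^ s := by
    intro n
    induction n with
    | zero => simp [hM, hs0.ne']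
    | succ n ih =>
      -- Previsible coefficient of `ξ n` in the linear term, up to the constant `s * w n`. As `ξ n`
      -- is centred and independent of the past, the cross term integrates to zero.
      set B : Ω → ℝ := fun ω => SignType.sign (M n ω) * |M n ω| ^ (s - 1) * A n ω with hB
      have hsm : Measurable fun x : ℝ => ((SignType.sign x : SignType) : ℝ) := by
        have : (fun x : ℝ => ((SignType.sign x : SignType) : ℝ))
            = fun x => if 0 < x then 1 else if x < 0 then -1 else 0 := by
          ext x; rw [sign_apply]; split_ifs <;> simp
        rw [this]
        exact Measurable.ite measurableSet_Ioi measurable_const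
          (Measurable.ite measurableSet_Iio measurable_const measurable_const)
      have hBm : Measurable[F n] B :=
        ((hsm.comp (hMm n)).mul ((measurable_norm.comp (hMm n)).pow_const (s - 1))).mul (hAm n)
      have hBi : Integrable B P := by
        refine Integrable.mono' (ih.1.add (hAs n)) (hBm.mono (F.le _) le_rfl).aestronglyMeasurable
          (ae_of_all _ fun ω => ?_)
        have h1 : |((SignType.sign (M n ω) : SignType) : ℝ)| ≤ 1 := by
          rcases lt_trichotomy (M n ω) 0 with h | h | h <;> simp [h]
        rw [Real.norm_eq_abs, hB, abs_mul, abs_mul, abs_of_nonneg (by positivity : 0 ≤ |M n ω| ^ (s - 1)), mul_assoc]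
        refine (mul_le_of_le_one_left (by positivity) h1).trans ?_
        exact rpow_sub_one_mul_le hs1 (abs_nonneg _) (abs_nonneg _)
      have hξB := hindF n B hBm
      have hcross : Integrable (fun ω => ξ n ω * B ω) P := hξB.integrable_mul (hξi n) hBi
      have hcross0 : ∫ ω, ξ n ω * B ω ∂P = 0 := by
        rw [hξB.integral_fun_mul_eq_mul_integral (hξi n).1 hBi.1, hξ0, zero_mul]
      have hbound : ∀ ω, |M (n + 1) ω| ^ s ≤ |M n ω| ^ s + s * w n * (ξ n ω * B ω)
          + 13 * |ξ n ω * A n ω * w n| ^ s := fun ω => by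
        rw [hMs]
        refine (abs_add_rpow_le hs1 hs2 _ _).trans_eq ?_
        rw [hB]; ring
      have hint : Integrable (fun ω => |M n ω| ^ s + s * w n * (ξ n ω * B ω)
          + 13 * |ξ n ω * A n ω * w n| ^ s) P :=
        (ih.1.add (hcross.const_mul _)).add ((hDs n).1.const_mul _)
      have hint1 : Integrable (fun ω => |M (n + 1) ω| ^ s) P := by
        refine Integrable.mono' hint
          ((measurable_norm.comp (hMm0 (n + 1))).pow_const s).aestronglyMeasurable
          (ae_of_all _ fun ω => ?_)
        rw [Real.norm_eq_abs, abs_of_nonneg (by positivity)]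
        exact hbound ω
      refine ⟨hint1, (integral_mono hint1 hint hbound).trans ?_⟩
      rw [integral_add (f := fun ω => |M n ω| ^ s + s * w n * (ξ n ω * B ω))
          (ih.1.add (hcross.const_mul _)) ((hDs n).1.const_mul _),
        integral_add ih.1 (hcross.const_mul _), integral_const_mul, integral_const_mul, hcross0,
        Finset.sum_range_succ]
      linarith [ih.2, (hDs n).2]
  have hK0 : 0 ≤ K := le_trans (by positivity) (hK 0)
  -- This is where `b > 1 / s` is used: the exponent `b s` exceeds `1`.
  have hsum : Summable fun k => w k ^ s := by
    have h1 : Summable fun k : ℕ => ((k : ℝ) + 1) ^ (-(b * s)) := by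
      have h2 : Summable fun k : ℕ => ((k : ℝ)) ^ (-(b * s)) := by
        refine Real.summable_nat_rpow.2 ?_
        have := (div_lt_iff₀ hs0).1 hb
        linarith
      simpa using (summable_nat_add_iff 1).2 h2
    refine h1.congr fun k => ?_
    rw [hw, ← Real.rpow_mul (by positivity), neg_mul]
  -- The weighted sums form an `L¹`-bounded martingale, so they converge and are bounded almost
  -- surely; Kronecker's lemma then removes the weights.
  have hmart : Martingale M F P := by
    have hMi : ∀ n, Integrable (M n) P := fun n =>
      integrable_of_abs_rpow hs1.le (hMm0 n).aestronglyMeasurable (hMint n).1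
    refine martingale_nat (fun n => (hMm n).stronglyMeasurable) hMi fun n => ?_
    have hAi : Integrable (A n) P :=
      integrable_of_abs_rpow hs1.le (hAm0 n).aestronglyMeasurable (hAs n)
    have hDi : Integrable (fun ω => ξ n ω * (A n ω * w n)) P := by
      refine ((hindF n (A n) (hAm n)).integrable_mul (hξi n) hAi).mul_const (w n) |>.congr ?_
      exact ae_of_all _ fun ω => by simp [mul_assoc]
    have e : M (n + 1) = M n + ξ n * fun ω => A n ω * w n := by
      ext ω; simp only [Pi.add_apply, Pi.mul_apply, hMs]; ring
    have h1 : P[ξ n * fun ω => A n ω * w n | F n] =ᵐ[P] P[ξ n | F n] * fun ω => A n ω * w n :=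
      condExp_mul_of_stronglyMeasurable_right
        ((hAm n).mul measurable_const).stronglyMeasurable hDi (hξi n)
    have h2 : P[ξ n | F n] =ᵐ[P] fun _ => ∫ ω, ξ n ω ∂P :=
      condExp_indep_eq (hξm0 n).comap_le (F.le n)
        (comap_measurable (ξ n)).stronglyMeasurable (hind n)
    have h3 : P[M n + ξ n * fun ω => A n ω * w n | F n] =ᵐ[P]
        P[M n | F n] + P[ξ n * fun ω => A n ω * w n | F n] := condExp_add (hMi n) hDi _
    have h4 : P[M n | F n] = M n := condExp_of_stronglyMeasurable (F.le n)
      (hMm n).stronglyMeasurable (hMi n)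
    rw [e]
    filter_upwards [h1, h2, h3] with ω h1 h2 h3
    rw [h3, Pi.add_apply, h1, Pi.mul_apply, h2, h4, hξ0, zero_mul, add_zero]
  have hbdd : ∀ n, eLpNorm (M n) 1 P ≤ ((1 + 13 * K * ∑' k, w k ^ s).toNNReal : NNReal) := by
    intro n
    rw [eLpNorm_one_eq_lintegral_enorm]
    have hMi : Integrable (M n) P :=
      integrable_of_abs_rpow hs1.le (hMm0 n).aestronglyMeasurable (hMint n).1
    rw [← ofReal_integral_norm_eq_lintegral_enorm hMi]
    refine ENNReal.ofReal_le_ofReal ?_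
    calc ∫ ω, ‖M n ω‖ ∂P ≤ ∫ ω, (1 + |M n ω| ^ s) ∂P :=
          integral_mono hMi.norm ((integrable_const (1 : ℝ)).add (hMint n).1)
            fun ω => abs_le_one_add_abs_rpow hs1.le _
      _ = 1 + ∫ ω, |M n ω| ^ s ∂P := by
          rw [integral_add (integrable_const _) (hMint n).1]; simp
      _ ≤ 1 + 13 * K * ∑ k ∈ Finset.range n, w k ^ s := by linarith [(hMint n).2]
      _ ≤ 1 + 13 * K * ∑' k, w k ^ s := by
          gcongr
          exact hsum.sum_le_tsum _ fun k _ => by positivity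
  filter_upwards [hmart.submartingale.exists_ae_tendsto_of_bdd hbdd] with ω ⟨c, hc⟩
  obtain ⟨C, hC⟩ := (Metric.isBounded_range_of_tendsto _ hc).exists_norm_le
  exact SumGrowth.of_weighted hb0 (C := C) fun n => hC _ ⟨n, rfl⟩

end MartingaleTransform

/-! ### Recursions for the quenched mean and variance. -/

/-- Environments in which all passage times to the right have finite third moment. -/
def GoodEnv (ω : Env) : Prop :=
  ∀ x, right ω x ≠ 0 ∧ crossLaw ω x Set.univ = 1 ∧ moment 1 ω x < ⊤ ∧ moment 2 ω x < ⊤ ∧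
    moment 3 ω x < ⊤

/-- One plus the mean of the passage time from `x` to `x + 1`. -/
def passMean (ω : Env) (x : ℤ) : ℝ := 1 + (moment 1 ω x).toReal

/-- The variance of the passage time from `x` to `x + 1`. -/
def passVar (ω : Env) (x : ℤ) : ℝ := (moment 2 ω x).toReal - (moment 1 ω x).toReal ^ 2

/-- The odds of a jump to the left, as a real number. -/
def rhoReal (u : unitInterval) : ℝ := (odds u).toReal

lemma rho_lt_top {ω : Env} {x : ℤ} (h : right ω x ≠ 0) : rho ω x < ⊤ := by
  rw [rho_eq_div]
  exact ENNReal.div_lt_top (left_lt_top ω x).ne h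

lemma GoodEnv.passMean_eq {ω : Env} (h : GoodEnv ω) (x : ℤ) :
    passMean ω x = 2 + rhoReal (ω x) * passMean ω (x - 1) := by
  obtain ⟨h0, hu, h1, h2, -⟩ := h x
  obtain ⟨-, hu', h1', h2', -⟩ := h (x - 1)
  have hr := rho_lt_top h0
  have e := moment_one_eq hu' hu h0 h1
  rw [rho_eq_odds] at e hr
  rw [passMean, passMean, e, rhoReal, ENNReal.toReal_add (by simp)
    (ENNReal.mul_lt_top hr (ENNReal.add_lt_top.2 ⟨by simp, h1'⟩)).ne,
    ENNReal.toReal_mul, ENNReal.toReal_add (by simp) h1'.ne]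
  simp only [ENNReal.toReal_one]
  ring

/-- Probabilistically, a crossing contains a geometric number of left excursions, with mean `ρ` and
variance `ρ + ρ²`, each lasting one step plus a crossing from `x - 1`; this is the variance formula
for such a random sum. The proof is algebra from the second-moment recursion. -/
lemma GoodEnv.passVar_eq {ω : Env} (h : GoodEnv ω) (x : ℤ) :
    passVar ω x = rhoReal (ω x) * passVar ω (x - 1)
      + (rhoReal (ω x) + rhoReal (ω x) ^ 2) * passMean ω (x - 1) ^ 2 := by
  obtain ⟨h0, hu, h1, h2, -⟩ := h x
  obtain ⟨-, hu', h1', h2', -⟩ := h (x - 1)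
  have hr := rho_lt_top h0
  have e1 := h.passMean_eq x
  have e2 := congrArg ENNReal.toReal (moment_two_eq hu' hu h0 h2)
  rw [rho_eq_odds] at e2 hr
  simp only [passVar, passMean, rhoReal] at e1 ⊢
  generalize moment 1 ω x = m at *
  generalize moment 1 ω (x - 1) = m' at *
  generalize moment 2 ω x = s at *
  generalize moment 2 ω (x - 1) = s' at *
  generalize odds (ω x) = r at *
  lift m to NNReal using h1.ne
  lift m' to NNReal using h1'.ne
  lift s to NNReal using h2.ne
  lift s' to NNReal using h2'.ne
  lift r to NNReal using hr.ne
  norm_cast at e2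
  simp only [ENNReal.coe_toReal] at *
  rw [e2]
  push_cast
  have e3 : (m : ℝ) = 1 + r * (1 + m') := by linarith
  rw [e3]
  ring

lemma moment_one_sq_le {ω : Env} {x : ℤ} (h : crossLaw ω x Set.univ = 1) :
    moment 1 ω x ^ 2 ≤ moment 2 ω x := by
  have : IsProbabilityMeasure (crossLaw ω x) := ⟨h⟩
  have h1 := eLpNorm'_le_eLpNorm'_of_exponent_le one_pos one_le_two (crossLaw ω x)
    (measurable_of_countable (fun k : ℕ => (k : ℝ≥0∞))).aestronglyMeasurable
  simp only [eLpNorm', enorm_eq_self, ENNReal.rpow_one, div_one, ENNReal.rpow_two] at h1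
  have h2 : moment 1 ω x ≤ moment 2 ω x ^ (1 / 2 : ℝ) := by simpa [moment] using h1
  calc moment 1 ω x ^ 2 ≤ (moment 2 ω x ^ (1 / 2 : ℝ)) ^ 2 := by gcongr
    _ = moment 2 ω x := by
      rw [← ENNReal.rpow_natCast, ← ENNReal.rpow_mul]; simp

lemma GoodEnv.passVar_nonneg {ω : Env} (h : GoodEnv ω) (x : ℤ) : 0 ≤ passVar ω x := by
  obtain ⟨-, hu, h1, h2, -⟩ := h x
  have := ENNReal.toReal_mono h2.ne (moment_one_sq_le hu)
  rw [ENNReal.toReal_pow] at this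
  exact sub_nonneg.2 this

lemma passVar_le (ω : Env) (x : ℤ) : passVar ω x ≤ (moment 2 ω x).toReal :=
  sub_le_self _ (sq_nonneg _)

lemma one_le_passMean (ω : Env) (x : ℤ) : 1 ≤ passMean ω x :=
  le_add_of_nonneg_right ENNReal.toReal_nonneg

lemma passMean_shift (ω : Env) (a x : ℤ) : passMean (shift a ω) x = passMean ω (x + a) := by
  simp only [passMean, moment_shift]

lemma passVar_shift (ω : Env) (a x : ℤ) : passVar (shift a ω) x = passVar ω (x + a) := by
  simp only [passVar, moment_shift]

lemma measurable_past_passMean (x : ℤ) : Measurable[past x] fun ω => passMean ω x :=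
  measurable_const.add (ENNReal.measurable_toReal.comp (measurable_past_moment 1 x))

lemma measurable_past_passVar (x : ℤ) : Measurable[past x] fun ω => passVar ω x :=
  (ENNReal.measurable_toReal.comp (measurable_past_moment 2 x)).sub
    ((ENNReal.measurable_toReal.comp (measurable_past_moment 1 x)).pow_const 2)

lemma measurable_rhoReal : Measurable rhoReal := ENNReal.measurable_toReal.comp measurable_odds

lemma rhoReal_nonneg (u : unitInterval) : 0 ≤ rhoReal u := ENNReal.toReal_nonneg

/-- The filtration generated by the environment to the left of a moving site. -/
def envFiltration : Filtration ℕ (inferInstance : MeasurableSpace Env) where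
  seq n := past n
  mono' _ _ h := past_mono (by exact_mod_cast h)
  le' n := past_le n

section

variable {P : Measure Env}

lemma ae_lt_top_of_rpow {f : Env → ℝ≥0∞} (hf : Measurable f) {q : ℝ} (hq : 0 < q)
    (h : ∫⁻ ω, f ω ^ q ∂P < ⊤) : ∀ᵐ ω ∂P, f ω < ⊤ := by
  filter_upwards [ae_lt_top (hf.pow_const q) h.ne] with ω hω
  exact (ENNReal.rpow_lt_top_iff_of_pos hq).1 hω

lemma integrable_toReal_rpow {f : Env → ℝ≥0∞} (hf : Measurable f) {q : ℝ}
    (h : ∫⁻ ω, f ω ^ q ∂P < ⊤) : Integrable (fun ω => |(f ω).toReal| ^ q) P := by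
  have e : ∀ ω, |(f ω).toReal| ^ q = (f ω ^ q).toReal := fun ω => by
    rw [abs_of_nonneg ENNReal.toReal_nonneg, ENNReal.toReal_rpow]
  simp only [e]
  exact integrable_toReal_of_lintegral_ne_top (hf.pow_const q).aemeasurable h.ne

lemma indepFun_past (hiid : IsIID P) (x : ℤ) {g : unitInterval → ℝ} (hg : Measurable g)
    {G : Env → ℝ} (hG : Measurable[past (x - 1)] G) : IndepFun (fun ω : Env => g (ω x)) G P := by
  refine (IndepFun_iff_Indep _ _ _).2 ?_
  refine indep_of_indep_of_le_left (indep_of_indep_of_le_right (indep_past hiid x) hG.comap_le) ?_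
  exact (hg.comp (comap_measurable (fun ω : Env => ω x))).comap_le

variable [IsProbabilityMeasure P]

lemma ae_goodEnv (hiid : IsIID P) {p : ℝ} (hp : 2 ≤ p) (h : ∫⁻ ω, rho ω 0 ^ p ∂P < 1) :
    ∀ᵐ ω ∂P, GoodEnv ω := by
  have hp1 : 1 ≤ p := by linarith
  have h1 := lintegral_rho_lt_one hp1 h
  have h0 : ∀ᵐ ω ∂P, moment 1 ω 0 < ⊤ ∧ moment 2 ω 0 < ⊤ ∧ moment 3 ω 0 < ⊤ := by
    filter_upwards [ae_moment_one_lt_top hiid h1,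
      ae_lt_top_of_rpow (measurable_moment 2 0) (by positivity)
        (lintegral_moment_two_rpow hiid hp1 h),
      ae_lt_top_of_rpow (measurable_moment 3 0) (by positivity)
        (lintegral_moment_three_rpow hiid hp h)] with ω a b c
    exact ⟨a, b, c⟩
  have h2 : ∀ᵐ ω ∂P, ∀ x : ℤ, moment 1 ω x < ⊤ ∧ moment 2 ω x < ⊤ ∧ moment 3 ω x < ⊤ := by
    refine ae_all_iff.2 fun x => ?_
    filter_upwards [ae_shift hiid x h0] with ω hω
    simpa only [moment_shift, zero_add] using hω
  filter_upwards [ae_right_ne_zero hiid h1, ae_crossLaw_univ hiid h1, h2] with ω a b c x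
  exact ⟨a x, b x, c x⟩

lemma integral_shift (hiid : IsIID P) (a : ℤ) {f : Env → ℝ} (hf : Measurable f) :
    ∫ ω, f (shift a ω) ∂P = ∫ ω, f ω ∂P := by
  have h := (measurePreserving_shift hiid a).map_eq
  conv_rhs => rw [← h]
  rw [integral_map (measurable_shift a).aemeasurable hf.aestronglyMeasurable]

lemma integrable_shift (hiid : IsIID P) (a : ℤ) {f : Env → ℝ} (hf : Integrable f P) :
    Integrable (fun ω => f (shift a ω)) P :=
  (measurePreserving_shift hiid a).integrable_comp_of_integrable hf

/-- A random field over the environment: covariant under shifts and adapted to the past. -/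
structure IsPastField (A : Env → ℤ → ℝ) : Prop where
  shift_apply : ∀ ω a x, A (shift a ω) x = A ω (x + a)
  measurable_past : ∀ x, Measurable[past x] fun ω => A ω x

lemma IsPastField.measurable {A : Env → ℤ → ℝ} (hA : IsPastField A) (x : ℤ) :
    Measurable fun ω => A ω x := (hA.measurable_past x).mono (past_le x) le_rfl

lemma isPastField_passMean : IsPastField passMean := ⟨passMean_shift, measurable_past_passMean⟩

lemma isPastField_passVar : IsPastField passVar := ⟨passVar_shift, measurable_past_passVar⟩

lemma IsPastField.pow {A : Env → ℤ → ℝ} (hA : IsPastField A) (n : ℕ) :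
    IsPastField fun ω x => A ω x ^ n :=
  ⟨fun ω a x => by rw [hA.shift_apply], fun x => (hA.measurable_past x).pow_const n⟩

lemma IsPastField.integral_eq {A : Env → ℤ → ℝ} (hA : IsPastField A) (hiid : IsIID P) (x : ℤ) :
    ∫ ω, A ω x ∂P = ∫ ω, A ω 0 ∂P := by
  rw [← integral_shift hiid x (hA.measurable 0)]
  simp only [hA.shift_apply, zero_add]

lemma IsPastField.integrable {A : Env → ℤ → ℝ} (hA : IsPastField A) (hiid : IsIID P)
    (h : Integrable (fun ω => A ω 0) P) (x : ℤ) : Integrable (fun ω => A ω x) P := by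
  have := integrable_shift hiid x h
  simpa only [hA.shift_apply, zero_add] using this

lemma IsPastField.integral_mul {A : Env → ℤ → ℝ} (hA : IsPastField A) (hiid : IsIID P)
    {g : unitInterval → ℝ} (hg : Measurable g) (hgi : Integrable (fun ω => g (ω 0)) P)
    (hAi : Integrable (fun ω => A ω 0) P) :
    Integrable (fun ω => g (ω 0) * A ω (0 - 1)) P ∧
      ∫ ω, g (ω 0) * A ω (0 - 1) ∂P = (∫ ω, g (ω 0) ∂P) * ∫ ω, A ω 0 ∂P := by
  have hi := indepFun_past hiid 0 hg (hA.measurable_past (0 - 1))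
  have hAi' := hA.integrable hiid hAi (0 - 1)
  refine ⟨hi.integrable_mul hgi hAi', ?_⟩
  rw [hi.integral_fun_mul_eq_mul_integral hgi.1 hAi'.1, hA.integral_eq hiid]

/-- The site `k + 1` is independent of everything up to `k`, so the summands are a martingale
transform; stationarity makes the moment bound uniform in `k`. -/
lemma IsPastField.ae_sumGrowth {A : Env → ℤ → ℝ} (hA : IsPastField A) (hiid : IsIID P)
    {s b : ℝ} (hs1 : 1 < s) (hs2 : s ≤ 2) (hb : 1 / s < b)
    {g : unitInterval → ℝ} (hg : Measurable g) (hgs : Integrable (fun ω => |g (ω 0)| ^ s) P)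
    (hAs : Integrable (fun ω => |A ω 0| ^ s) P) :
    ∀ᵐ ω ∂P, SumGrowth b fun k => (g (ω (k + 1)) - ∫ ω, g (ω 0) ∂P) * A ω k := by
  have hs0 : 0 < s := by linarith
  have hg0 : Measurable fun ω : Env => g (ω 0) := hg.comp (measurable_pi_apply 0)
  set c := ∫ ω, g (ω 0) ∂P with hc
  have hgi : Integrable (fun ω => g (ω 0)) P :=
    integrable_of_abs_rpow hs1.le hg0.aestronglyMeasurable hgs
  have hcs : Integrable (fun ω => |g (ω 0) - c| ^ s) P := by
    have hs' : ENNReal.ofReal s ≠ 0 := by simpa using hs0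
    have hm : MemLp (fun ω => g (ω 0)) (ENNReal.ofReal s) P := by
      rw [← integrable_norm_rpow_iff hg0.aestronglyMeasurable hs' ENNReal.ofReal_ne_top,
        ENNReal.toReal_ofReal hs0.le]
      exact hgs
    have := (hm.sub (memLp_const c)).integrable_norm_rpow hs' ENNReal.ofReal_ne_top
    rwa [ENNReal.toReal_ofReal hs0.le] at this
  have hξs : ∀ n : ℕ, Integrable (fun ω => |g (ω ((n : ℤ) + 1)) - c| ^ s) P ∧
      ∫ ω, |g (ω ((n : ℤ) + 1)) - c| ^ s ∂P = ∫ ω, |g (ω 0) - c| ^ s ∂P := fun n => by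
    have h1 := integrable_shift hiid ((n : ℤ) + 1) hcs
    have h2 := integral_shift hiid ((n : ℤ) + 1) (f := fun ω => |g (ω 0) - c| ^ s)
      ((measurable_norm.comp (hg0.sub measurable_const)).pow_const s)
    simp only [shift, zero_add] at h1 h2
    exact ⟨h1, h2⟩
  have hAn : ∀ n : ℕ, Integrable (fun ω => |A ω n| ^ s) P ∧
      ∫ ω, |A ω n| ^ s ∂P = ∫ ω, |A ω 0| ^ s ∂P := fun n => by
    have h1 := integrable_shift hiid n hAs
    have h2 := integral_shift hiid n (f := fun ω => |A ω 0| ^ s)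
      ((measurable_norm.comp (hA.measurable 0)).pow_const s)
    simp only [hA.shift_apply, zero_add] at h1 h2
    exact ⟨h1, h2⟩
  refine ae_sumGrowth_martingale (F := envFiltration)
    (ξ := fun n ω => g (ω ((n : ℤ) + 1)) - c) (A := fun n ω => A ω n) hs1 hs2 hb
    (fun n => ?_) (fun n => hA.measurable_past n) (fun n => ?_) (fun n => ?_)
    (fun n => (hξs n).1) (fun n => (hAn n).1) (K := (∫ ω, |g (ω 0) - c| ^ s ∂P) * ∫ ω, |A ω 0| ^ s ∂P)
    (fun n => ?_)
  · have : Measurable[past ((n + 1 : ℕ) : ℤ)] fun ω : Env => g (ω ((n : ℤ) + 1)) :=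
      hg.comp (measurable_past_apply (by push_cast; exact le_rfl))
    exact this.sub measurable_const
  · have h := indep_past hiid ((n : ℤ) + 1)
    rw [add_sub_cancel_right] at h
    refine indep_of_indep_of_le_left h ?_
    exact ((hg.sub measurable_const).comp
      (comap_measurable (fun ω : Env => ω ((n : ℤ) + 1)))).comap_le
  · have h2 := integral_shift hiid ((n : ℤ) + 1) (f := fun ω => g (ω 0) - c) (hg0.sub measurable_const)
    simp only [shift, zero_add] at h2
    rw [h2, integral_sub hgi (integrable_const c)]
    simp [hc]
  · rw [(hξs n).2, (hAn n).2]

end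

/-! ### Almost sure growth of quenched variances and third moments. -/

section

variable {P : Measure Env}

lemma integrable_rhoReal_rpow {p : ℝ} (h : ∫⁻ ω, rho ω 0 ^ p ∂P < 1) :
    Integrable (fun ω => |rhoReal (ω 0)| ^ p) P :=
  integrable_toReal_rpow (measurable_rho 0) (h.trans ENNReal.one_lt_top)

variable [IsProbabilityMeasure P]

lemma integral_rhoReal_pow_lt_one {p : ℝ} (n : ℕ) (hn : 0 < n) (hp : (n : ℝ) ≤ p)
    (h : ∫⁻ ω, rho ω 0 ^ p ∂P < 1) :
    ∫ ω, rhoReal (ω 0) ^ n ∂P < 1 := by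
  have h1 := lintegral_rho_rpow_le (by positivity) hp h
  simp only [ENNReal.rpow_natCast] at h1
  have e : ∀ ω : Env, rhoReal (ω 0) ^ n = (rho ω 0 ^ n).toReal := fun ω => by
    rw [ENNReal.toReal_pow, rho_eq_odds, rhoReal]
  simp only [e]
  rw [integral_toReal ((measurable_rho 0).pow_const n).aemeasurable]
  · exact (ENNReal.toReal_lt_toReal (h1.trans ENNReal.one_lt_top).ne ENNReal.one_ne_top).2 h1
  · exact ae_lt_top ((measurable_rho 0).pow_const n) (h1.trans ENNReal.one_lt_top).ne

lemma integrable_passMean_rpow (hiid : IsIID P) {p : ℝ} (hp : 1 ≤ p)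
    (h : ∫⁻ ω, rho ω 0 ^ p ∂P < 1) : Integrable (fun ω => |passMean ω 0| ^ p) P := by
  have hp0 : 0 < p := by linarith
  have h1 : ∫⁻ ω, (1 + moment 1 ω 0) ^ p ∂P < ⊤ :=
    lintegral_add_rpow_lt_top measurable_const hp0 (by simp) (lintegral_moment_one_rpow hiid hp h)
  refine (integrable_toReal_rpow (measurable_const.add (measurable_moment 1 0)) h1).congr ?_
  filter_upwards [ae_moment_one_lt_top hiid (lintegral_rho_lt_one hp h)] with ω hω
  rw [Pi.add_apply, ENNReal.toReal_add (by simp) hω.ne, passMean, ENNReal.toReal_one]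

lemma integrable_passVar_rpow (hiid : IsIID P) {p : ℝ} (hp : 2 ≤ p)
    (h : ∫⁻ ω, rho ω 0 ^ p ∂P < 1) : Integrable (fun ω => |passVar ω 0| ^ (p / 2)) P := by
  have h1 := integrable_toReal_rpow (measurable_moment 2 0)
    (lintegral_moment_two_rpow hiid (by linarith) h)
  refine h1.mono' ((measurable_norm.comp
    (isPastField_passVar.measurable 0)).pow_const (p / 2)).aestronglyMeasurable ?_
  filter_upwards [ae_goodEnv hiid hp h] with ω hω
  rw [Real.norm_eq_abs, abs_of_nonneg (by positivity)]
  refine Real.rpow_le_rpow (abs_nonneg _) ?_ (by linarith)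
  rw [abs_of_nonneg (hω.passVar_nonneg 0), abs_of_nonneg ENNReal.toReal_nonneg]
  exact passVar_le ω 0

lemma abs_sq_rpow_half (x p : ℝ) : |x ^ 2| ^ (p / 2) = |x| ^ p := by
  rw [abs_pow, ← Real.rpow_natCast, ← Real.rpow_mul (abs_nonneg x)]
  congr 1
  push_cast
  ring

/-- Almost sure rate in the law of large numbers for the quenched variances. -/
theorem ae_sumGrowth_passVar (hiid : IsIID P) {p b : ℝ} (hp2 : 2 < p) (hp4 : p ≤ 4)
    (hb : 2 / p < b) (h : ∫⁻ ω, rho ω 0 ^ p ∂P < 1) :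
    Integrable (fun ω => passVar ω 0) P ∧
      ∀ᵐ ω ∂P, SumGrowth b fun k => passVar ω k - ∫ ω, passVar ω 0 ∂P := by
  have hp0 : 0 < p := by linarith
  have hs1 : 1 < p / 2 := by linarith
  have hs2 : p / 2 ≤ 2 := by linarith
  have hsb : 1 / (p / 2) < b := by rwa [one_div_div]
  have hb0 : 0 ≤ b := le_trans (by positivity) hb.le
  have hrs : Integrable (fun ω => |rhoReal (ω 0)| ^ (p / 2)) P :=
    integrable_rhoReal_rpow (lintegral_rho_rpow_le (by positivity) (by linarith) h)
  have hr2s : Integrable (fun ω => |rhoReal (ω 0) ^ 2| ^ (p / 2)) P := by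
    simp only [abs_sq_rpow_half]; exact integrable_rhoReal_rpow h
  have has : Integrable (fun ω => |passMean ω 0| ^ (p / 2)) P :=
    integrable_passMean_rpow hiid (by linarith)
      (lintegral_rho_rpow_le (by positivity) (by linarith) h)
  have ha2s : Integrable (fun ω => |passMean ω 0 ^ 2| ^ (p / 2)) P := by
    simp only [abs_sq_rpow_half]; exact integrable_passMean_rpow hiid (by linarith) h
  have hvs := integrable_passVar_rpow hiid hp2.le h
  have hA := isPastField_passMean
  have hA2 := hA.pow 2
  have hV := isPastField_passVar
  have hg := measurable_rhoReal
  have hg2 : Measurable fun u => rhoReal u ^ 2 := hg.pow_const 2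
  have hev : Measurable fun ω : Env => ω 0 := measurable_pi_apply 0
  have hri := integrable_of_abs_rpow hs1.le (hg.comp hev).aestronglyMeasurable hrs
  have hr2i := integrable_of_abs_rpow hs1.le (hg2.comp hev).aestronglyMeasurable hr2s
  have hai := integrable_of_abs_rpow hs1.le (hA.measurable 0).aestronglyMeasurable has
  have ha2i := integrable_of_abs_rpow hs1.le (hA2.measurable 0).aestronglyMeasurable ha2s
  have hvi := integrable_of_abs_rpow hs1.le (hV.measurable 0).aestronglyMeasurable hvs
  have hgood := ae_goodEnv hiid hp2.le h
  have ra := hA.integral_mul hiid hg hri hai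
  have ra2 := hA2.integral_mul hiid hg hri ha2i
  have r2a2 := hA2.integral_mul hiid hg2 hr2i ha2i
  have rv := hV.integral_mul hiid hg hri hvi
  have grow1 := hA.ae_sumGrowth hiid hs1 hs2 hsb hg hrs has
  have grow2 := hA2.ae_sumGrowth hiid hs1 hs2 hsb hg hrs ha2s
  have grow3 := hA2.ae_sumGrowth hiid hs1 hs2 hsb hg2 hr2s ha2s
  have grow4 := hV.ae_sumGrowth hiid hs1 hs2 hsb hg hrs hvs
  have hμ1 : ∫ ω, rhoReal (ω 0) ∂P < 1 := by
    simpa using integral_rhoReal_pow_lt_one 1 one_pos (by push_cast; linarith) h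
  have hν1 : ∫ ω, rhoReal (ω 0) ^ 2 ∂P < 1 :=
    integral_rhoReal_pow_lt_one 2 two_pos (by push_cast; linarith) h
  have hμ0 : 0 ≤ ∫ ω, rhoReal (ω 0) ∂P := integral_nonneg fun ω => rhoReal_nonneg _
  have hν0 : 0 ≤ ∫ ω, rhoReal (ω 0) ^ 2 ∂P := integral_nonneg fun ω => sq_nonneg _
  set μ := ∫ ω, rhoReal (ω 0) ∂P
  set ν := ∫ ω, rhoReal (ω 0) ^ 2 ∂P
  set a := ∫ ω, passMean ω 0 ∂P with ha
  set α := ∫ ω, passMean ω 0 ^ 2 ∂P with hα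
  set σ := ∫ ω, passVar ω 0 ∂P with hσ
  -- `a`, `α`, `σ` are the stationary means of `passMean`, its square, and `passVar` (so `σ` is a
  -- variance here). Taking expectations in the recursions yields the equations that are subtracted
  -- pathwise below.
  have ea : a = 2 + μ * a := by
    conv_lhs => rw [ha]
    rw [← ra.2]
    calc ∫ ω, passMean ω 0 ∂P = ∫ ω, (2 + rhoReal (ω 0) * passMean ω (0 - 1)) ∂P :=
          integral_congr_ae (by filter_upwards [hgood] with ω hω using hω.passMean_eq 0)
      _ = _ := by rw [integral_add (integrable_const _) ra.1]; simp
  have eα : α = 4 + 4 * (μ * a) + ν * α := by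
    conv_lhs => rw [hα]
    rw [← ra.2, ← r2a2.2]
    calc ∫ ω, passMean ω 0 ^ 2 ∂P = ∫ ω, (4 + 4 * (rhoReal (ω 0) * passMean ω (0 - 1))
            + rhoReal (ω 0) ^ 2 * passMean ω (0 - 1) ^ 2) ∂P := by
          refine integral_congr_ae ?_
          filter_upwards [hgood] with ω hω
          rw [hω.passMean_eq 0]; ring
      _ = _ := by
          rw [integral_add (f := fun ω => 4 + 4 * (rhoReal (ω 0) * passMean ω (0 - 1)))
            ((integrable_const _).add (ra.1.const_mul _)) r2a2.1,
            integral_add (integrable_const _) (ra.1.const_mul _), integral_const_mul]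
          simp
  have eσ : σ = μ * σ + (μ * α + ν * α) := by
    conv_lhs => rw [hσ]
    rw [← rv.2, ← r2a2.2, ← ra2.2]
    calc ∫ ω, passVar ω 0 ∂P = ∫ ω, (rhoReal (ω 0) * passVar ω (0 - 1)
            + (rhoReal (ω 0) * passMean ω (0 - 1) ^ 2
            + rhoReal (ω 0) ^ 2 * passMean ω (0 - 1) ^ 2)) ∂P := by
          refine integral_congr_ae ?_
          filter_upwards [hgood] with ω hω
          rw [hω.passVar_eq 0]; ring
      _ = _ := by
          rw [integral_add (g := fun ω => rhoReal (ω 0) * passMean ω (0 - 1) ^ 2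
            + rhoReal (ω 0) ^ 2 * passMean ω (0 - 1) ^ 2) rv.1 (ra2.1.add r2a2.1),
            integral_add ra2.1 r2a2.1]
  refine ⟨hvi, ?_⟩
  filter_upwards [hgood, grow1, grow2, grow3, grow4] with ω hω g1 g2 g3 g4
  have rec1 : ∀ k : ℕ, passMean ω ((k + 1 : ℕ) : ℤ)
      = 2 + rhoReal (ω ((k : ℤ) + 1)) * passMean ω k := fun k => by
    have := hω.passMean_eq ((k : ℤ) + 1)
    rwa [add_sub_cancel_right] at this
  have rec2 : ∀ k : ℕ, passVar ω ((k + 1 : ℕ) : ℤ) = rhoReal (ω ((k : ℤ) + 1)) * passVar ω k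
      + (rhoReal (ω ((k : ℤ) + 1)) + rhoReal (ω ((k : ℤ) + 1)) ^ 2) * passMean ω k ^ 2 :=
    fun k => by
      have := hω.passVar_eq ((k : ℤ) + 1)
      rwa [add_sub_cancel_right] at this
  -- After centring, the recursion contracts by `μ` and is driven by `(ρ_{k+1} - μ) passMean ω k`.
  -- The square then contracts by `ν`, with `G1` entering as a forcing term, and the variance again
  -- by `μ`, with the centred square as forcing.
  have G1 : SumGrowth b fun k => passMean ω k - a := by
    refine SumGrowth.of_recursion hb0 hμ0 hμ1 (fun k => ?_) g1
    rw [rec1]; linear_combination -ea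
  have G2 : SumGrowth b fun k => passMean ω k ^ 2 - α := by
    refine SumGrowth.of_recursion hb0 hν0 hν1 (fun k => ?_)
      (((G1.const_mul (4 * μ)).add (g1.const_mul 4)).add g3)
    rw [rec1]; linear_combination -eα
  refine SumGrowth.of_recursion hb0 hμ0 hμ1 (fun k => ?_)
    ((((G2.const_mul (μ + ν)).add g2).add g3).add g4)
  rw [rec2]; linear_combination -eσ

/-- Vanishing mean variance forces the term `(ρ_0 + ρ_0²) passMean²` to vanish almost surely; as
`passMean ≥ 1`, this gives `ρ_0 = 0`, that is `ω 0 = 1`. -/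
lemma integral_passVar_pos (hiid : IsIID P) (hnondeg : ¬ ∀ᵐ ω ∂P, ω 0 = 1)
    {p : ℝ} (hp : 2 ≤ p) (h : ∫⁻ ω, rho ω 0 ^ p ∂P < 1)
    (hi : Integrable (fun ω => passVar ω 0) P) : 0 < ∫ ω, passVar ω 0 ∂P := by
  have hgood := ae_goodEnv hiid hp h
  have h0 : 0 ≤ᵐ[P] fun ω => passVar ω 0 := by
    filter_upwards [hgood] with ω hω using hω.passVar_nonneg 0
  refine lt_of_le_of_ne (integral_nonneg_of_ae h0) fun he => hnondeg ?_
  filter_upwards [(integral_eq_zero_iff_of_nonneg_ae h0 hi).1 he.symm, hgood] with ω hz hω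
  have e := hω.passVar_eq 0
  have hr := rhoReal_nonneg (ω 0)
  have hv := hω.passVar_nonneg (0 - 1)
  have hm := one_le_passMean ω (0 - 1)
  have hz' : passVar ω 0 = 0 := hz
  have hr0 : rhoReal (ω 0) = 0 := by
    by_contra hne
    have hpos : 0 < rhoReal (ω 0) := lt_of_le_of_ne hr (Ne.symm hne)
    have : 0 < passVar ω 0 := by rw [e]; positivity
    exact this.ne' hz'
  have hlt := rho_lt_top (hω 0).1
  rw [rhoReal, ENNReal.toReal_eq_zero_iff] at hr0
  rcases hr0 with hr0 | hr0
  · rw [odds, ENNReal.div_eq_zero_iff] at hr0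
    have : 1 - (ω 0 : ℝ) ≤ 0 := by simpa using hr0
    exact Subtype.ext (le_antisymm (ω 0).2.2 (by simpa using this))
  · exact absurd hr0 hlt.ne

lemma sum_rpow_le {r : ℝ} (h0 : 0 < r) (h1 : r ≤ 1) (f : ℕ → ℝ≥0∞) (n : ℕ) :
    (∑ k ∈ Finset.range n, f k) ^ r ≤ ∑ k ∈ Finset.range n, f k ^ r := by
  induction n with
  | zero => simp [h0]
  | succ n ih =>
    rw [Finset.sum_range_succ, Finset.sum_range_succ]
    exact (ENNReal.rpow_add_le_add_rpow _ _ h0.le h1).trans (by gcongr)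

/-- Almost sure growth of the sums of the quenched third moments. -/
theorem ae_sum_moment_three_le (hiid : IsIID P) {q η : ℝ} (hq2 : 2 ≤ q) (hq3 : q ≤ 3)
    (hη : 0 < η) (h : ∫⁻ ω, rho ω 0 ^ q ∂P < 1) :
    ∀ᵐ ω ∂P, ∃ C : ℝ, 0 ≤ C ∧ ∀ n : ℕ, ∑ k ∈ Finset.range n, (moment 3 ω k).toReal
      ≤ C * ((n : ℝ) + 1) ^ (3 * (1 + η) / q) := by
  have hq0 : 0 < q := by linarith
  set r := q / 3 with hr
  have hr0 : 0 < r := by positivity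
  have hr1 : r ≤ 1 := by rw [hr]; linarith
  have hM := lintegral_moment_three_rpow hiid hq2 h
  -- The third moments may fail to be integrable, so their powers `r = q / 3 ≤ 1` are summed against
  -- a summable weight. Subadditivity of `x ↦ x^r` then bounds the `r`-th power of the plain sum.
  set w : ℕ → ℝ≥0∞ := fun k => ENNReal.ofReal (((k : ℝ) + 1) ^ (-(1 + η))) with hw
  have hws : ∑' k, w k < ⊤ := by
    have h1 : Summable fun k : ℕ => ((k : ℝ) + 1) ^ (-(1 + η)) := by
      have h2 : Summable fun k : ℕ => ((k : ℝ)) ^ (-(1 + η)) :=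
        Real.summable_nat_rpow.2 (by linarith)
      simpa using (summable_nat_add_iff 1).2 h2
    rw [hw, ← ENNReal.ofReal_tsum_of_nonneg (fun k => by positivity) h1]
    exact ENNReal.ofReal_lt_top
  have hmk : ∀ k : ℕ, ∫⁻ ω, moment 3 ω k ^ r ∂P = ∫⁻ ω, moment 3 ω 0 ^ r ∂P := fun k => by
    rw [← lintegral_shift hiid k ((measurable_moment 3 0).pow_const r)]
    simp only [moment_shift, zero_add]
  have hS : ∫⁻ ω, ∑' k : ℕ, w k * moment 3 ω k ^ r ∂P < ⊤ := by
    rw [lintegral_tsum fun k : ℕ => (((measurable_moment 3 k).pow_const r).const_mul _).aemeasurable]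
    simp only [lintegral_const_mul _ ((measurable_moment 3 _).pow_const r), hmk]
    rw [ENNReal.tsum_mul_right]
    exact ENNReal.mul_lt_top hws hM
  filter_upwards [ae_lt_top (Measurable.tsum fun k : ℕ =>
    ((measurable_moment 3 k).pow_const r).const_mul (w k)) hS.ne,
    ae_goodEnv hiid hq2 h] with ω hω hgood
  set S := ∑' k : ℕ, w k * moment 3 ω k ^ r with hSdef
  refine ⟨(S ^ (1 / r)).toReal, ENNReal.toReal_nonneg, fun n => ?_⟩
  have hSt : S ^ (1 / r) < ⊤ := ENNReal.rpow_lt_top_of_nonneg (by positivity) hω.ne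
  have hN : 0 < (n : ℝ) + 1 := by positivity
  have key : ∑ k ∈ Finset.range n, moment 3 ω k
      ≤ S ^ (1 / r) * ENNReal.ofReal (((n : ℝ) + 1) ^ (3 * (1 + η) / q)) := by
    have h1 : (∑ k ∈ Finset.range n, moment 3 ω k) ^ r
        ≤ S * ENNReal.ofReal (((n : ℝ) + 1) ^ (1 + η)) := by
      refine (sum_rpow_le hr0 hr1 _ n).trans ?_
      calc ∑ k ∈ Finset.range n, moment 3 ω k ^ r
          ≤ ∑ k ∈ Finset.range n, w k * moment 3 ω k ^ r
              * ENNReal.ofReal (((n : ℝ) + 1) ^ (1 + η)) := by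
            refine Finset.sum_le_sum fun k hk => ?_
            have hk' : (k : ℝ) ≤ n := by exact_mod_cast (Finset.mem_range.1 hk).le
            rw [mul_right_comm]
            refine le_mul_of_one_le_left zero_le ?_
            rw [hw, ← ENNReal.ofReal_mul (by positivity), ENNReal.one_le_ofReal,
              Real.rpow_neg (by positivity), inv_mul_eq_div, one_le_div (by positivity)]
            gcongr
        _ = (∑ k ∈ Finset.range n, w k * moment 3 ω k ^ r)
              * ENNReal.ofReal (((n : ℝ) + 1) ^ (1 + η)) := by rw [Finset.sum_mul]
        _ ≤ _ := by gcongr; exact ENNReal.sum_le_tsum _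
    have h2 := ENNReal.rpow_le_rpow h1 (by positivity : 0 ≤ 1 / r)
    rw [← ENNReal.rpow_mul, mul_one_div_cancel hr0.ne', ENNReal.rpow_one,
      ENNReal.mul_rpow_of_nonneg _ _ (by positivity),
      ENNReal.ofReal_rpow_of_pos (by positivity), ← Real.rpow_mul hN.le] at h2
    refine h2.trans_eq ?_
    rw [hr]
    congr 3
    field_simp
  have h3 := ENNReal.toReal_mono (ENNReal.mul_lt_top hSt ENNReal.ofReal_lt_top).ne key
  rw [ENNReal.toReal_mul, ENNReal.toReal_ofReal (by positivity),
    ENNReal.toReal_sum fun (k : ℕ) _ => (hgood k).2.2.2.2.ne] at h3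
  exact h3

end

/-! ### Smoothing with a normal law and Fourier representation. -/

section GaussianSmoothing

/-- The standard normal law. -/
abbrev stdNormal : Measure ℝ := gaussianReal 0 1

lemma charFun_stdNormal (t : ℝ) : charFun stdNormal t = (Real.exp (-(t ^ 2 / 2)) : ℝ) := by
  rw [charFun_gaussianReal]
  push_cast
  congr 1
  simp

lemma gaussianPDFReal_std (x : ℝ) :
    gaussianPDFReal 0 1 x = (√(2 * Real.pi))⁻¹ * Real.exp (-(x ^ 2 / 2)) := by
  rw [gaussianPDFReal_def]
  simp [neg_div]

lemma inv_sqrt_two_pi_le_one : (√(2 * Real.pi))⁻¹ ≤ 1 := by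
  refine inv_le_one_of_one_le₀ ?_
  rw [Real.one_le_sqrt]
  linarith [Real.pi_gt_three]

lemma gaussianPDFReal_std_le_one (x : ℝ) : gaussianPDFReal 0 1 x ≤ 1 := by
  rw [gaussianPDFReal_std]
  refine mul_le_one₀ inv_sqrt_two_pi_le_one (Real.exp_pos _).le ?_
  rw [Real.exp_le_one_iff]
  have := sq_nonneg x
  linarith

lemma cdf_sub_cdf_stdNormal {u v : ℝ} (h : u ≤ v) :
    cdf stdNormal v - cdf stdNormal u = ∫ x in u..v, gaussianPDFReal 0 1 x := by
  have hs : Set.Iic v \ Set.Iic u = Set.Ioc u v := by ext; simp [and_comm]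
  rw [intervalIntegral.integral_of_le h, cdf_eq_real, cdf_eq_real,
    ← measureReal_sdiff (Set.Iic_subset_Iic.2 h) measurableSet_Iic, hs,
    measureReal_def, gaussianReal_apply_eq_integral _ one_ne_zero,
    ENNReal.toReal_ofReal (integral_nonneg fun x => gaussianPDFReal_nonneg _ _ _)]

lemma cdf_stdNormal_sub_le {u v : ℝ} (h : u ≤ v) :
    cdf stdNormal v - cdf stdNormal u ≤ v - u := by
  rw [cdf_sub_cdf_stdNormal h]
  calc ∫ x in u..v, gaussianPDFReal 0 1 x ≤ ∫ _ in u..v, (1 : ℝ) :=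
        intervalIntegral.integral_mono_on h (integrable_gaussianPDFReal 0 1).intervalIntegrable
          intervalIntegrable_const fun x _ => gaussianPDFReal_std_le_one x
    _ = v - u := by simp

lemma hasDerivAt_cdf_stdNormal (u : ℝ) :
    HasDerivAt (cdf stdNormal) ((√(2 * Real.pi))⁻¹ * Real.exp (-(u ^ 2 / 2))) u := by
  have hc : Continuous (gaussianPDFReal 0 1) := by
    have : gaussianPDFReal 0 1 = fun x => (√(2 * Real.pi))⁻¹ * Real.exp (-(x ^ 2 / 2)) :=
      funext gaussianPDFReal_std
    rw [this]; fun_prop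
  have h1 : ∀ x, cdf stdNormal x = cdf stdNormal 0 + ∫ y in (0 : ℝ)..x, gaussianPDFReal 0 1 y := by
    intro x
    rcases le_total 0 x with h | h
    · rw [← cdf_sub_cdf_stdNormal h]; ring
    · rw [intervalIntegral.integral_symm, ← cdf_sub_cdf_stdNormal h]; ring
  have h2 : HasDerivAt (fun x => cdf stdNormal 0 + ∫ y in (0 : ℝ)..x, gaussianPDFReal 0 1 y)
      (gaussianPDFReal 0 1 u) u :=
    (intervalIntegral.integral_hasDerivAt_right (hc.intervalIntegrable _ _)
      (hc.stronglyMeasurableAtFilter _ _) hc.continuousAt).const_add _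
  rw [← gaussianPDFReal_std]
  exact h2.congr_of_eventuallyEq (Eventually.of_forall h1)

/-- The function `u ↦ sin (t u) / t`, with its continuous extension to `t = 0`. -/
def sinQuot (t u : ℝ) : ℝ := u * Real.sinc (t * u)

lemma mul_sinQuot (t u : ℝ) : t * sinQuot t u = Real.sin (t * u) := by
  rw [sinQuot, ← mul_assoc]
  by_cases h : t * u = 0
  · simp [h]
  · rw [Real.sinc_of_ne_zero h, mul_div_cancel₀ _ h]

lemma sinQuot_of_ne_zero {t : ℝ} (ht : t ≠ 0) (u : ℝ) : sinQuot t u = Real.sin (t * u) / t := by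
  rw [← mul_sinQuot]; field_simp

lemma abs_sinQuot_le (t u : ℝ) : |sinQuot t u| ≤ |u| := by
  rw [sinQuot, abs_mul]
  exact mul_le_of_le_one_right (abs_nonneg _) (Real.abs_sinc_le_one _)

lemma continuous_sinQuot : Continuous fun p : ℝ × ℝ => sinQuot p.1 p.2 :=
  continuous_snd.mul (Real.continuous_sinc.comp (continuous_fst.mul continuous_snd))

lemma hasDerivAt_sinQuot (t u : ℝ) : HasDerivAt (sinQuot t) (Real.cos (t * u)) u := by
  rcases eq_or_ne t 0 with rfl | ht
  · have : sinQuot 0 = fun u => u := by ext u; simp [sinQuot]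
    rw [this]; simpa using hasDerivAt_id' u
  · have : sinQuot t = fun u => Real.sin (t * u) / t := funext (sinQuot_of_ne_zero ht)
    rw [this]
    have h := ((Real.hasDerivAt_sin (t * u)).comp u ((hasDerivAt_id u).const_mul t)).div_const t
    simpa [ht] using h

lemma integral_cos_stdNormal (u : ℝ) :
    ∫ t, Real.cos (t * u) ∂stdNormal = Real.exp (-(u ^ 2 / 2)) := by
  have h := congrArg Complex.re (charFun_stdNormal u)
  rw [Complex.ofReal_re, charFun_apply_real] at h
  rw [← h]
  have hi : Integrable (fun x : ℝ => Complex.exp (u * x * Complex.I)) stdNormal := by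
    refine Integrable.mono' (integrable_const (1 : ℝ)) (by fun_prop) (ae_of_all _ fun x => ?_)
    rw [← Complex.ofReal_mul, Complex.norm_exp_ofReal_mul_I]
  have h2 := integral_re hi
  simp only [RCLike.re_to_complex] at h2
  rw [← h2]
  refine integral_congr_ae (ae_of_all _ fun x => ?_)
  simp only
  rw [← Complex.ofReal_mul, Complex.exp_ofReal_mul_I_re, mul_comm]

/-- Fourier inversion from the self-duality of the normal law: the derivative of the integral is `∫
cos (t u)`, which is the normal density at `u` up to `√(2π)`. Both sides have the same derivative
and agree at `0`. -/
lemma cdf_stdNormal_eq (u : ℝ) : cdf stdNormal u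
    = cdf stdNormal 0 + (√(2 * Real.pi))⁻¹ * ∫ t, sinQuot t u ∂stdNormal := by
  have hder : ∀ u, HasDerivAt (fun u => ∫ t, sinQuot t u ∂stdNormal)
      (Real.exp (-(u ^ 2 / 2))) u := by
    intro u
    rw [← integral_cos_stdNormal]
    refine (hasDerivAt_integral_of_dominated_loc_of_deriv_le (μ := stdNormal)
      (F := fun u t => sinQuot t u) (F' := fun u t => Real.cos (t * u)) (s := Set.univ)
      (bound := fun _ => 1)
      Filter.univ_mem ?_ ?_ ?_ ?_ (integrable_const _) ?_).2
    · exact Eventually.of_forall fun x => (continuous_sinQuot.comp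
        (continuous_id.prodMk continuous_const)).aestronglyMeasurable
    · refine Integrable.mono' (integrable_const |u|) (continuous_sinQuot.comp
        (continuous_id.prodMk continuous_const)).aestronglyMeasurable
        (ae_of_all _ fun t => abs_sinQuot_le t u)
    · fun_prop
    · exact ae_of_all _ fun t x _ => Real.abs_cos_le_one _
    · exact ae_of_all _ fun t x _ => hasDerivAt_sinQuot t x
  have hd : ∀ x, HasDerivAt (fun u => cdf stdNormal u
      - (√(2 * Real.pi))⁻¹ * ∫ t, sinQuot t u ∂stdNormal) 0 x := by
    intro x
    exact ((hasDerivAt_cdf_stdNormal x).fun_sub ((hder x).const_mul _)).congr_deriv (sub_self _)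
  have hconst := is_const_of_deriv_eq_zero (fun x => (hd x).differentiableAt)
    (fun x => (hd x).deriv) u 0
  simp only [sinQuot, zero_mul, integral_zero, mul_zero, sub_zero] at hconst
  simp only [sinQuot]
  linarith

section Smoothing

variable (μ : Measure ℝ) [IsProbabilityMeasure μ]

/-- The distribution function of `μ` smoothed by a normal law of standard deviation `1 / T`. -/
def smoothCDF (T x : ℝ) : ℝ := ∫ s, cdf stdNormal (T * (x - s)) ∂μ

lemma integrable_smoothCDF (T x : ℝ) : Integrable (fun s => cdf stdNormal (T * (x - s))) μ := by
  refine Integrable.mono' (integrable_const (1 : ℝ)) ?_ (ae_of_all _ fun s => ?_)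
  · have h : Measurable (cdf stdNormal : ℝ → ℝ) := (monotone_cdf stdNormal).measurable
    exact (h.comp (by fun_prop : Measurable fun s => T * (x - s))).aestronglyMeasurable
  · rw [Real.norm_eq_abs, abs_of_nonneg (cdf_nonneg _ _)]
    exact cdf_le_one _ _

lemma integral_indicator_Iic (x : ℝ) : ∫ s, (Set.Iic x).indicator (fun _ => (1 : ℝ)) s ∂μ = cdf μ x := by
  rw [integral_indicator_const _ measurableSet_Iic, cdf_eq_real]
  simp

/-- Smoothing moves mass by more than `a / T` to the left with probability at most `τ`;
`le_smoothCDF` is the mirror image. -/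
lemma smoothCDF_le {T a τ : ℝ} (hT : 0 < T) (hτ : cdf stdNormal (-a) ≤ τ) (x : ℝ) :
    smoothCDF μ T x ≤ cdf μ (x + a / T) + τ := by
  have hτ0 : 0 ≤ τ := (cdf_nonneg _ _).trans hτ
  have hi : Integrable ((Set.Iic (x + a / T)).indicator fun _ => (1 : ℝ)) μ :=
    (integrable_const _).indicator measurableSet_Iic
  calc smoothCDF μ T x
      ≤ ∫ s, ((Set.Iic (x + a / T)).indicator (fun _ => (1 : ℝ)) s + τ) ∂μ := by
        refine integral_mono (integrable_smoothCDF μ T x) (hi.add (integrable_const _)) fun s => ?_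
        by_cases h : s ≤ x + a / T
        · simp only [Set.indicator, Set.mem_Iic, h, if_true]
          linarith [cdf_le_one stdNormal (T * (x - s))]
        · simp only [Set.indicator, Set.mem_Iic, h, if_false, zero_add]
          refine le_trans (monotone_cdf _ ?_) hτ
          have : a / T < s - x := by linarith [not_le.1 h]
          rw [div_lt_iff₀ hT] at this
          linarith
    _ = cdf μ (x + a / T) + τ := by
        rw [integral_add hi (integrable_const _), integral_indicator_Iic]; simp

lemma le_smoothCDF {T a τ : ℝ} (hT : 0 < T) (hτ : 1 - cdf stdNormal a ≤ τ) (x : ℝ) :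
    cdf μ (x - a / T) - τ ≤ smoothCDF μ T x := by
  have hτ0 : 0 ≤ τ := (sub_nonneg.2 (cdf_le_one _ _)).trans hτ
  have hi : Integrable ((Set.Iic (x - a / T)).indicator fun _ => (1 : ℝ)) μ :=
    (integrable_const _).indicator measurableSet_Iic
  calc cdf μ (x - a / T) - τ
      = ∫ s, ((Set.Iic (x - a / T)).indicator (fun _ => (1 : ℝ)) s - τ) ∂μ := by
        rw [integral_sub hi (integrable_const _), integral_indicator_Iic]; simp
    _ ≤ smoothCDF μ T x := by
        refine integral_mono (hi.sub (integrable_const _)) (integrable_smoothCDF μ T x) fun s => ?_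
        by_cases h : s ≤ x - a / T
        · simp only [Set.indicator, Set.mem_Iic, h, if_true]
          have h1 : a ≤ T * (x - s) := by
            have : a / T ≤ x - s := by linarith
            rw [div_le_iff₀ hT] at this
            linarith
          linarith [monotone_cdf stdNormal h1]
        · simp only [Set.indicator, Set.mem_Iic, h, if_false, zero_sub]
          linarith [cdf_nonneg stdNormal (T * (x - s))]

/-- Smoothing inequality. -/
lemma abs_cdf_sub_le {T a τ η : ℝ} (hT : 0 < T) (ha : 0 ≤ a) (h1 : cdf stdNormal (-a) ≤ τ)
    (h2 : 1 - cdf stdNormal a ≤ τ) (hη : ∀ x, |smoothCDF μ T x - smoothCDF stdNormal T x| ≤ η)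
    (x : ℝ) : |cdf μ x - cdf stdNormal x| ≤ η + 2 * (a / T) + 2 * τ := by
  have haT : 0 ≤ a / T := by positivity
  rw [abs_le]
  constructor
  · have e1 := smoothCDF_le μ hT h1 (x - a / T)
    have e2 := le_smoothCDF stdNormal hT h2 (x - a / T)
    have e3 := (abs_le.1 (hη (x - a / T))).1
    have e4 := cdf_stdNormal_sub_le (show x - a / T - a / T ≤ x by linarith)
    rw [sub_add_cancel] at e1
    linarith
  · have e1 := smoothCDF_le stdNormal hT h1 (x + a / T)
    have e2 := le_smoothCDF μ hT h2 (x + a / T)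
    have e3 := (abs_le.1 (hη (x + a / T))).2
    have e4 := cdf_stdNormal_sub_le (show x ≤ x + a / T + a / T by linarith)
    rw [add_sub_cancel_right] at e2
    linarith

lemma integrable_exp_mul_I (t : ℝ) : Integrable (fun x : ℝ => Complex.exp (t * x * Complex.I)) μ := by
  refine Integrable.mono' (integrable_const (1 : ℝ)) (by fun_prop) (ae_of_all _ fun x => ?_)
  rw [← Complex.ofReal_mul, Complex.norm_exp_ofReal_mul_I]

lemma integral_sin_eq (t x : ℝ) : ∫ s, Real.sin (t * (x - s)) ∂μ
    = -(Complex.exp (-(t * x : ℝ) * Complex.I) * charFun μ t).im := by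
  have hi := (integrable_exp_mul_I μ t).const_mul (Complex.exp (-(t * x : ℝ) * Complex.I))
  have h := integral_im hi
  simp only [RCLike.im_to_complex] at h
  rw [charFun_apply_real, ← integral_const_mul, ← h, ← integral_neg]
  refine integral_congr_ae (ae_of_all _ fun s => ?_)
  simp only
  rw [← Complex.exp_add]
  have : -((t * x : ℝ) : ℂ) * Complex.I + t * s * Complex.I
      = ((-(t * (x - s)) : ℝ) : ℂ) * Complex.I := by push_cast; ring
  rw [this, Complex.exp_ofReal_mul_I_im, Real.sin_neg, neg_neg]

/-- Fubini for the representation of the normal distribution function. The first moment of `μ`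
provides the dominating function, since `|sinQuot t u| ≤ |u|` uniformly in `t`. -/
lemma smoothCDF_eq (hμ : Integrable id μ) (T x : ℝ) :
    Integrable (fun t => ∫ s, sinQuot t (T * (x - s)) ∂μ) stdNormal ∧
    smoothCDF μ T x = cdf stdNormal 0
      + (√(2 * Real.pi))⁻¹ * ∫ t, ∫ s, sinQuot t (T * (x - s)) ∂μ ∂stdNormal := by
  have hprod : Integrable (fun p : ℝ × ℝ => sinQuot p.2 (T * (x - p.1))) (μ.prod stdNormal) := by
    have hb : Integrable (fun p : ℝ × ℝ => T * (x - p.1)) (μ.prod stdNormal) :=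
      (((integrable_const x).sub hμ).const_mul T).comp_fst stdNormal
    refine hb.mono ?_ (ae_of_all _ fun p => ?_)
    · exact (continuous_sinQuot.comp (by fun_prop : Continuous fun p : ℝ × ℝ =>
        (p.2, T * (x - p.1)))).aestronglyMeasurable
    · exact abs_sinQuot_le _ _
  refine ⟨hprod.integral_prod_right, ?_⟩
  rw [smoothCDF]
  simp only [cdf_stdNormal_eq (T * (x - _))]
  rw [integral_add (integrable_const _) (hprod.integral_prod_left.const_mul _),
    integral_const_mul, integral_integral_swap hprod]
  simp

lemma abs_integral_sinQuot_sub_le {ν : Measure ℝ} [IsProbabilityMeasure ν] {t : ℝ} (ht : t ≠ 0)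
    (T x : ℝ) :
    |∫ s, sinQuot t (T * (x - s)) ∂μ - ∫ s, sinQuot t (T * (x - s)) ∂ν|
      ≤ ‖charFun μ (t * T) - charFun ν (t * T)‖ / |t| := by
  have e : ∀ s, sinQuot t (T * (x - s)) = Real.sin ((t * T) * (x - s)) / t := fun s => by
    rw [sinQuot_of_ne_zero ht, mul_assoc]
  simp only [e, integral_div, integral_sin_eq]
  rw [← sub_div, abs_div]
  gcongr
  have e2 : -(Complex.exp (-(t * T * x : ℝ) * Complex.I) * charFun μ (t * T)).im
      - -(Complex.exp (-(t * T * x : ℝ) * Complex.I) * charFun ν (t * T)).im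
      = -(Complex.exp (-(t * T * x : ℝ) * Complex.I)
        * (charFun μ (t * T) - charFun ν (t * T))).im := by
    rw [mul_sub, Complex.sub_im]; ring
  rw [e2, abs_neg]
  refine (Complex.abs_im_le_norm _).trans ?_
  rw [norm_mul, ← Complex.ofReal_neg, Complex.norm_exp_ofReal_mul_I, one_mul]

lemma abs_smoothCDF_sub_le (hμ : Integrable id μ) {T : ℝ} {D : ℝ → ℝ} (hD : Integrable D stdNormal)
    (hle : ∀ t, t ≠ 0 → ‖charFun μ (t * T) - charFun stdNormal (t * T)‖ / |t| ≤ D t) (x : ℝ) :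
    |smoothCDF μ T x - smoothCDF stdNormal T x| ≤ ∫ t, D t ∂stdNormal := by
  have hg : Integrable id stdNormal := memLp_one_iff_integrable.1 (memLp_id_gaussianReal 1)
  have h1 := smoothCDF_eq μ hμ T x
  have h2 := smoothCDF_eq stdNormal hg T x
  rw [h1.2, h2.2, add_sub_add_left_eq_sub, ← mul_sub, ← integral_sub h1.1 h2.1, abs_mul]
  refine (mul_le_of_le_one_left (abs_nonneg _) ?_).trans ?_
  · rw [abs_of_nonneg (by positivity)]
    exact inv_sqrt_two_pi_le_one
  refine (abs_integral_le_integral_abs).trans ?_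
  refine integral_mono_ae (h1.1.sub h2.1).abs hD ?_
  have : NullSingletonClass stdNormal := nullSingletonClass_gaussianReal one_ne_zero
  have h0 : ∀ᵐ t ∂stdNormal, t ≠ 0 := by
    rw [ae_iff]; simp
  filter_upwards [h0] with t ht
  exact (abs_integral_sinQuot_sub_le μ ht T x).trans (hle t ht)

end Smoothing

end GaussianSmoothing

/-! ### Berry–Esseen bound for sums of independent variables. -/

section BerryEsseen

lemma integrable_abs_pow_stdNormal (N : ℕ) : Integrable (fun x : ℝ => |x| ^ N) stdNormal := by
  have h := (memLp_id_gaussianReal (μ := 0) (v := 1) (N : NNReal)).integrable_norm_pow'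
  simpa using h

lemma exists_stdNormal_tail_le (N : ℕ) : ∃ C : ℝ, 0 ≤ C ∧ ∀ a : ℝ, 0 < a →
    cdf stdNormal (-a) ≤ C * (a ^ N)⁻¹ ∧ 1 - cdf stdNormal a ≤ C * (a ^ N)⁻¹ := by
  refine ⟨∫ x, |x| ^ N ∂stdNormal, integral_nonneg fun x => by positivity, fun a ha => ?_⟩
  have hm : stdNormal.real {x | a ^ N ≤ |x| ^ N} ≤ (∫ x, |x| ^ N ∂stdNormal) * (a ^ N)⁻¹ := by
    rw [← div_eq_mul_inv, le_div_iff₀ (by positivity), mul_comm]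
    exact mul_meas_ge_le_integral_of_nonneg (ae_of_all _ fun x => by positivity)
      (integrable_abs_pow_stdNormal N) _
  constructor
  · rw [cdf_eq_real]
    refine (measureReal_mono fun x hx => ?_).trans hm
    exact pow_le_pow_left₀ ha.le (by rw [Set.mem_Iic] at hx; exact le_abs.2 (Or.inr (by linarith))) _
  · rw [cdf_eq_real, ← probReal_compl_eq_one_sub measurableSet_Iic]
    refine (measureReal_mono fun x hx => ?_).trans hm
    exact pow_le_pow_left₀ ha.le (le_abs.2 (Or.inl (by simpa using (not_le.1 (show ¬ x ≤ a from hx)).le))) _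

/-- Passing to Lebesgue measure allows the substitution `u = T t`, so the low-frequency integral
does not depend on `T`. -/
lemma stdNormal_le_volume : stdNormal ≤ volume := by
  rw [stdNormal, gaussianReal_of_var_ne_zero _ one_ne_zero]
  conv_rhs => rw [← withDensity_one (μ := (volume : Measure ℝ))]
  refine withDensity_mono (ae_of_all _ fun x => ?_)
  rw [gaussianPDF]
  exact ENNReal.ofReal_le_one.2 (gaussianPDFReal_std_le_one x)

lemma integrable_sq_mul_exp : Integrable fun u : ℝ => u ^ 2 * Real.exp (-(u ^ 2 / 8)) := by
  have h := integrable_rpow_mul_exp_neg_mul_sq (show (0 : ℝ) < 1 / 8 by norm_num)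
    (show (-1 : ℝ) < 2 by norm_num)
  refine h.congr (ae_of_all _ fun u => ?_)
  simp only [Real.rpow_two]
  ring_nf

lemma integrable_abs_mul_exp : Integrable fun u : ℝ => |u| * Real.exp (-(u ^ 2 / 8)) := by
  have h := (integrable_mul_exp_neg_mul_sq (show (0 : ℝ) < 1 / 8 by norm_num)).abs
  refine h.congr (ae_of_all _ fun u => ?_)
  simp only [abs_mul, Real.abs_exp]
  ring_nf

/-- Bound for the distance to the normal distribution function from a bound for the
characteristic function. -/
lemma exists_abs_cdf_sub_stdNormal_le (N : ℕ) : ∃ C : ℝ, 0 ≤ C ∧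
    ∀ (μ : Measure ℝ) [IsProbabilityMeasure μ], Integrable id μ → ∀ a T g d : ℝ, 1 ≤ a → 0 < T →
      0 ≤ g → 0 ≤ d → (∀ t, |t| ≤ a * T → ‖charFun μ t - charFun stdNormal t‖
        ≤ (g * |t| ^ 3 + d * t ^ 2) * Real.exp (-(t ^ 2 / 8))) →
      ∀ x, |cdf μ x - cdf stdNormal x| ≤ C * (g + d + a / T + (a ^ N)⁻¹) := by
  obtain ⟨K, hK0, hK⟩ := exists_stdNormal_tail_le N
  set M2 := ∫ u : ℝ, u ^ 2 * Real.exp (-(u ^ 2 / 8)) with hM2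
  set M1 := ∫ u : ℝ, |u| * Real.exp (-(u ^ 2 / 8)) with hM1
  set MN := ∫ u : ℝ, |u| ^ N ∂stdNormal with hMN
  have h2 : 0 ≤ M2 := integral_nonneg fun u => by positivity
  have h1 : 0 ≤ M1 := integral_nonneg fun u => by positivity
  have hN : 0 ≤ MN := integral_nonneg fun u => by positivity
  refine ⟨M2 + M1 + 2 * MN + 2 + 2 * K, by positivity, ?_⟩
  intro μ _ hμ a T g d ha hT hg hd hcf x
  have ha0 : 0 < a := by linarith
  -- The assumed bound for the characteristic functions divided by `|u|`.
  set G : ℝ → ℝ := fun u => g * (u ^ 2 * Real.exp (-(u ^ 2 / 8)))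
    + d * (|u| * Real.exp (-(u ^ 2 / 8))) with hG
  have hG0 : ∀ u, 0 ≤ G u := fun u => by rw [hG]; positivity
  have hGi : Integrable G := (integrable_sq_mul_exp.const_mul g).add
    (integrable_abs_mul_exp.const_mul d)
  have hGI : ∫ u, G u = g * M2 + d * M1 := by
    rw [hG, integral_add (integrable_sq_mul_exp.const_mul g) (integrable_abs_mul_exp.const_mul d),
      integral_const_mul, integral_const_mul]
  have hGTi : Integrable fun t => T * G (T * t) := (hGi.comp_mul_left' hT.ne').const_mul T
  have hGTI : ∫ t, T * G (T * t) = g * M2 + d * M1 := by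
    rw [integral_const_mul, Measure.integral_comp_mul_left G T, hGI, abs_of_pos (by positivity),
      smul_eq_mul, mul_inv_cancel_left₀ hT.ne']
  have hGg : ∫ t, T * G (T * t) ∂stdNormal ≤ g * M2 + d * M1 := by
    rw [← hGTI]
    exact integral_mono_measure stdNormal_le_volume
      (ae_of_all _ fun t => mul_nonneg hT.le (hG0 _)) hGTi
  have hD1 : Integrable (fun t => T * G (T * t)) stdNormal := hGTi.mono_measure stdNormal_le_volume
  have hD2 : Integrable (fun t : ℝ => 2 * (a ^ N)⁻¹ * |t| ^ N) stdNormal :=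
    (integrable_abs_pow_stdNormal N).const_mul _
  have hη := abs_smoothCDF_sub_le μ hμ (T := T) (hD1.add hD2) (fun t ht => by
    have ht' : 0 < |t| := abs_pos.2 ht
    rw [div_le_iff₀ ht']
    -- Below `a` the hypothesis applies. Beyond `a` the trivial bound `2` is multiplied by `(|t| /
    -- a)^N ≥ 1`, and dividing by `|t| > a ≥ 1` only helps.
    rcases le_or_gt |t| a with hta | hta
    · refine (hcf (t * T) (by rw [abs_mul, abs_of_pos hT]; gcongr)).trans ?_
      have e : (g * |t * T| ^ 3 + d * (t * T) ^ 2) * Real.exp (-((t * T) ^ 2 / 8))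
          = T * G (T * t) * |t| := by
        simp only [hG, abs_mul, abs_of_pos hT]
        rw [mul_comm T t, mul_pow t T 2, ← sq_abs t]
        ring
      rw [e]
      refine mul_le_mul_of_nonneg_right ?_ ht'.le
      simp only [Pi.add_apply, le_add_iff_nonneg_right]
      positivity
    · have b1 : ‖charFun μ (t * T) - charFun stdNormal (t * T)‖ ≤ 2 := by
        refine (norm_sub_le _ _).trans ?_
        linarith [norm_charFun_le_one (μ := μ) (t * T), norm_charFun_le_one (μ := stdNormal) (t * T)]
      have b2 : 1 ≤ (a ^ N)⁻¹ * |t| ^ N := by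
        rw [inv_mul_eq_div, one_le_div (by positivity)]
        exact pow_le_pow_left₀ ha0.le hta.le _
      have b3 : 2 ≤ (T * G (T * t) + 2 * (a ^ N)⁻¹ * |t| ^ N) := by
        have := mul_nonneg hT.le (hG0 (T * t))
        nlinarith
      simp only [Pi.add_apply]
      nlinarith)
  have hmain := abs_cdf_sub_le μ hT ha0.le (hK a ha0).1 (hK a ha0).2 hη x
  refine hmain.trans ?_
  have e1 : ∫ t, ((fun t => T * G (T * t)) + fun t : ℝ => 2 * (a ^ N)⁻¹ * |t| ^ N) t ∂stdNormal
      ≤ g * M2 + d * M1 + 2 * (a ^ N)⁻¹ * MN := by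
    simp only [Pi.add_apply]
    rw [integral_add hD1 hD2, integral_const_mul (2 * (a ^ N)⁻¹)]
    linarith
  have e2 : 0 ≤ a / T := by positivity
  have e3 : 0 ≤ (a ^ N)⁻¹ := by positivity
  refine (add_le_add_left (add_le_add_left e1 _) _).trans ?_
  nlinarith [mul_nonneg hg h1, mul_nonneg hg h2, mul_nonneg hg hN, mul_nonneg hg hK0,
    mul_nonneg hd h1, mul_nonneg hd h2, mul_nonneg hd hN, mul_nonneg hd hK0,
    mul_nonneg e2 h1, mul_nonneg e2 h2, mul_nonneg e2 hN, mul_nonneg e2 hK0,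
    mul_nonneg e3 h1, mul_nonneg e3 h2, mul_nonneg e3 hN, mul_nonneg e3 hK0]

/-- The constant comes from `|y| > 1`: `1 + (1 + |y| + y²/2) ≤ (7/2)|y|³`. -/
lemma norm_exp_mul_I_sub_le (y : ℝ) :
    ‖Complex.exp (y * Complex.I) - (1 + y * Complex.I - (y ^ 2 / 2 : ℝ))‖ ≤ 7 / 2 * |y| ^ 3 := by
  rcases le_or_gt |y| 1 with h | h
  · have hn : ‖(y : ℂ) * Complex.I‖ = |y| := by simp
    have hb := Complex.exp_bound (x := y * Complex.I) (by rw [hn]; exact h) (n := 3) (by norm_num)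
    rw [hn] at hb
    have e : ∑ m ∈ Finset.range 3, ((y : ℂ) * Complex.I) ^ m / (m.factorial : ℂ)
        = 1 + y * Complex.I - (y ^ 2 / 2 : ℝ) := by
      simp [Finset.sum_range_succ, mul_pow, Complex.I_sq]
      ring
    rw [e] at hb
    refine hb.trans ?_
    have : 0 ≤ |y| ^ 3 := by positivity
    norm_num [Nat.factorial]
    nlinarith
  · have e1 : ‖Complex.exp (y * Complex.I)‖ = 1 := Complex.norm_exp_ofReal_mul_I y
    have e2 : ‖(1 : ℂ) + y * Complex.I - (y ^ 2 / 2 : ℝ)‖ ≤ 1 + |y| + |y| ^ 2 / 2 := by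
      refine (norm_sub_le _ _).trans ?_
      refine add_le_add ((norm_add_le _ _).trans (by simp)) ?_
      rw [Complex.norm_real, Real.norm_eq_abs, abs_div, abs_pow, abs_two]
    refine (norm_sub_le _ _).trans ?_
    have f1 : |y| ≤ |y| ^ 3 := by nlinarith [mul_pos (show 0 < |y| by linarith) (show 0 < |y| by linarith)]
    have f2 : |y| ^ 2 ≤ |y| ^ 3 := by nlinarith [sq_nonneg |y|]
    linarith

lemma exp_neg_bounds {r : ℝ} (hr : 0 ≤ r) :
    |Real.exp (-(r ^ 2 / 2)) - (1 - r ^ 2 / 2)| ≤ r ^ 3 / 2 := by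
  have h1 := Real.add_one_le_exp (-(r ^ 2 / 2))
  rw [abs_of_nonneg (by linarith)]
  have h2 := Real.add_one_le_exp (r ^ 2 / 2)
  have h3 : Real.exp (-(r ^ 2 / 2)) ≤ (1 + r ^ 2 / 2)⁻¹ := by
    rw [Real.exp_neg]
    exact inv_anti₀ (by positivity) (by linarith)
  have h4 : (1 + r ^ 2 / 2)⁻¹ ≤ 1 - r ^ 2 / 2 + r ^ 3 / 2 := by
    rw [inv_le_iff_one_le_mul₀ (by positivity)]
    have : 0 ≤ r ^ 3 * ((r - 1) ^ 2 + 1) := by positivity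
    nlinarith
  linarith

lemma abs_exp_neg_sub_le {u v m : ℝ} (hu : m ≤ u) (hv : m ≤ v) :
    |Real.exp (-u) - Real.exp (-v)| ≤ |u - v| * Real.exp (-m) := by
  wlog h : u ≤ v generalizing u v
  · rw [abs_sub_comm, abs_sub_comm u v]
    exact this hv hu (le_of_not_ge h)
  rw [abs_of_nonneg (by simpa using h), abs_of_nonpos (by linarith)]
  have e : Real.exp (-v) = Real.exp (-u) * Real.exp (u - v) := by rw [← Real.exp_add]; ring_nf
  have h1 := Real.add_one_le_exp (u - v)
  have h2 : Real.exp (-u) ≤ Real.exp (-m) := Real.exp_le_exp.2 (by linarith)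
  have h3 := Real.exp_pos (-u)
  rw [e]
  nlinarith

/-- Third order comparison of the characteristic function of a centred law with that of the
normal law of the same variance. -/
lemma charFun_centred_bounds (ν : Measure ℝ) [IsProbabilityMeasure ν]
    (h3 : Integrable (fun x : ℝ => |x| ^ 3) ν) (hmean : ∫ x, x ∂ν = 0) (t : ℝ) :
    let x := (∫ z, z ^ 2 ∂ν) * t ^ 2 / 2
    let y := 4 * (∫ z, |z| ^ 3 ∂ν) * |t| ^ 3
    ‖charFun ν t - (Real.exp (-x) : ℝ)‖ ≤ y ∧ ‖charFun ν t‖ ≤ Real.exp (-x + y) ∧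
      1 ≤ Real.exp 1 * Real.exp (-x + y) := by
  intro x y
  have hdom : ∀ z : ℝ, |z| ≤ 1 + |z| ^ 3 ∧ z ^ 2 ≤ 1 + |z| ^ 3 := fun z => by
    rw [← sq_abs]
    have : 0 ≤ |z| := abs_nonneg z
    constructor <;> nlinarith [sq_nonneg (|z| - 1), mul_nonneg this (sq_nonneg (|z| - 1))]
  have hi : Integrable (fun z : ℝ => 1 + |z| ^ 3) ν := (integrable_const _).add h3
  have h1 : Integrable (fun z : ℝ => z) ν := hi.mono' (by fun_prop) (ae_of_all _ fun z => (hdom z).1)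
  have h2 : Integrable (fun z : ℝ => z ^ 2) ν := hi.mono' (by fun_prop) (ae_of_all _ fun z => by
    rw [Real.norm_eq_abs, abs_of_nonneg (sq_nonneg z)]; exact (hdom z).2)
  set s := ∫ z, z ^ 2 ∂ν with hs
  set β := ∫ z, |z| ^ 3 ∂ν with hβ
  have hs0 : 0 ≤ s := integral_nonneg fun z => sq_nonneg z
  have hβ0 : 0 ≤ β := integral_nonneg fun z => by positivity
  -- Lyapunov's inequality, by integrating `3 c z² ≤ 2 |z|³ + c³` with `c = √s`, where `c³ = c s`.
  have hsβ : √s ^ 3 ≤ β := by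
    have hle : ∫ z, 3 * √s * z ^ 2 ∂ν ≤ ∫ z, (2 * |z| ^ 3 + √s ^ 3) ∂ν := by
      refine integral_mono (h2.const_mul _) ((h3.const_mul 2).add (integrable_const _)) fun z => ?_
      have hc := Real.sqrt_nonneg s
      have hz := abs_nonneg z
      simp only
      rw [← sq_abs]
      nlinarith [mul_nonneg (show 0 ≤ 2 * |z| + √s by positivity) (sq_nonneg (|z| - √s))]
    rw [integral_const_mul, integral_add (h3.const_mul 2) (integrable_const _),
      integral_const_mul, integral_const, ← hs, ← hβ] at hle
    simp only [probReal_univ, one_smul] at hle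
    have e : √s ^ 3 = √s * s := by rw [pow_succ, Real.sq_sqrt hs0, mul_comm]
    rw [e] at hle ⊢
    linarith
  set r := √s * |t| with hr
  have hr0 : 0 ≤ r := by positivity
  have hx : x = r ^ 2 / 2 := by
    rw [hr, mul_pow, Real.sq_sqrt hs0, sq_abs]
  have hy : 4 * r ^ 3 ≤ y := by
    have : √s ^ 3 * |t| ^ 3 ≤ β * |t| ^ 3 := by gcongr
    simp only [y, hr, mul_pow]
    linarith
  have hy0 : 0 ≤ y := by positivity
  have hx0 : 0 ≤ x := by rw [hx]; positivity
  have i1 : Integrable (fun z : ℝ => ((t * z : ℝ) : ℂ) * Complex.I) ν :=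
    ((h1.const_mul t).ofReal).mul_const _
  have hsq : ∀ z : ℝ, t ^ 2 / 2 * z ^ 2 = (t * z) ^ 2 / 2 := fun z => by ring
  have i2' : Integrable (fun z : ℝ => (t * z) ^ 2 / 2) ν :=
    (h2.const_mul (t ^ 2 / 2)).congr (ae_of_all _ hsq)
  have i2 : Integrable (fun z : ℝ => (((t * z) ^ 2 / 2 : ℝ) : ℂ)) ν := i2'.ofReal
  have i3 : Integrable (fun z : ℝ => (1 : ℂ) + (t * z : ℝ) * Complex.I) ν :=
    (integrable_const _).add i1
  -- Of the budget `y`, the Taylor remainder of the characteristic function takes `7/8` and that of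
  -- the exponential takes `1/8`; this explains the `4` in `y`.
  have htaylor : ‖charFun ν t - (1 - x : ℝ)‖ ≤ 7 / 8 * y := by
    have e1 : ∫ z : ℝ, ((1 : ℂ) + (t * z : ℝ) * Complex.I - ((t * z) ^ 2 / 2 : ℝ)) ∂ν
        = (1 - x : ℝ) := by
      rw [integral_sub i3 i2, integral_add (integrable_const _) i1,
        integral_mul_const, integral_complex_ofReal, integral_complex_ofReal, integral_const_mul,
        hmean]
      have : ∫ z, (t * z) ^ 2 / 2 ∂ν = x := by
        simp only [← hsq, integral_const_mul, x]
        ring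
      rw [this]
      simp
    rw [charFun_apply_real, ← e1, ← integral_sub (integrable_exp_mul_I ν t) (i3.sub' i2)]
    have hbd : ∀ z : ℝ, ‖Complex.exp (t * z * Complex.I)
        - ((1 : ℂ) + (t * z : ℝ) * Complex.I - ((t * z) ^ 2 / 2 : ℝ))‖
        ≤ 7 / 2 * |t| ^ 3 * |z| ^ 3 := fun z => by
      have := norm_exp_mul_I_sub_le (t * z)
      rw [abs_mul, mul_pow |t|, ← mul_assoc] at this
      rw [← Complex.ofReal_mul]
      exact this
    refine (norm_integral_le_of_norm_le (h3.const_mul (7 / 2 * |t| ^ 3))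
      (ae_of_all _ hbd)).trans (le_of_eq ?_)
    rw [integral_const_mul]
    simp only [y]
    ring
  have hexp : |Real.exp (-x) - (1 - x)| ≤ y / 8 := by
    have := exp_neg_bounds hr0
    rw [← hx] at this
    linarith
  -- For `x ≥ 1` the Taylor expansion says nothing, but then `y ≥ x` and the bounds on `‖charFun ν
  -- t‖` become trivial.
  have hxy : 1 ≤ x → x ≤ y := fun h1x => by
    have hr1 : 1 ≤ r := by
      by_contra hcon
      push Not at hcon
      nlinarith
    have : r ^ 2 ≤ r ^ 3 := by nlinarith [sq_nonneg r]
    rw [hx]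
    nlinarith [sq_nonneg r]
  refine ⟨?_, ?_, ?_⟩
  · have e : charFun ν t - (Real.exp (-x) : ℝ)
        = (charFun ν t - (1 - x : ℝ)) - ((Real.exp (-x) - (1 - x) : ℝ) : ℂ) := by push_cast; ring
    rw [e]
    refine (norm_sub_le _ _).trans ?_
    rw [Complex.norm_real, Real.norm_eq_abs]
    linarith
  · rcases le_total x 1 with h | h
    · have e : charFun ν t = (charFun ν t - (1 - x : ℝ)) + ((1 - x : ℝ) : ℂ) := by ring
      have h4 : ‖charFun ν t‖ ≤ ‖charFun ν t - (1 - x : ℝ)‖ + ‖((1 - x : ℝ) : ℂ)‖ := by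
        conv_lhs => rw [e]
        exact norm_add_le _ _
      rw [Complex.norm_real, Real.norm_eq_abs, abs_of_nonneg (by linarith)] at h4
      linarith [Real.add_one_le_exp (-x + y)]
    · exact (norm_charFun_le_one t).trans (Real.one_le_exp (by linarith [hxy h]))
  · rw [← Real.exp_add]
    refine Real.one_le_exp ?_
    rcases le_total x 1 with h | h
    · linarith
    · linarith [hxy h]

/-- Telescoping over the factors. When one factor is replaced its Gaussian decay `exp (-x j)` is
lost; `h3` restores it at the price of a single overall factor `e`, not one per index. -/
lemma norm_prod_sub_prod_exp_le {ι : Type*} (A : Finset ι) (φ : ι → ℂ) (x y : ι → ℝ)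
    (hy : ∀ i, 0 ≤ y i) (h1 : ∀ i, ‖φ i - (Real.exp (-x i) : ℝ)‖ ≤ y i)
    (h2 : ∀ i, ‖φ i‖ ≤ Real.exp (-x i + y i)) (h3 : ∀ i, 1 ≤ Real.exp 1 * Real.exp (-x i + y i)) :
    ‖∏ i ∈ A, φ i - (Real.exp (-∑ i ∈ A, x i) : ℝ)‖
      ≤ Real.exp 1 * (∑ i ∈ A, y i) * Real.exp (-∑ i ∈ A, x i + ∑ i ∈ A, y i) := by
  classical
  induction A using Finset.induction_on with
  | empty => simp
  | insert j A hj ih =>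
    rw [Finset.prod_insert hj, Finset.sum_insert hj, Finset.sum_insert hj]
    set X := ∑ i ∈ A, x i
    set Y := ∑ i ∈ A, y i with hY
    set Q := ∏ i ∈ A, φ i
    have hY0 : 0 ≤ Y := Finset.sum_nonneg fun i _ => hy i
    have e : φ j * Q - (Real.exp (-(x j + X)) : ℝ) = φ j * (Q - (Real.exp (-X) : ℝ))
        + (φ j - (Real.exp (-x j) : ℝ)) * (Real.exp (-X) : ℝ) := by
      rw [neg_add, Real.exp_add]; push_cast; ring
    have e2 : Real.exp (-(x j + X) + (y j + Y))
        = Real.exp (-x j + y j) * Real.exp (-X + Y) := by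
      rw [← Real.exp_add]; ring_nf
    have hX : Real.exp (-X) ≤ Real.exp (-X + Y) := Real.exp_le_exp.2 (by linarith)
    rw [e, e2]
    refine (norm_add_le _ _).trans ?_
    rw [norm_mul, norm_mul, Complex.norm_real, Real.norm_eq_abs, Real.abs_exp]
    have a1 : ‖φ j‖ * ‖Q - (Real.exp (-X) : ℝ)‖
        ≤ Real.exp (-x j + y j) * (Real.exp 1 * Y * Real.exp (-X + Y)) :=
      mul_le_mul (h2 j) ih (norm_nonneg _) (Real.exp_pos _).le
    have a2 : ‖φ j - (Real.exp (-x j) : ℝ)‖ * Real.exp (-X)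
        ≤ y j * ((Real.exp 1 * Real.exp (-x j + y j)) * Real.exp (-X + Y)) := by
      refine mul_le_mul (h1 j) ?_ (Real.exp_pos _).le (hy j)
      exact hX.trans (le_mul_of_one_le_left (Real.exp_pos _).le (h3 j))
    refine (add_le_add a1 a2).trans (le_of_eq ?_)
    ring

/-- A Berry–Esseen bound for sums of independent centred variables, stated in terms of the
characteristic functions. -/
theorem exists_berryEsseen_bound (N : ℕ) : ∃ C : ℝ, 0 ≤ C ∧
    ∀ (μ : Measure ℝ) [IsProbabilityMeasure μ], Integrable id μ →
    ∀ {ι : Type} (A : Finset ι) (ν : ι → Measure ℝ) [∀ i, IsProbabilityMeasure (ν i)],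
      (∀ i, Integrable (fun x : ℝ => |x| ^ 3) (ν i)) → (∀ i, ∫ x, x ∂ν i = 0) →
      (∀ t, charFun μ t = ∏ i ∈ A, charFun (ν i) t) →
    ∀ a Γ : ℝ, 1 ≤ a → 0 < Γ → 4 * ∑ i ∈ A, ∫ x, |x| ^ 3 ∂ν i ≤ Γ →
      |∑ i ∈ A, ∫ x, x ^ 2 ∂ν i - 1| ≤ 1 / 2 →
      ∀ x, |cdf μ x - cdf stdNormal x|
        ≤ C * (a ^ 2 * Γ + |∑ i ∈ A, ∫ x, x ^ 2 ∂ν i - 1| + (a ^ N)⁻¹) := by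
  obtain ⟨C, hC0, hC⟩ := exists_abs_cdf_sub_stdNormal_le N
  refine ⟨11 * C, by positivity, ?_⟩
  intro μ _ hμ ι A ν _ h3 hmean hcf a Γ ha hΓ hβ hδ x
  set δ := ∑ i ∈ A, ∫ x, x ^ 2 ∂ν i - 1 with hδdef
  have ha0 : 0 < a := by linarith
  have haT : a * (1 / (8 * Γ * a)) = 1 / (8 * Γ) := by field_simp
  -- With this `T` the relevant range is `|t| ≤ 1 / (8Γ)`, where `Γ|t|³ ≤ t²/8`. As `|δ| ≤ 1/2`, the
  -- exponent `-(1 + δ)t²/2 + Γ|t|³` is at most `-t²/8`. The final `11` is `3 + 8`, from `e ≤ 3` and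
  -- `a / T = 8 a² Γ`.
  have hmain := hC μ hμ a (1 / (8 * Γ * a)) (Real.exp 1 * Γ) (|δ| / 2) ha (by positivity)
    (by positivity) (by positivity) (fun t ht => ?_) x
  · refine hmain.trans ?_
    have e1 : a / (1 / (8 * Γ * a)) = 8 * (a ^ 2 * Γ) := by field_simp
    have e2 : Real.exp 1 * Γ ≤ 3 * (a ^ 2 * Γ) := by
      have : Real.exp 1 ≤ 3 := by linarith [Real.exp_one_lt_d9]
      have h1 : 1 ≤ a ^ 2 := one_le_pow₀ ha
      calc Real.exp 1 * Γ ≤ 3 * Γ := by gcongr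
        _ ≤ 3 * (a ^ 2 * Γ) := by nlinarith
    rw [e1]
    have e3 : 0 ≤ (a ^ N)⁻¹ := by positivity
    have e4 : 0 ≤ |δ| := abs_nonneg _
    calc C * (Real.exp 1 * Γ + |δ| / 2 + 8 * (a ^ 2 * Γ) + (a ^ N)⁻¹)
        ≤ C * (11 * (a ^ 2 * Γ + |δ| + (a ^ N)⁻¹)) := by gcongr; linarith
      _ = _ := by ring
  rw [haT] at ht
  have hb := fun i => charFun_centred_bounds (ν i) (h3 i) (hmean i) t
  have hprod := norm_prod_sub_prod_exp_le A (fun i => charFun (ν i) t)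
    (fun i => (∫ z, z ^ 2 ∂ν i) * t ^ 2 / 2) (fun i => 4 * (∫ z, |z| ^ 3 ∂ν i) * |t| ^ 3)
    (fun i => by
      have : 0 ≤ ∫ z, |z| ^ 3 ∂ν i := integral_nonneg fun z => by positivity
      positivity)
    (fun i => (hb i).1) (fun i => (hb i).2.1) (fun i => (hb i).2.2)
  have hX : ∑ i ∈ A, (∫ z, z ^ 2 ∂ν i) * t ^ 2 / 2 = (1 + δ) * t ^ 2 / 2 := by
    rw [← Finset.sum_div, ← Finset.sum_mul, hδdef]; ring
  have hY : ∑ i ∈ A, 4 * (∫ z, |z| ^ 3 ∂ν i) * |t| ^ 3 ≤ Γ * |t| ^ 3 := by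
    rw [← Finset.sum_mul, ← Finset.mul_sum]
    gcongr
  have hY2 : Γ * |t| ^ 3 ≤ t ^ 2 / 8 := by
    have h1 : Γ * |t| ≤ 1 / 8 := by
      rw [le_div_iff₀ (by positivity)] at ht
      linarith
    rw [← sq_abs]
    nlinarith [sq_nonneg |t|]
  have hδ' := abs_le.1 hδ
  rw [← hcf t, hX] at hprod
  have ht2 := sq_nonneg t
  have b1 : ‖charFun μ t - (Real.exp (-((1 + δ) * t ^ 2 / 2)) : ℝ)‖
      ≤ Real.exp 1 * Γ * |t| ^ 3 * Real.exp (-(t ^ 2 / 8)) := by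
    refine hprod.trans ?_
    rw [mul_assoc (Real.exp 1) Γ]
    have : -((1 + δ) * t ^ 2 / 2) + ∑ i ∈ A, 4 * (∫ z, |z| ^ 3 ∂ν i) * |t| ^ 3
        ≤ -(t ^ 2 / 8) := by nlinarith
    gcongr
  have b2 : |Real.exp (-((1 + δ) * t ^ 2 / 2)) - Real.exp (-(t ^ 2 / 2))|
      ≤ |δ| / 2 * t ^ 2 * Real.exp (-(t ^ 2 / 8)) := by
    refine (abs_exp_neg_sub_le (m := t ^ 2 / 8) (by nlinarith) (by linarith)).trans (le_of_eq ?_)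
    have : (1 + δ) * t ^ 2 / 2 - t ^ 2 / 2 = δ * (t ^ 2 / 2) := by ring
    rw [this, abs_mul, abs_of_nonneg (show 0 ≤ t ^ 2 / 2 by positivity)]
    ring
  rw [charFun_stdNormal]
  have e : charFun μ t - (Real.exp (-(t ^ 2 / 2)) : ℝ)
      = (charFun μ t - (Real.exp (-((1 + δ) * t ^ 2 / 2)) : ℝ))
        + ((Real.exp (-((1 + δ) * t ^ 2 / 2)) - Real.exp (-(t ^ 2 / 2)) : ℝ) : ℂ) := by
    push_cast; ring
  rw [e]
  refine (norm_add_le _ _).trans ?_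
  rw [Complex.norm_real, Real.norm_eq_abs]
  refine (add_le_add b1 b2).trans (le_of_eq ?_)
  ring

end BerryEsseen

/-! ### Centred and scaled laws of integer-valued variables. -/

section NatLaws

variable (m : Measure ℕ)

lemma integrable_natCast_pow {j : ℕ} (h : ∫⁻ k, (k : ℝ≥0∞) ^ j ∂m < ⊤) :
    Integrable (fun k : ℕ => (k : ℝ) ^ j) m ∧
      ∫ k, (k : ℝ) ^ j ∂m = (∫⁻ k, (k : ℝ≥0∞) ^ j ∂m).toReal := by
  have e : ∀ k : ℕ, ((k : ℝ≥0∞) ^ j).toReal = (k : ℝ) ^ j := fun k => by simp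
  have hm : AEMeasurable (fun k : ℕ => (k : ℝ≥0∞) ^ j) m :=
    (measurable_of_countable _).aemeasurable
  have h1 := integrable_toReal_of_lintegral_ne_top hm h.ne
  have h2 := integral_toReal hm (ae_of_all _ fun k => ENNReal.pow_lt_top (ENNReal.natCast_lt_top k))
  simp only [e] at h1 h2
  exact ⟨h1, h2⟩

/-- The law of an integer valued variable after centring at `b` and scaling by `r`. -/
def affineLaw (r b : ℝ) : Measure ℝ := m.map fun k : ℕ => r * ((k : ℝ) - b)

lemma measurable_affine (r b : ℝ) : Measurable fun k : ℕ => r * ((k : ℝ) - b) :=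
  measurable_of_countable _

lemma charFun_affineLaw (r b t : ℝ) : charFun (affineLaw m r b) t
    = Complex.exp (-(t * r * b : ℝ) * Complex.I) * charFun (m.map fun k : ℕ => (k : ℝ)) (r * t) := by
  rw [affineLaw, charFun_map_mul_comp ((measurable_of_countable _).aemeasurable), charFun_apply_real,
    charFun_apply_real, integral_map (measurable_of_countable _).aemeasurable (by fun_prop),
    integral_map (measurable_of_countable _).aemeasurable (by fun_prop), ← integral_const_mul]
  refine integral_congr_ae (ae_of_all _ fun k => ?_)
  simp only
  rw [← Complex.exp_add]
  congr 1
  push_cast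
  ring

variable [IsProbabilityMeasure m]

instance (r b : ℝ) : IsProbabilityMeasure (affineLaw m r b) :=
  Measure.isProbabilityMeasure_map (measurable_affine r b).aemeasurable

lemma integrable_affineLaw (h1 : ∫⁻ k, (k : ℝ≥0∞) ^ 1 ∂m < ⊤) (r b : ℝ) :
    Integrable id (affineLaw m r b) := by
  rw [affineLaw, integrable_map_measure aestronglyMeasurable_id (measurable_affine r b).aemeasurable]
  have h := (((integrable_natCast_pow m h1).1.sub (integrable_const b)).const_mul r)
  simpa using h

variable {m}

lemma centredLaw_moments (h1 : ∫⁻ k, (k : ℝ≥0∞) ^ 1 ∂m < ⊤) (h2 : ∫⁻ k, (k : ℝ≥0∞) ^ 2 ∂m < ⊤)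
    (h3 : ∫⁻ k, (k : ℝ≥0∞) ^ 3 ∂m < ⊤) {r : ℝ} (hr : 0 ≤ r) {b : ℝ}
    (hb : b = (∫⁻ k, (k : ℝ≥0∞) ^ 1 ∂m).toReal) :
    Integrable (fun x : ℝ => |x| ^ 3) (affineLaw m r b) ∧
    ∫ x, x ∂(affineLaw m r b) = 0 ∧
    ∫ x, x ^ 2 ∂(affineLaw m r b) = r ^ 2 * ((∫⁻ k, (k : ℝ≥0∞) ^ 2 ∂m).toReal - b ^ 2) ∧
    ∫ x, |x| ^ 3 ∂(affineLaw m r b) ≤ r ^ 3 * (2 * (∫⁻ k, (k : ℝ≥0∞) ^ 3 ∂m).toReal) := by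
  obtain ⟨i1, e1⟩ := integrable_natCast_pow m h1
  obtain ⟨i2, e2⟩ := integrable_natCast_pow m h2
  obtain ⟨i3, e3⟩ := integrable_natCast_pow m h3
  rw [← e1] at hb
  simp only [pow_one] at i1 hb
  rw [← e2, ← e3]
  have hb0 : 0 ≤ b := by rw [hb]; exact integral_nonneg fun k => by positivity
  have hm := (measurable_affine r b).aemeasurable (μ := m)
  have hbd : ∀ k : ℕ, |r * ((k : ℝ) - b)| ^ 3 ≤ r ^ 3 * ((k : ℝ) ^ 3 + b ^ 3) := fun k => by
    rw [abs_mul, abs_of_nonneg hr, mul_pow]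
    refine mul_le_mul_of_nonneg_left ?_ (by positivity)
    have hk : (0 : ℝ) ≤ k := by positivity
    rcases le_total (k : ℝ) b with h | h
    · have : |(k : ℝ) - b| ≤ b := by rw [abs_of_nonpos (by linarith)]; linarith
      have := pow_le_pow_left₀ (abs_nonneg _) this 3
      have : 0 ≤ (k : ℝ) ^ 3 := by positivity
      linarith
    · have : |(k : ℝ) - b| ≤ k := by rw [abs_of_nonneg (by linarith)]; linarith
      have := pow_le_pow_left₀ (abs_nonneg _) this 3
      have : 0 ≤ b ^ 3 := by positivity
      linarith
  have i4 : Integrable (fun k : ℕ => r ^ 3 * ((k : ℝ) ^ 3 + b ^ 3)) m :=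
    (i3.add (integrable_const _)).const_mul _
  have i5 : Integrable (fun k : ℕ => |r * ((k : ℝ) - b)| ^ 3) m :=
    i4.mono' (measurable_of_countable _).aestronglyMeasurable (ae_of_all _ fun k => by
      rw [Real.norm_eq_abs, abs_of_nonneg (by positivity)]; exact hbd k)
  refine ⟨?_, ?_, ?_, ?_⟩
  · rw [affineLaw, integrable_map_measure (by fun_prop) hm]
    exact i5
  · rw [affineLaw, integral_map hm (by fun_prop), integral_const_mul,
      integral_sub i1 (integrable_const _), ← hb]
    simp
  · rw [affineLaw, integral_map hm (by fun_prop)]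
    have e : ∀ k : ℕ, (r * ((k : ℝ) - b)) ^ 2 = r ^ 2 * ((k : ℝ) ^ 2 - (2 * b * k - b ^ 2)) :=
      fun k => by ring
    simp only [e]
    rw [integral_const_mul, integral_sub i2 ((i1.const_mul _).sub' (integrable_const _)),
      integral_sub (i1.const_mul _) (integrable_const _), integral_const_mul, ← hb]
    simp
    left
    ring
  · rw [affineLaw, integral_map hm (by fun_prop)]
    refine (integral_mono i5 i4 hbd).trans ?_
    rw [integral_const_mul, integral_add i3 (integrable_const _)]
    refine mul_le_mul_of_nonneg_left ?_ (by positivity)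
    -- Jensen's inequality `b³ ≤ E[k³]`, from the tangent bound `3 b² k ≤ k³ + 2 b³`; this accounts
    -- for the factor `2` in the third-moment estimate.
    have hy : ∫ k : ℕ, 3 * b ^ 2 * (k : ℝ) ∂m ≤ ∫ k : ℕ, ((k : ℝ) ^ 3 + 2 * b ^ 3) ∂m := by
      refine integral_mono (i1.const_mul _) (i3.add (integrable_const _)) fun k => ?_
      have hk : (0 : ℝ) ≤ k := by positivity
      simp only
      nlinarith [mul_nonneg (show 0 ≤ (k : ℝ) + 2 * b by positivity) (sq_nonneg ((k : ℝ) - b))]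
    rw [integral_const_mul, integral_add i3 (integrable_const _), ← hb] at hy
    simp only [integral_const, probReal_univ, one_smul] at hy ⊢
    nlinarith

end NatLaws

/-! ### Hitting times as sums of independent crossing times. -/

section QuenchedLink

variable {ω : Env}

lemma GoodEnv.crossLaw_prob (h : GoodEnv ω) (x : ℤ) : IsProbabilityMeasure (crossLaw ω x) :=
  ⟨(h x).2.1⟩

lemma GoodEnv.passLaw_prob (h : GoodEnv ω) (n : ℕ) : IsProbabilityMeasure (passLaw ω n 0) := by
  induction n with
  | zero => rw [Nat.cast_zero, passLaw_self]; infer_instance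
  | succ n ih =>
    have := h.crossLaw_prob n
    rw [Nat.cast_succ, passLaw_succ ω (by positivity)]
    rw [crossLaw] at this
    infer_instance

lemma GoodEnv.charFun_passLaw (h : GoodEnv ω) (n : ℕ) (t : ℝ) :
    charFun ((passLaw ω n 0).map fun k : ℕ => (k : ℝ)) t
      = ∏ k ∈ Finset.range n, charFun ((crossLaw ω k).map fun k : ℕ => (k : ℝ)) t := by
  induction n with
  | zero =>
    rw [Nat.cast_zero, passLaw_self, Measure.map_dirac' (measurable_of_countable _)]
    simp
  | succ n ih =>
    have h1 : ∀ a b : Measure ℕ, [IsFiniteMeasure a] → [IsFiniteMeasure b] →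
        (a ∗ b).map (fun k : ℕ => (k : ℝ))
          = (a.map fun k : ℕ => (k : ℝ)) ∗ (b.map fun k : ℕ => (k : ℝ)) := fun a b _ _ =>
      Measure.map_conv_addMonoidHom (Nat.castAddMonoidHom ℝ) (measurable_of_countable _)
    have := h.passLaw_prob n
    have := h.crossLaw_prob n
    rw [Nat.cast_succ, passLaw_succ ω (by positivity), h1, charFun_conv, ih, Finset.prod_range_succ,
      crossLaw]

lemma GoodEnv.lintegral_passLaw_one (h : GoodEnv ω) (n : ℕ) :
    ∫⁻ k, (k : ℝ≥0∞) ^ 1 ∂(passLaw ω n 0) = ∑ k ∈ Finset.range n, moment 1 ω k := by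
  induction n with
  | zero => rw [Nat.cast_zero, passLaw_self]; simp
  | succ n ih =>
    have h1 := (h.passLaw_prob n).measure_univ
    have h2 := (h n).2.1
    rw [Nat.cast_succ, lintegral_passLaw_succ ω (by positivity), Finset.sum_range_succ, ← ih, moment]
    simp only [pow_one]
    push_cast
    exact lintegral_add_pow_one _ _ h1 h2

lemma GoodEnv.lintegral_passLaw_one_lt_top (h : GoodEnv ω) (n : ℕ) :
    ∫⁻ k, (k : ℝ≥0∞) ^ 1 ∂(passLaw ω n 0) < ⊤ := by
  rw [h.lintegral_passLaw_one]
  exact ENNReal.sum_lt_top.2 fun k _ => (h k).2.2.1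

lemma GoodEnv.lintegral_passLaw_two_lt_top (h : GoodEnv ω) (n : ℕ) :
    ∫⁻ k, (k : ℝ≥0∞) ^ 2 ∂(passLaw ω n 0) < ⊤ := by
  induction n with
  | zero => rw [Nat.cast_zero, passLaw_self]; simp
  | succ n ih =>
    have h1 := (h.passLaw_prob n).measure_univ
    have h2 := h n
    have h3 := h.lintegral_passLaw_one_lt_top n
    simp only [moment, pow_one] at h2 h3
    rw [Nat.cast_succ, lintegral_passLaw_succ ω (by positivity)]
    push_cast
    change ∫⁻ i, ∫⁻ j, ((i : ℝ≥0∞) + (j : ℝ≥0∞)) ^ 2 ∂(crossLaw ω n) ∂(passLaw ω n 0) < ⊤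
    rw [lintegral_add_pow_two (fun i : ℕ => (i : ℝ≥0∞)) (fun i : ℕ => (i : ℝ≥0∞)) h1 h2.2.1]
    refine ENNReal.add_lt_top.2 ⟨ENNReal.add_lt_top.2 ⟨ih, h2.2.2.2.1⟩, ?_⟩
    exact ENNReal.mul_lt_top (ENNReal.mul_lt_top (by simp) h3) h2.2.2.1

lemma GoodEnv.ae_hitTime_lt_top (h : GoodEnv ω) (n : ℕ) :
    ∀ᵐ X ∂(quenchedLaw ω 0), hitTime n X < ⊤ :=
  RWRE.ae_hitTime_lt_top (h.passLaw_prob n).measure_univ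

lemma GoodEnv.integral_hitTimeReal (h : GoodEnv ω) (n : ℕ) {f : ℝ → ℝ} (hf : Measurable f) :
    ∫ X, f (hitTimeReal n X) ∂(quenchedLaw ω 0) = ∫ k : ℕ, f k ∂(passLaw ω n 0) := by
  rw [← integral_map (measurable_hitTimeReal n).aemeasurable hf.aestronglyMeasurable,
    map_hitTimeReal (h.passLaw_prob n).measure_univ,
    integral_map (measurable_of_countable _).aemeasurable hf.aestronglyMeasurable]

lemma GoodEnv.memLp_hitTimeReal (h : GoodEnv ω) (n : ℕ) :
    MemLp (hitTimeReal n) 2 (quenchedLaw ω 0) := by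
  have e : MemLp id 2 ((quenchedLaw ω 0).map (hitTimeReal n)) := by
    rw [map_hitTimeReal (h.passLaw_prob n).measure_univ, memLp_map_measure_iff
      aestronglyMeasurable_id (measurable_of_countable _).aemeasurable,
      memLp_two_iff_integrable_sq (measurable_of_countable _).aestronglyMeasurable]
    exact (integrable_natCast_pow _ (h.lintegral_passLaw_two_lt_top n)).1
  exact e.comp_of_map (measurable_hitTimeReal n).aemeasurable

lemma GoodEnv.quenchedMean_eq (h : GoodEnv ω) (n : ℕ) :
    quenchedMean ω n = (∫⁻ k, (k : ℝ≥0∞) ^ 1 ∂(passLaw ω n 0)).toReal := by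
  have e := h.integral_hitTimeReal n measurable_id
  simp only [id] at e
  rw [quenchedMean, e,
    ← (integrable_natCast_pow _ (h.lintegral_passLaw_one_lt_top n)).2]
  simp

lemma GoodEnv.quenchedVar_one (h : GoodEnv ω) : quenchedVar ω 1 = passVar ω 0 := by
  have := h.crossLaw_prob 0
  have hm := h.memLp_hitTimeReal 1
  have e1 := h.integral_hitTimeReal 1 measurable_id
  have e2 := h.integral_hitTimeReal 1 (f := fun x => x ^ 2) (by fun_prop)
  have i1 := (integrable_natCast_pow (crossLaw ω 0) (h 0).2.2.1).2
  have i2 := (integrable_natCast_pow (crossLaw ω 0) (h 0).2.2.2.1).2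
  rw [Nat.cast_one] at hm e1 e2
  rw [crossLaw, zero_add] at i1 i2
  simp only [id, pow_one] at e1 i1
  rw [quenchedVar, variance_eq_sub hm, passVar]
  simp only [Pi.pow_apply]
  rw [e1, e2, i1, i2]
  simp only [moment, crossLaw, zero_add, pow_one]

/-- The law of the centred and scaled hitting time. -/
lemma GoodEnv.quenchedCDF_eq (h : GoodEnv ω) (P : Measure Env) (n : ℕ) (x : ℝ) :
    quenchedCDF P ω n x = cdf (affineLaw (passLaw ω n 0) (√(sigmaSq P) * √(n : ℝ))⁻¹
      (quenchedMean ω n)) x := by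
  have := h.passLaw_prob n
  have e : affineLaw (passLaw ω n 0) (√(sigmaSq P) * √(n : ℝ))⁻¹ (quenchedMean ω n)
      = (quenchedLaw ω 0).map fun X =>
        (hitTimeReal n X - quenchedMean ω n) / (√(sigmaSq P) * √(n : ℝ)) := by
    have e1 : (fun X => (hitTimeReal n X - quenchedMean ω n) / (√(sigmaSq P) * √(n : ℝ)))
        = (fun y : ℝ => (y - quenchedMean ω n) / (√(sigmaSq P) * √(n : ℝ))) ∘ hitTimeReal n := rfl
    rw [e1, ← Measure.map_map (by fun_prop) (measurable_hitTimeReal n),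
      map_hitTimeReal (h.passLaw_prob n).measure_univ,
      Measure.map_map (by fun_prop) (measurable_of_countable _), affineLaw]
    congr 1
    ext k
    simp only [Function.comp]
    rw [div_eq_inv_mul]
  rw [cdf_eq_real, e, map_measureReal_apply
    (((measurable_hitTimeReal n).sub_const _).div_const _) measurableSet_Iic, quenchedCDF]
  rfl

/-- Quenched Berry–Esseen bound for the hitting times. -/
theorem exists_abs_quenchedCDF_sub_le (N : ℕ) : ∃ C : ℝ, 0 ≤ C ∧ ∀ {ω : Env}, GoodEnv ω →
    ∀ (P : Measure Env), 0 < sigmaSq P → ∀ (n : ℕ), 0 < n → ∀ a Γ : ℝ, 1 ≤ a → 0 < Γ →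
      8 * ∑ k ∈ Finset.range n, (moment 3 ω k).toReal ≤ Γ * (√(sigmaSq P) * √(n : ℝ)) ^ 3 →
      |(∑ k ∈ Finset.range n, passVar ω k) / (sigmaSq P * n) - 1| ≤ 1 / 2 →
      ∀ x, |quenchedCDF P ω n x - cdf (gaussianReal 0 1) x|
        ≤ C * (a ^ 2 * Γ + |(∑ k ∈ Finset.range n, passVar ω k) / (sigmaSq P * n) - 1|
          + (a ^ N)⁻¹) := by
  obtain ⟨C, hC0, hC⟩ := exists_berryEsseen_bound N
  refine ⟨C, hC0, ?_⟩
  intro ω h P hσ n hn a Γ ha hΓ hβ hδ x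
  have hn' : (0 : ℝ) < n := by exact_mod_cast hn
  set c := √(sigmaSq P) * √(n : ℝ) with hc
  have hc0 : 0 < c := by positivity
  have hc2 : c ^ 2 = sigmaSq P * n := by
    rw [hc, mul_pow, Real.sq_sqrt hσ.le, Real.sq_sqrt hn'.le]
  have := h.passLaw_prob n
  have := fun k : ℕ => h.crossLaw_prob k
  set b : ℕ → ℝ := fun k => (moment 1 ω k).toReal with hb
  have hmom := fun k : ℕ => centredLaw_moments (m := crossLaw ω k) (h k).2.2.1 (h k).2.2.2.1
    (h k).2.2.2.2 (inv_nonneg.2 hc0.le) (b := b k) rfl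
  have hmean : quenchedMean ω n = ∑ k ∈ Finset.range n, b k := by
    rw [h.quenchedMean_eq, h.lintegral_passLaw_one, ENNReal.toReal_sum (f := fun k : ℕ => moment 1 ω k) fun k _ => (h k).2.2.1.ne]
  have hvar : ∑ k ∈ Finset.range n, ∫ x, x ^ 2 ∂(affineLaw (crossLaw ω k) c⁻¹ (b k))
      = (∑ k ∈ Finset.range n, passVar ω k) / (sigmaSq P * n) := by
    rw [Finset.sum_div]
    refine Finset.sum_congr rfl fun k _ => ?_
    rw [(hmom k).2.2.1, passVar, ← hc2, inv_pow, div_eq_inv_mul]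
    rfl
  have key := hC (affineLaw (passLaw ω n 0) c⁻¹ (quenchedMean ω n))
    (integrable_affineLaw _ (h.lintegral_passLaw_one_lt_top n) _ _) (Finset.range n)
    (fun k => affineLaw (crossLaw ω k) c⁻¹ (b k)) (fun k => (hmom k).1) (fun k => (hmom k).2.1)
    (fun t => by
      simp only [charFun_affineLaw]
      rw [h.charFun_passLaw, Finset.prod_mul_distrib, ← Complex.exp_sum, hmean, ← Finset.sum_mul]
      congr 3
      push_cast
      rw [Finset.mul_sum, Finset.sum_neg_distrib]) a Γ ha hΓ
    (by
      -- The `8` in the hypothesis is `4` from the Berry–Esseen bound times `2` from centring.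
      calc 4 * ∑ k ∈ Finset.range n, ∫ x, |x| ^ 3 ∂(affineLaw (crossLaw ω k) c⁻¹ (b k))
          ≤ 4 * ∑ k ∈ Finset.range n, c⁻¹ ^ 3 * (2 * (moment 3 ω k).toReal) := by
            gcongr with k
            exact (hmom k).2.2.2
        _ = (8 * ∑ k ∈ Finset.range n, (moment 3 ω k).toReal) / c ^ 3 := by
            rw [← Finset.mul_sum, ← Finset.mul_sum, inv_pow]; ring
        _ ≤ Γ := by rwa [div_le_iff₀ (by positivity)])
    (by rw [hvar]; exact hδ) x
  rw [hvar] at key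
  rw [h.quenchedCDF_eq]
  exact key

end QuenchedLink

/-! ### Choice of parameters and almost sure rates. -/

section Rates

lemma add_one_rpow_le {n : ℕ} (hn : 0 < n) {b : ℝ} (hb : 0 ≤ b) :
    ((n : ℝ) + 1) ^ b ≤ 2 ^ b * (n : ℝ) ^ b := by
  rw [← Real.mul_rpow (by norm_num) (by positivity)]
  have : (1 : ℝ) ≤ n := by exact_mod_cast hn
  exact Real.rpow_le_rpow (by positivity) (by linarith) hb

lemma tendsto_natCast_rpow_zero {y : ℝ} (hy : y < 0) :
    Tendsto (fun n : ℕ => (n : ℝ) ^ y) atTop (𝓝 0) := by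
  have h := (tendsto_rpow_neg_atTop (neg_pos.2 hy)).comp (tendsto_natCast_atTop_atTop (R := ℝ))
  simpa [Function.comp_def] using h

/-- Optimisation of the parameters in the Berry–Esseen bound. -/
lemma tendsto_rpow_mul_zero_of_bound {S M δ : ℕ → ℝ} {s C C₁ C₂ β b θ e : ℝ} {N : ℕ}
    (hs : 0 < s) (hC : 0 ≤ C) (hC₁ : 0 ≤ C₁) (hC₂ : 0 ≤ C₂) (hβ : 0 ≤ β) (hb0 : 0 ≤ b) (hb1 : b < 1)
    (he : 0 ≤ e) (hS0 : ∀ n, 0 ≤ S n)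
    (hS : ∀ n : ℕ, 0 < n → ∀ a Γ : ℝ, 1 ≤ a → 0 < Γ → 8 * M n ≤ Γ * (s * √(n : ℝ)) ^ 3 →
      |δ n| ≤ 1 / 2 → S n ≤ C * (a ^ 2 * Γ + |δ n| + (a ^ N)⁻¹))
    (hM : ∀ n, M n ≤ C₁ * ((n : ℝ) + 1) ^ β)
    (hδ : ∀ n : ℕ, 0 < n → |δ n| ≤ C₂ * ((n : ℝ) + 1) ^ b / n)
    (h1 : θ + 2 * e + β < 3 / 2) (h2 : θ + b < 1) (h3 : θ < e * N) :
    Tendsto (fun n : ℕ => (n : ℝ) ^ θ * S n) atTop (𝓝 0) := by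
  -- The `+ 1` keeps `Γ` strictly positive even when `C₁ = 0`.
  set K := (8 * (C₁ * 2 ^ β) + 1) / s ^ 3 with hK
  have hK0 : 0 < K := by positivity
  have hδ' : ∀ n : ℕ, 0 < n → |δ n| ≤ C₂ * 2 ^ b * (n : ℝ) ^ (b - 1) := fun n hn => by
    have hn' : (0 : ℝ) < n := by exact_mod_cast hn
    calc |δ n| ≤ C₂ * ((n : ℝ) + 1) ^ b / n := hδ n hn
      _ ≤ C₂ * (2 ^ b * (n : ℝ) ^ b) / n := by
        gcongr
        exact add_one_rpow_le hn hb0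
      _ = _ := by rw [Real.rpow_sub_one hn'.ne']; ring
  have hδ0 : Tendsto (fun n : ℕ => C₂ * 2 ^ b * (n : ℝ) ^ (b - 1)) atTop (𝓝 0) := by
    simpa using (tendsto_natCast_rpow_zero (show b - 1 < 0 by linarith)).const_mul (C₂ * 2 ^ b)
  have hlim : Tendsto (fun n : ℕ => C * (K * (n : ℝ) ^ (θ + 2 * e + β - 3 / 2)
      + C₂ * 2 ^ b * (n : ℝ) ^ (θ + b - 1) + (n : ℝ) ^ (θ - e * N))) atTop (𝓝 0) := by
    have l1 := (tendsto_natCast_rpow_zero (show θ + 2 * e + β - 3 / 2 < 0 by linarith)).const_mul K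
    have l2 := (tendsto_natCast_rpow_zero (show θ + b - 1 < 0 by linarith)).const_mul (C₂ * 2 ^ b)
    have l3 := tendsto_natCast_rpow_zero (show θ - e * N < 0 by linarith)
    simpa using ((l1.add l2).add l3).const_mul C
  refine squeeze_zero' (Eventually.of_forall fun n => mul_nonneg (by positivity) (hS0 n)) ?_ hlim
  filter_upwards [eventually_gt_atTop 0, hδ0.eventually_le_const (show (0 : ℝ) < 1 / 2 by norm_num)]
    with n hn hn2
  have hn' : (0 : ℝ) < n := by exact_mod_cast hn
  have hn1 : (1 : ℝ) ≤ n := by exact_mod_cast hn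
  have hM' : 8 * M n ≤ K * (n : ℝ) ^ (β - 3 / 2) * (s * √(n : ℝ)) ^ 3 := by
    have e1 : (n : ℝ) ^ (β - 3 / 2) * √(n : ℝ) ^ 3 = (n : ℝ) ^ β := by
      rw [Real.sqrt_eq_rpow, ← Real.rpow_natCast, ← Real.rpow_mul hn'.le, ← Real.rpow_add hn']
      congr 1
      push_cast
      ring
    have e2 : K * (n : ℝ) ^ (β - 3 / 2) * (s * √(n : ℝ)) ^ 3
        = (8 * (C₁ * 2 ^ β) + 1) * (n : ℝ) ^ β := by
      rw [← e1, hK, mul_pow]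
      field_simp
    rw [e2]
    have e3 := (hM n).trans (mul_le_mul_of_nonneg_left (add_one_rpow_le hn hβ) hC₁)
    have e4 : 0 ≤ (n : ℝ) ^ β := by positivity
    nlinarith
  -- With `a = n^e` and `Γ = K n^{β - 3/2}`, the three error terms times `n^θ` have exactly the
  -- exponents made negative by `h1`, `h2` and `h3`.
  have key := hS n hn ((n : ℝ) ^ e) (K * (n : ℝ) ^ (β - 3 / 2)) (Real.one_le_rpow hn1 he)
    (by positivity) hM' ((hδ' n hn).trans hn2)
  calc (n : ℝ) ^ θ * S n
      ≤ (n : ℝ) ^ θ * (C * (((n : ℝ) ^ e) ^ 2 * (K * (n : ℝ) ^ (β - 3 / 2))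
          + C₂ * 2 ^ b * (n : ℝ) ^ (b - 1) + (((n : ℝ) ^ e) ^ N)⁻¹)) := by
        gcongr
        refine key.trans ?_
        gcongr
        exact hδ' n hn
    _ = _ := by
        have f1 : (n : ℝ) ^ (θ + 2 * e + β - 3 / 2)
            = (n : ℝ) ^ θ * ((n : ℝ) ^ e) ^ 2 * (n : ℝ) ^ (β - 3 / 2) := by
          rw [← Real.rpow_natCast, ← Real.rpow_mul hn'.le, ← Real.rpow_add hn', ← Real.rpow_add hn']
          congr 1; push_cast; ring
        have f2 : (n : ℝ) ^ (θ + b - 1) = (n : ℝ) ^ θ * (n : ℝ) ^ (b - 1) := by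
          rw [← Real.rpow_add hn']; congr 1; ring
        have f3 : (n : ℝ) ^ (θ - e * N) = (n : ℝ) ^ θ * (((n : ℝ) ^ e) ^ N)⁻¹ := by
          rw [← Real.rpow_natCast, ← Real.rpow_mul hn'.le, ← Real.rpow_neg hn'.le,
            ← Real.rpow_add hn']
          congr 1
        rw [f1, f2, f3]
        ring

lemma supDist_nonneg (P : Measure Env) (ω : Env) (n : ℕ) : 0 ≤ supDist P ω n :=
  Real.iSup_nonneg fun _ => abs_nonneg _

variable {P : Measure Env}

lemma exists_lt_of_lt_kappa {x : ℝ} (h : ENNReal.ofReal x < kappa P) :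
    ∃ p : ℝ, x < p ∧ ∫⁻ ω, rho ω 0 ^ p ∂P < 1 ∧ ENNReal.ofReal p ≤ kappa P := by
  obtain ⟨q, ⟨p, hp, hlt, rfl⟩, hq⟩ := lt_sSup_iff.1 h
  exact ⟨p, (ENNReal.ofReal_lt_ofReal_iff hp).1 hq, hlt, le_sSup ⟨p, hp, hlt, rfl⟩⟩

variable [IsProbabilityMeasure P]

lemma quenchedVar_one_ae_eq (hiid : IsIID P) {p : ℝ} (hp : 2 ≤ p)
    (h : ∫⁻ ω, rho ω 0 ^ p ∂P < 1) :
    (fun ω => quenchedVar ω 1) =ᵐ[P] fun ω => passVar ω 0 := by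
  filter_upwards [ae_goodEnv hiid hp h] with ω hω using hω.quenchedVar_one

/-- The almost sure rate of convergence under a moment condition. -/
theorem ae_tendsto_rpow_mul_supDist (hiid : IsIID P) (hnondeg : ¬ ∀ᵐ ω ∂P, ω 0 = 1) {p : ℝ}
    (hp2 : 2 < p) (hp4 : p ≤ 4) (h : ∫⁻ ω, rho ω 0 ^ p ∂P < 1) {ε : ℝ} (hε : 0 < ε) :
    ∀ᵐ ω ∂P, Tendsto (fun n : ℕ => (n : ℝ) ^ (1 - 2 / p - ε) * supDist P ω n) atTop (𝓝 0) := by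
  have hp0 : 0 < p := by linarith
  have h2p : 2 / p < 1 := (div_lt_one hp0).2 hp2
  have h2p0 : 0 < 2 / p := by positivity
  obtain ⟨b, hb, hb'⟩ := exists_between (lt_min h2p (show 2 / p < 2 / p + ε by linarith))
  obtain ⟨hb1, hb2⟩ := lt_min_iff.1 hb'
  -- With `a = n^{ε/8}`, this makes `a^{-N}` smaller than `n^{-1}`.
  obtain ⟨N, hN⟩ := exists_nat_gt (8 / ε)
  obtain ⟨C, hC0, hC⟩ := exists_abs_quenchedCDF_sub_le N
  obtain ⟨hint, hgrow⟩ := ae_sumGrowth_passVar hiid hp2 hp4 hb h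
  have hpos := integral_passVar_pos hiid hnondeg hp2.le h hint
  have hσeq : sigmaSq P = ∫ ω, passVar ω 0 ∂P :=
    integral_congr_ae (quenchedVar_one_ae_eq hiid hp2.le h)
  rw [← hσeq] at hpos hgrow
  -- The exponent is capped at `3` because the subadditivity argument needs `q / 3 ≤ 1`.
  have hq2 : 2 ≤ min p 3 := le_min hp2.le (by norm_num)
  have hq0 : 0 < min p 3 := by linarith
  have hthree := ae_sum_moment_three_le hiid hq2 (min_le_right _ _) (show 0 < ε / 6 by positivity)
    (lintegral_rho_rpow_le hq0 (min_le_left _ _) h)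
  -- With `θ = 1 - 2/p - ε` and `2e = ε/4`, this bound gives `θ + 2e + β ≤ 3/2 - ε/2`. The
  -- comparison `3 / min p 3 ≤ 1/2 + 2/p`, valid for `2 < p ≤ 4`, says that the third-moment error
  -- does not exceed the variance error.
  have hβ : 3 * (1 + ε / 6) / min p 3 ≤ 1 / 2 + 2 / p + ε / 4 := by
    have e1 : 3 * (1 + ε / 6) / min p 3 = 3 / min p 3 + ε / 2 / min p 3 := by
      field_simp; ring
    have e2 : ε / 2 / min p 3 ≤ ε / 4 := by
      rw [div_le_iff₀ hq0]; nlinarith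
    have e3 : 3 / min p 3 ≤ 1 / 2 + 2 / p := by
      rcases le_total p 3 with h3 | h3
      · rw [min_eq_left h3]
        have : 3 / p = 1 / p + 2 / p := by ring
        have : 1 / p ≤ 1 / 2 := by gcongr
        linarith
      · rw [min_eq_right h3]
        have : 2 / 4 ≤ 2 / p := by gcongr
        linarith
    linarith
  filter_upwards [ae_goodEnv hiid hp2.le h, hgrow, hthree] with ω hω ⟨C₂, hC₂⟩ ⟨C₁, hC₁0, hC₁⟩
  have hC₂0 : 0 ≤ C₂ := by simpa using hC₂ 0
  refine tendsto_rpow_mul_zero_of_bound (s := √(sigmaSq P)) (e := ε / 8) (N := N)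
    (M := fun n => ∑ k ∈ Finset.range n, (moment 3 ω k).toReal)
    (δ := fun n => (∑ k ∈ Finset.range n, passVar ω k) / (sigmaSq P * n) - 1)
    (Real.sqrt_pos.2 hpos) hC0 hC₁0 (C₂ := C₂ / sigmaSq P) (by positivity) (by positivity)
    (h2p0.le.trans hb.le) hb1 (by positivity) (supDist_nonneg P ω) ?_ hC₁ ?_ ?_ ?_ ?_
  · intro n hn a Γ ha hΓ hM hδ
    exact ciSup_le (hC hω P hpos n hn a Γ ha hΓ hM hδ)
  · intro n hn
    have hn' : (0 : ℝ) < n := by exact_mod_cast hn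
    have e : (∑ k ∈ Finset.range n, passVar ω k) / (sigmaSq P * n) - 1
        = (∑ k ∈ Finset.range n, (passVar ω k - sigmaSq P)) / (sigmaSq P * n) := by
      rw [Finset.sum_sub_distrib, Finset.sum_const, Finset.card_range, nsmul_eq_mul]
      field_simp
    simp only [e]
    rw [abs_div, abs_of_pos (show 0 < sigmaSq P * n by positivity), div_mul_eq_mul_div, div_div]
    gcongr
    exact hC₂ n
  · linarith
  · linarith
  · have : 1 < ε / 8 * N := by
      rw [div_lt_iff₀ hε] at hN
      linarith
    linarith

end Rates

end RWRE

end

/-! ### The theorem, with the moment order chosen from `κ`. -/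

theorem mainTheorem2 (P : Measure RWRE.Env) [IsProbabilityMeasure P]
    (hiid : RWRE.IsIID P)
    (hkappa : 2 < RWRE.kappa P)
    (hnondeg : ¬ ∀ᵐ ω ∂P, ω 0 = 1) :
    -- all quantities entering the quenched distribution function are well defined
    (∀ᵐ ω ∂P, ∀ n : ℕ,
      (∀ᵐ X ∂(RWRE.quenchedLaw ω 0), RWRE.hitTime n X < ⊤) ∧
      MemLp (RWRE.hitTimeReal n) 2 (RWRE.quenchedLaw ω 0)) ∧
    Integrable (fun ω => RWRE.quenchedVar ω 1) P ∧
    0 < RWRE.sigmaSq P ∧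
    -- the rates
    (4 < RWRE.kappa P → ∀ ε : ℝ, 0 < ε → ∀ᵐ ω ∂P,
      Tendsto (fun n : ℕ => (n : ℝ) ^ ((1 : ℝ) / 2 - ε) * RWRE.supDist P ω n) atTop (𝓝 0)) ∧
    (RWRE.kappa P ≤ 4 → ∀ ε : ℝ, 0 < ε → ∀ᵐ ω ∂P,
      Tendsto (fun n : ℕ =>
        (n : ℝ) ^ (1 - 2 / (RWRE.kappa P).toReal - ε) * RWRE.supDist P ω n) atTop (𝓝 0)) := by
  obtain ⟨p₀, hp₀, hlt₀, -⟩ := RWRE.exists_lt_of_lt_kappa (x := 2)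
    (by simpa using hkappa)
  have hp2 : 2 < min p₀ 4 := lt_min hp₀ (by norm_num)
  have hlt := RWRE.lintegral_rho_rpow_le (P := P) (by linarith) (min_le_left p₀ 4) hlt₀
  obtain ⟨b, hb, -⟩ := exists_between (lt_add_one (2 / min p₀ 4))
  have hint := (RWRE.ae_sumGrowth_passVar hiid hp2 (min_le_right _ _) hb hlt).1
  have hae := RWRE.quenchedVar_one_ae_eq hiid hp2.le hlt
  refine ⟨?_, hint.congr hae.symm, ?_, ?_, ?_⟩
  · filter_upwards [RWRE.ae_goodEnv hiid hp2.le hlt] with ω hω n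
    exact ⟨hω.ae_hitTime_lt_top n, hω.memLp_hitTimeReal n⟩
  · rw [RWRE.sigmaSq, integral_congr_ae hae]
    exact RWRE.integral_passVar_pos hiid hnondeg hp2.le hlt hint
  · intro h4 ε hε
    obtain ⟨p, hp, hp1, -⟩ := RWRE.exists_lt_of_lt_kappa (x := 4) (by simpa using h4)
    -- When `κ > 4` the order `p = 4` is admissible, and `1 - 2/4 = 1/2`.
    have h := RWRE.ae_tendsto_rpow_mul_supDist hiid hnondeg (p := 4) (by norm_num) le_rfl
      (RWRE.lintegral_rho_rpow_le (by norm_num) hp.le hp1) hε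
    norm_num at h ⊢
    exact h
  · intro h4 ε hε
    have htop : RWRE.kappa P ≠ ⊤ := (h4.trans_lt (by simp)).ne
    set κ := (RWRE.kappa P).toReal with hκ
    have hκeq : RWRE.kappa P = ENNReal.ofReal κ := (ENNReal.ofReal_toReal htop).symm
    have hκ2 : 2 < κ := by
      rw [hκ]
      simpa using (ENNReal.toReal_lt_toReal (by simp) htop).2 hkappa
    have hκ4 : κ ≤ 4 := by
      rw [hκ]
      simpa using (ENNReal.toReal_le_toReal htop (by simp)).2 h4
    -- The order `κ` itself need not satisfy `E[ρ^κ] < 1`. A slightly smaller `p` is used, close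
    -- enough that `2/p < 2/κ + ε`; the loss is absorbed by applying the rate with `2/κ + ε - 2/p`
    -- in place of `ε`.
    have hx : 2 / (2 / κ + ε) < κ := by
      rw [div_lt_iff₀ (by positivity), mul_add, mul_div_cancel₀ _ (by positivity)]
      have : 0 < κ * ε := by positivity
      linarith
    obtain ⟨p, hp, hp1, hpκ⟩ := RWRE.exists_lt_of_lt_kappa (P := P)
      (x := max 2 (2 / (2 / κ + ε))) (by
        rw [hκeq]
        exact (ENNReal.ofReal_lt_ofReal_iff (by linarith)).2 (max_lt hκ2 hx))
    obtain ⟨hp2, hpx⟩ := max_lt_iff.1 hp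
    have hpκ' : p ≤ κ := by
      rw [hκeq] at hpκ
      exact (ENNReal.ofReal_le_ofReal_iff (by linarith)).1 hpκ
    have hε' : 0 < 2 / κ + ε - 2 / p := by
      rw [div_lt_comm₀ (by positivity) (by linarith)] at hpx
      linarith
    have h := RWRE.ae_tendsto_rpow_mul_supDist hiid hnondeg hp2 (hpκ'.trans hκ4) hp1 hε'
    have e : 1 - 2 / p - (2 / κ + ε - 2 / p) = 1 - 2 / κ - ε := by ring
    rwa [e] at h
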